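/- Let $\mathfrak A=\{A\in \mathrm{SL}(2,\mathbb R): \operatorname{tr}A\ge 2\}\setminus\{I\}$. For $\lambda>1$ and $u<0<s$ put $$H^\lambda_{s,u}=\begin{pmatrix}s&u\\1&1\end{pmatrix}\begin{pmatrix}\lambda&0\\0&\lambda^{-1}\end{pmatrix}\begin{pmatrix}s&u\\1&1\end{pmatrix}^{-1},$$ and for $x>0$ put $P_x=\begin{pmatrix}1&0\\x&1\end{pmatrix}$. A pair $\{A,B\}\subset\mathfrak A$ is called balanced if there is $T\in \mathrm{GL}(2,\mathbb R)$ such that the unordered pair $\{T^{-1}AT,T^{-1}BT\}$ is of one of the forms * (h) $\{H^{\lambda_1}_{s_1,u_1},H^{\lambda_2}_{s_2,u_2}\}$ with $u_2<u_1<0<s_1<s_2$ and $\lambda_1,\lambda_2>1$; * (m) $\{H^{\lambda}_{s,u},P_x\}$ with $u<0<s$, $\lambda>1$, $x>0$; * (p) $\{P_x,P_y^{t}\}$ with $x,y>0$, where $^t$ denotes the transpose. A pair $\mathbb A=(A_0,A_1)$ of real $2\times2$ matrices with positive determinants is called balanced if $\{aA_0,bA_1\}\subset\mathfrak A$ is a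 balanced pair for some $a,b\in\mathbb R$. Let $\sigma$ be the one-sided shift on $\{0,1\}^{\mathbb N}$, $\mathbb N=\{1,2,\dots\}$, and let $\mathcal M$ be the set of $\sigma$-invariant Borel probability measures. For $\alpha\in[0,1]$ let $s_\alpha\in\{0,1\}^{\mathbb N}$ be the word with $n$-th letter $\lfloor n\alpha\rfloor-\lfloor (n-1)\alpha\rfloor$, and let $S_\alpha$ be the $\omega$-limit set of $s_\alpha$ under $\sigma$. The Sturmian measure $\mu_\alpha$ of slope $\alpha$ is the unique measure in $\mathcal M$ that is supported on $S_\alpha$. For $\mu\in\mathcal M$ the (top) Lyapunov exponent is $$\chi(\mathbb A,\mu)=\lim_{n\to\infty}\frac1n\int\log\|A_{i_n}\cdots A_{i_2}A_{i_1}\|\,d\mu(i_1i_2\cdots),$$ where $\|\cdot\|$ is the Hilbert–Schmidt norm, and $\mu\in\mathcal M$ is called maximizing for $\mathbb A$ if $\chi(\mathbb A,\mu)=\sup_{\nu\in\mathcal M}\chi(\mathbb A,\nu)$. Lemma 4.6. For every $\alpha\in[0,1]$ there is exactly one measure in $\mathcal M$ supported on $S_\alpha$, so $\mu_\alpha$ is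 well defined. For any balanced pair $\mathbb A$, the function $\alpha\mapsto\chi(\mathbb A,\mu_\alpha)$ is continuous and strictly concave on $[0,1]$. Therefore there is at most one $\alpha\in[0,1]$ such that $\mu_\alpha$ is a maximizing measure of $\mathbb A$. -/

import Mathlib

open MeasureTheory Filter Topology Matrix Set

/-! ### Matrices and balanced pairs -/

/-- Real `2 × 2` matrices. -/
abbrev Mat2 : Type := Matrix (Fin 2) (Fin 2) ℝ

/-- The class of unimodular matrices with trace at least `2`, the identity excluded. -/
def UnimodularTraceGeTwo (A : Mat2) : Prop :=
  A.det = 1 ∧ 2 ≤ A.trace ∧ A ≠ 1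

/-- The hyperbolic matrix `H_{s,u}^l`, with eigenvalue `l` on the line spanned by `(s,1)`
and `l⁻¹` on the line spanned by `(u,1)`. It is used only for `u < 0 < s` and `1 < l`. -/
noncomputable def hypMat (s u l : ℝ) : Mat2 :=
  !![s, u; 1, 1] * !![l, 0; 0, l⁻¹] * (!![s, u; 1, 1])⁻¹

/-- The parabolic matrix `P_x`. It is used only for `0 < x`. -/
def parMat (x : ℝ) : Mat2 := !![1, 0; x, 1]

/-- The unordered pair `{C, D}` is in one of the three normal forms (h), (m), (p). -/
def IsNormalForm (C D : Mat2) : Prop :=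
  (∃ s₁ u₁ l₁ s₂ u₂ l₂ : ℝ,
      u₂ < u₁ ∧ u₁ < 0 ∧ 0 < s₁ ∧ s₁ < s₂ ∧ 1 < l₁ ∧ 1 < l₂ ∧
      ({C, D} : Set Mat2) = {hypMat s₁ u₁ l₁, hypMat s₂ u₂ l₂}) ∨
  (∃ s u l x : ℝ, u < 0 ∧ 0 < s ∧ 1 < l ∧ 0 < x ∧
      ({C, D} : Set Mat2) = {hypMat s u l, parMat x}) ∨
  (∃ x y : ℝ, 0 < x ∧ 0 < y ∧
      ({C, D} : Set Mat2) = {parMat x, (parMat y)ᵀ})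

/-- Balanced pairs of unimodular matrices of trace at least `2`: a simultaneous conjugate is
in normal form. -/
def IsUnimodularBalancedPair (A B : Mat2) : Prop :=
  UnimodularTraceGeTwo A ∧ UnimodularTraceGeTwo B ∧
    ∃ T : GL (Fin 2) ℝ,
      IsNormalForm ((T⁻¹ : GL (Fin 2) ℝ).val * A * T.val) ((T⁻¹ : GL (Fin 2) ℝ).val * B * T.val)

/-- A pair `(M 0, M 1)` of matrices of positive determinant is balanced if some scalar multiples
of its two members form a balanced pair of unimodular matrices of trace at least `2`. -/
def IsBalancedPair (M : Fin 2 → Mat2) : Prop :=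
  0 < (M 0).det ∧ 0 < (M 1).det ∧ ∃ a b : ℝ, IsUnimodularBalancedPair (a • M 0) (b • M 1)

/-! ### The shift, invariant measures and Sturmian measures -/

/-- Infinite words `i₁ i₂ ⋯` over `{0, 1}`; the letter `iₙ` is stored at position `n - 1`. The
type carries the product topology and the product (which is the Borel) σ-algebra. -/
abbrev InfWord : Type := ℕ → Fin 2

/-- The one-sided full shift. -/
def shift (x : InfWord) : InfWord := fun n => x (n + 1)

/-- Shift-invariant Borel probability measures. -/
def IsInvariantProb (μ : Measure InfWord) : Prop :=
  IsProbabilityMeasure μ ∧ MeasurePreserving shift μ μ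

/-- The word `s_α` whose `n`-th letter (`n ≥ 1`) is `⌊nα⌋ - ⌊(n-1)α⌋`, for `α ∈ [0,1]`. -/
noncomputable def rotationWord (α : ℝ) : InfWord :=
  fun n => Fin.ofNat 2 (⌊((n : ℝ) + 1) * α⌋ - ⌊(n : ℝ) * α⌋).toNat

theorem rotationWord_spec {α : ℝ} (h0 : 0 ≤ α) (h1 : α ≤ 1) (n : ℕ) :
    (((rotationWord α n : Fin 2) : ℕ) : ℤ) = ⌊((n : ℝ) + 1) * α⌋ - ⌊(n : ℝ) * α⌋ := by
  have e : ((n : ℝ) + 1) * α = (n : ℝ) * α + α := by ring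
  have hl : ⌊(n : ℝ) * α⌋ ≤ ⌊((n : ℝ) + 1) * α⌋ := Int.floor_le_floor (by rw [e]; linarith)
  have hu : ⌊((n : ℝ) + 1) * α⌋ ≤ ⌊(n : ℝ) * α⌋ + 1 := by
    rw [← Int.floor_add_one]
    exact Int.floor_le_floor (by rw [e]; linarith)
  simp only [rotationWord, Fin.val_ofNat]
  omega

/-- The subshift `S_α`: the ω-limit set of `s_α` under the shift. -/
noncomputable def sturmianShift (α : ℝ) : Set InfWord :=
  omegaLimit atTop (fun n : ℕ => shift^[n]) {rotationWord α}

/-- `μ` is a shift-invariant Borel probability measure supported on `S_α` (a closed set). -/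
def IsSturmianMeasure (α : ℝ) (μ : Measure InfWord) : Prop :=
  IsInvariantProb μ ∧ μ (sturmianShift α)ᶜ = 0

open Classical in
/-- The Sturmian measure `μ_α` of slope `α`: the invariant probability measure supported
on `S_α`. -/
noncomputable def sturmianMeasure (α : ℝ) : Measure InfWord :=
  if h : ∃ μ : Measure InfWord, IsSturmianMeasure α μ then h.choose else 0

/-! ### Lyapunov exponents and maximizing measures -/

/-- The Hilbert–Schmidt norm `‖X‖ = √(tr (Xᵀ X))`. -/
noncomputable def hsNorm (X : Mat2) : ℝ := √((Xᵀ * X).trace)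

/-- The product `M_{iₙ} ⋯ M_{i₂} M_{i₁}` along the word `x = i₁ i₂ ⋯`. -/
def cocycle (M : Fin 2 → Mat2) (x : InfWord) : ℕ → Mat2
  | 0 => 1
  | n + 1 => M (x n) * cocycle M x n

/-- The `n`-th term of the sequence whose limit is the Lyapunov exponent. -/
noncomputable def lyapunovSeq (M : Fin 2 → Mat2) (μ : Measure InfWord) (n : ℕ) : ℝ :=
  (1 / (n : ℝ)) * ∫ x, Real.log (hsNorm (cocycle M x n)) ∂μ

/-- The (top) Lyapunov exponent `χ(M, μ)`. The limit exists for invertible matrices and invariant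
`μ`: see `tendsto_lyapunovSeq`. -/
noncomputable def lyapunovExponent (M : Fin 2 → Mat2) (μ : Measure InfWord) : ℝ :=
  limUnder atTop (lyapunovSeq M μ)

/-- `μ` is a (Lyapunov) maximizing measure of `M`. -/
def IsMaximizingMeasure (M : Fin 2 → Mat2) (μ : Measure InfWord) : Prop :=
  IsInvariantProb μ ∧ ∀ ν, IsInvariantProb ν → lyapunovExponent M ν ≤ lyapunovExponent M μ

/-! ### The limit that defines the Lyapunov exponent exists -/

theorem trace_transpose_mul_self_eq (X : Mat2) :
    (Xᵀ * X).trace = X 0 0 ^ 2 + X 0 1 ^ 2 + X 1 0 ^ 2 + X 1 1 ^ 2 := by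
  simp [Matrix.trace, Matrix.mul_apply, Fin.sum_univ_two]
  ring

theorem abs_det_le_hsNorm_sq (X : Mat2) : |X.det| ≤ hsNorm X ^ 2 := by
  rw [hsNorm, Real.sq_sqrt (by rw [trace_transpose_mul_self_eq]; positivity),
    trace_transpose_mul_self_eq, Matrix.det_fin_two, abs_le]
  constructor <;>
    nlinarith [sq_nonneg (X 0 0 - X 1 1), sq_nonneg (X 0 0 + X 1 1), sq_nonneg (X 0 1 - X 1 0),
      sq_nonneg (X 0 1 + X 1 0)]

theorem hsNorm_pos {X : Mat2} (h : X.det ≠ 0) : 0 < hsNorm X := by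
  have h1 := abs_det_le_hsNorm_sq X
  have h2 : 0 < |X.det| := abs_pos.mpr h
  have h3 : 0 ≤ hsNorm X := Real.sqrt_nonneg _
  rcases h3.eq_or_lt with h4 | h4
  · rw [← h4] at h1; norm_num at h1; exact absurd h1 h
  · exact h4

theorem hsNorm_mul_le (X Y : Mat2) : hsNorm (X * Y) ≤ hsNorm X * hsNorm Y := by
  unfold hsNorm
  rw [← Real.sqrt_mul (by rw [trace_transpose_mul_self_eq]; positivity)]
  apply Real.sqrt_le_sqrt
  simp only [trace_transpose_mul_self_eq, Matrix.mul_apply, Fin.sum_univ_two]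
  nlinarith [sq_nonneg (X 0 0 * Y 1 0 - X 0 1 * Y 0 0), sq_nonneg (X 0 0 * Y 1 1 - X 0 1 * Y 0 1),
    sq_nonneg (X 1 0 * Y 1 0 - X 1 1 * Y 0 0), sq_nonneg (X 1 0 * Y 1 1 - X 1 1 * Y 0 1)]

theorem continuous_shift : Continuous shift :=
  continuous_pi fun n => continuous_apply (n + 1)

theorem det_cocycle_ne_zero {M : Fin 2 → Mat2} (hM : ∀ i, (M i).det ≠ 0) (x : InfWord) (n : ℕ) :
    (cocycle M x n).det ≠ 0 := by
  induction n with
  | zero => simp [cocycle]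
  | succ n ih => rw [cocycle, Matrix.det_mul]; exact mul_ne_zero (hM _) ih

theorem cocycle_add (M : Fin 2 → Mat2) (x : InfWord) (m n : ℕ) :
    cocycle M x (m + n) = cocycle M (shift^[m] x) n * cocycle M x m := by
  induction n with
  | zero => simp [cocycle]
  | succ n ih =>
    have h : ∀ (k : ℕ) (y : InfWord), (shift^[k] y) n = y (k + n) := by
      intro k
      induction k with
      | zero => intro y; simp
      | succ k ihk =>
        intro y
        rw [Function.iterate_succ_apply, ihk]
        exact congrArg y (by omega)
    rw [← add_assoc, cocycle, cocycle, ih, h, Matrix.mul_assoc]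

theorem continuous_cocycle (M : Fin 2 → Mat2) (n : ℕ) :
    Continuous fun x : InfWord => cocycle M x n := by
  induction n with
  | zero => exact continuous_const
  | succ n ih =>
    have h : Continuous fun x : InfWord => M (x n) :=
      continuous_of_discreteTopology.comp (continuous_apply n)
    exact h.matrix_mul ih

theorem continuous_log_hsNorm_cocycle {M : Fin 2 → Mat2} (hM : ∀ i, (M i).det ≠ 0) (n : ℕ) :
    Continuous fun x : InfWord => Real.log (hsNorm (cocycle M x n)) := by
  refine Continuous.log ?_ fun x => (hsNorm_pos (det_cocycle_ne_zero hM x n)).ne'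
  have h := continuous_cocycle M n
  exact Real.continuous_sqrt.comp (h.matrix_transpose.matrix_mul h).matrix_trace

theorem integrable_log_hsNorm_cocycle {M : Fin 2 → Mat2} (hM : ∀ i, (M i).det ≠ 0)
    (μ : Measure InfWord) [IsFiniteMeasure μ] (n : ℕ) :
    Integrable (fun x : InfWord => Real.log (hsNorm (cocycle M x n))) μ :=
  (continuous_log_hsNorm_cocycle hM n).integrable_of_hasCompactSupport
    (HasCompactSupport.of_compactSpace _)

/-- The limit in the definition of the Lyapunov exponent exists. -/
theorem tendsto_lyapunovSeq {M : Fin 2 → Mat2} (hM : ∀ i, (M i).det ≠ 0)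
    {μ : Measure InfWord} (hμ : IsInvariantProb μ) :
    Tendsto (lyapunovSeq M μ) atTop (𝓝 (lyapunovExponent M μ)) := by
  obtain ⟨hprob, hinv⟩ := hμ
  set u : ℕ → ℝ := fun n => ∫ x, Real.log (hsNorm (cocycle M x n)) ∂μ with hu
  have hsub : Subadditive u := by
    intro m n
    have hm := integrable_log_hsNorm_cocycle hM μ m
    have hcomp : ∫ x, Real.log (hsNorm (cocycle M (shift^[m] x) n)) ∂μ = u n := by
      have hp := hinv.iterate m
      have h := integral_map (μ := μ) hp.measurable.aemeasurable
        (f := fun x : InfWord => Real.log (hsNorm (cocycle M x n)))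
        (continuous_log_hsNorm_cocycle hM n).aestronglyMeasurable
      rw [hp.map_eq] at h
      exact h.symm
    have hint : Integrable (fun x => Real.log (hsNorm (cocycle M (shift^[m] x) n))) μ :=
      ((continuous_log_hsNorm_cocycle hM n).comp
        (continuous_shift.iterate m)).integrable_of_hasCompactSupport
        (HasCompactSupport.of_compactSpace _)
    have hle : u (m + n) ≤ ∫ x, (Real.log (hsNorm (cocycle M x m)) +
        Real.log (hsNorm (cocycle M (shift^[m] x) n))) ∂μ := by
      refine integral_mono (integrable_log_hsNorm_cocycle hM μ _) (hm.add hint) fun x => ?_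
      have h1 := hsNorm_pos (det_cocycle_ne_zero hM x m)
      have h2 := hsNorm_pos (det_cocycle_ne_zero hM (shift^[m] x) n)
      have h3 := hsNorm_pos (det_cocycle_ne_zero hM x (m + n))
      dsimp only
      rw [add_comm (Real.log _), ← Real.log_mul h2.ne' h1.ne']
      refine Real.log_le_log h3 ?_
      rw [cocycle_add]
      exact hsNorm_mul_le _ _
    rw [integral_add hm hint, hcomp] at hle
    exact hle
  have hbdd : BddBelow (Set.range fun n => u n / n) := by
    set c : ℝ := min (Real.log |(M 0).det|) (Real.log |(M 1).det|) with hc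
    have hcM : ∀ i, c ≤ Real.log |(M i).det| := by
      intro i
      fin_cases i
      · exact min_le_left _ _
      · exact min_le_right _ _
    have hdet : ∀ (n : ℕ) (x : InfWord), n * c ≤ Real.log |(cocycle M x n).det| := by
      intro n x
      induction n with
      | zero => simp [cocycle]
      | succ n ih =>
        rw [cocycle, Matrix.det_mul, abs_mul, Real.log_mul (abs_pos.mpr (hM _)).ne'
          (abs_pos.mpr (det_cocycle_ne_zero hM x n)).ne']
        push_cast
        linarith [hcM (x n)]
    have hlow : ∀ (n : ℕ) (x : InfWord), n * (c / 2) ≤ Real.log (hsNorm (cocycle M x n)) := by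
      intro n x
      have h1 := Real.log_le_log (abs_pos.mpr (det_cocycle_ne_zero hM x n))
        (abs_det_le_hsNorm_sq (cocycle M x n))
      rw [Real.log_pow] at h1
      push_cast at h1
      linarith [hdet n x]
    refine ⟨min (c / 2) 0, ?_⟩
    rintro _ ⟨n, rfl⟩
    rcases Nat.eq_zero_or_pos n with rfl | hn
    · simp
    · have hn' : (0 : ℝ) < n := by exact_mod_cast hn
      have h1 : ∫ _ : InfWord, (n * (c / 2) : ℝ) ∂μ ≤ u n :=
        integral_mono (integrable_const _) (integrable_log_hsNorm_cocycle hM μ n) (hlow n)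
      have h2 : n * (c / 2) ≤ u n := by simpa using h1
      refine (min_le_left _ _).trans ?_
      dsimp only
      rw [le_div_iff₀ hn']
      linarith
  have h := hsub.tendsto_lim hbdd
  have e : lyapunovSeq M μ = fun n => u n / n := by
    funext n
    simp only [lyapunovSeq, hu]
    ring
  exact tendsto_nhds_limUnder ⟨_, by rw [e]; exact h⟩

/-!
The proof replaces the pair by a triangular one with nonnegative entries and then works with Farey
words.

*Traces.* For unimodular `A`, `B` of trace at least `2`, being balanced is a condition on
`x = tr A`, `y = tr B`, `z = tr (A B)`: `x y < 2 z` and `tr (A B A⁻¹ B⁻¹) > 2`. The commutator trace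
does not change when `(A, B)` is replaced by `(A, A B)` or by `(A B, B)`, so that all pairs of
consecutive words of the Farey tree give balanced pairs (`NonnegBalanced.traceBalanced_fareyWord`).
If `C` is the product along a Farey word `w w'`, its neighbours at later levels are the words
`w (w w') ^ j` and `(w w') ^ j w'`, and the same trace identities yield the strict inequality
`ρ(w (w w') ^ j) ρ((w w') ^ j w') < ρ(w w') ^ (2 j + 1)` for spectral radii
(`TraceBalanced.specRad_recurrence_mul_lt`). Hence the broken line that interpolates
`log ρ(w) / |w|` at the slopes of the Farey words of one level is strictly concave at its
vertices; equivalently, it is the minimum of its chords (`NonnegBalanced.fareyChord_le`).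

*Lyapunov exponents.* If `α` lies in the Farey interval of two consecutive words `v`, `w`, the
rotation by `α` has a return interval on which it reads `v` or `w`, so that the points of `S_α` are
concatenations of `v` and `w` with prescribed frequencies (`exists_parsing_coding`). A balanced pair
is simultaneously conjugate to an upper and a lower triangular nonnegative matrix, and a suitable
row vector shows that products are at least as large as the product of the spectral radii; so the
chord bounds the Lyapunov exponent from below (`NonnegBalanced.fareyChord_le_lyapunovExponent`).
Since the powers of the products along Farey words are comparable to the powers of their spectral
radii, uniformly over all words, the chords also bound it from above up to an error that tends to
`0` uniformly in `α` (`NonnegBalanced.lyapunovExponent_le_fareyChord_add`). Continuity and concavity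
follow. At the slopes of Farey words the exponent equals `log ρ(w) / |w|`, so it is affine on no
interval and therefore strictly concave.

*Sturmian measures.* The coding of Lebesgue measure on the circle is a Sturmian measure. For
uniqueness, the sets `{x | c ≤ x₁ + ⋯ + x_j}` generate the σ-algebra, form a chain on `S_α`, and
have measures determined by the frequency `α` of the letter `1`.
-/

/-! ### Trace inequalities for balanced pairs -/

/-- The larger root of `X ^ 2 - t X + 1`, that is, the spectral radius of a matrix of determinant
`1` and trace `t ≥ 2`. -/
noncomputable def specRad (t : ℝ) : ℝ := (t + √(t ^ 2 - 4)) / 2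

theorem one_le_specRad {t : ℝ} (ht : 2 ≤ t) : 1 ≤ specRad t := by
  have := Real.sqrt_nonneg (t ^ 2 - 4)
  unfold specRad
  linarith

theorem specRad_pos {t : ℝ} (ht : 2 ≤ t) : 0 < specRad t := by
  linarith [one_le_specRad ht]

theorem specRad_sq {t : ℝ} (ht : 2 ≤ t) : specRad t ^ 2 - t * specRad t + 1 = 0 := by
  have h := Real.sq_sqrt (show 0 ≤ t ^ 2 - 4 by nlinarith)
  unfold specRad
  linear_combination h / 4

theorem specRad_add_inv {t : ℝ} (ht : 2 ≤ t) : specRad t + (specRad t)⁻¹ = t := by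
  have h := specRad_sq ht
  have h0 := specRad_pos ht
  field_simp
  linarith

theorem add_inv_strictMono {l m : ℝ} (hl : 1 ≤ l) (hm : l < m) : l + l⁻¹ < m + m⁻¹ := by
  have h0 : 0 < l := by linarith
  have h1 : 0 < m := by linarith
  have h2 : 1 < l * m := by nlinarith
  have h : m + m⁻¹ - (l + l⁻¹) = (m - l) * (l * m - 1) / (l * m) := by field_simp; ring
  have : 0 < (m - l) * (l * m - 1) / (l * m) := by
    have : 0 < m - l := by linarith
    have : 0 < l * m - 1 := by linarith
    positivity
  linarith

theorem lt_of_add_inv_lt {l m : ℝ} (hm : 1 ≤ m) (h : l + l⁻¹ < m + m⁻¹) (hl : 1 ≤ l) :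
    l < m := by
  by_contra! hc
  rcases hc.eq_or_lt with rfl | hc
  · exact lt_irrefl _ h
  · linarith [add_inv_strictMono hm hc]

theorem two_le_add_inv {l : ℝ} (hl : 1 ≤ l) : 2 ≤ l + l⁻¹ := by
  rcases hl.eq_or_lt with rfl | h
  · norm_num
  · have := add_inv_strictMono le_rfl h
    norm_num at this
    linarith

theorem specRad_add_inv_self {l : ℝ} (hl : 1 ≤ l) : specRad (l + l⁻¹) = l := by
  have h2 := two_le_add_inv hl
  have h3 := specRad_add_inv h2
  rcases lt_trichotomy (specRad (l + l⁻¹)) l with h | h | h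
  · linarith [add_inv_strictMono (one_le_specRad h2) h]
  · exact h
  · linarith [add_inv_strictMono hl h]

/-- The condition on `x = tr A`, `y = tr B`, `z = tr (A B)` that characterizes balanced pairs of
unimodular matrices. The last polynomial is `tr (A B A⁻¹ B⁻¹) - 2`, so its positivity says that the
axes of `A` and `B` are disjoint; `x y < 2 z` says that they are coherently oriented. -/
def TraceBalanced (x y z : ℝ) : Prop :=
  2 ≤ x ∧ 2 ≤ y ∧ x * y < 2 * z ∧ 0 < x ^ 2 + y ^ 2 + z ^ 2 - x * y * z - 4

namespace TraceBalanced

variable {x y z : ℝ}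

theorem symm (h : TraceBalanced x y z) : TraceBalanced y x z := by
  obtain ⟨hx, hy, hz, hk⟩ := h
  exact ⟨hy, hx, by linarith, by linarith⟩

theorem two_lt (h : TraceBalanced x y z) : 2 < z := by
  obtain ⟨hx, hy, hz, hk⟩ := h
  nlinarith

/-- The commutator trace is unchanged when `(A, B)` is replaced by `(A, A B)`. -/
theorem left (h : TraceBalanced x y z) : TraceBalanced x z (x * z - y) := by
  have h2 := h.two_lt
  obtain ⟨hx, hy, hz, hk⟩ := h
  refine ⟨hx, h2.le, by nlinarith, by nlinarith⟩

theorem right (h : TraceBalanced x y z) : TraceBalanced z y (y * z - x) :=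
  h.symm.left.symm

/-- With `x = l + l⁻¹`, `y = m + m⁻¹` and `κ = x ^ 2 + y ^ 2 + z ^ 2 - x y z - 4`, the identity
`(2 z - x y) ^ 2 = (l - l⁻¹) ^ 2 (m - m⁻¹) ^ 2 + 4 κ` compares `z` with the trace
`l m + (l m)⁻¹` of a commuting pair. -/
theorem add_inv_lt {l m : ℝ} (hl : 1 ≤ l) (hm : 1 ≤ m)
    (h : TraceBalanced (l + l⁻¹) (m + m⁻¹) z) : l * m + (l * m)⁻¹ < z := by
  obtain ⟨-, -, hz, hk⟩ := h
  have hl0 : l ≠ 0 := by positivity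
  have hm0 : m ≠ 0 := by positivity
  have h1 : 0 ≤ l - l⁻¹ := by linarith [inv_le_one_of_one_le₀ hl]
  have h2 : 0 ≤ m - m⁻¹ := by linarith [inv_le_one_of_one_le₀ hm]
  have h3 : ((l - l⁻¹) * (m - m⁻¹)) ^ 2 < (2 * z - (l + l⁻¹) * (m + m⁻¹)) ^ 2 := by
    have e : (2 * z - (l + l⁻¹) * (m + m⁻¹)) ^ 2 - ((l - l⁻¹) * (m - m⁻¹)) ^ 2 =
      4 * ((l + l⁻¹) ^ 2 + (m + m⁻¹) ^ 2 + z ^ 2 - (l + l⁻¹) * (m + m⁻¹) * z - 4) := by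
      field_simp; ring
    linarith
  have h4 := lt_of_pow_lt_pow_left₀ 2 (by linarith) h3
  have e : (l + l⁻¹) * (m + m⁻¹) + (l - l⁻¹) * (m - m⁻¹) = 2 * (l * m + (l * m)⁻¹) := by
    field_simp; ring
  linarith

theorem of_add_inv_lt {l m : ℝ} (hl : 1 ≤ l) (hm : 1 ≤ m) (h : l * m + (l * m)⁻¹ < z) :
    TraceBalanced (l + l⁻¹) (m + m⁻¹) z := by
  have hl0 : l ≠ 0 := by positivity
  have hm0 : m ≠ 0 := by positivity
  have h1 : 0 ≤ l - l⁻¹ := by linarith [inv_le_one_of_one_le₀ hl]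
  have h2 : 0 ≤ m - m⁻¹ := by linarith [inv_le_one_of_one_le₀ hm]
  have e : (l + l⁻¹) * (m + m⁻¹) + (l - l⁻¹) * (m - m⁻¹) = 2 * (l * m + (l * m)⁻¹) := by
    field_simp; ring
  have h3 : (l - l⁻¹) * (m - m⁻¹) < 2 * z - (l + l⁻¹) * (m + m⁻¹) := by linarith
  have h0 : 0 ≤ (l - l⁻¹) * (m - m⁻¹) := by positivity
  refine ⟨two_le_add_inv hl, two_le_add_inv hm, by linarith, ?_⟩
  have h4 := pow_lt_pow_left₀ h3 h0 two_ne_zero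
  have e2 : (2 * z - (l + l⁻¹) * (m + m⁻¹)) ^ 2 - ((l - l⁻¹) * (m - m⁻¹)) ^ 2 =
      4 * ((l + l⁻¹) ^ 2 + (m + m⁻¹) ^ 2 + z ^ 2 - (l + l⁻¹) * (m + m⁻¹) * z - 4) := by
      field_simp; ring
  linarith

/-- The spectral radius is strictly supermultiplicative on balanced pairs. -/
theorem specRad_mul_lt (h : TraceBalanced x y z) : specRad x * specRad y < specRad z := by
  have hz := h.two_lt.le
  have hx := one_le_specRad h.1
  have hy := one_le_specRad h.2.1
  refine lt_of_add_inv_lt (one_le_specRad hz) ?_ (by nlinarith)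
  rw [specRad_add_inv hz]
  refine add_inv_lt hx hy ?_
  rwa [specRad_add_inv h.1, specRad_add_inv h.2.1]

end TraceBalanced

/-- Sequences such as `j ↦ tr (C ^ j A)`, for `C` of trace `s + s⁻¹`, in closed form. -/
theorem linear_recurrence_closed_form {s x y : ℝ} (hs : 1 < s) {a : ℕ → ℝ} (h0 : a 0 = x)
    (h1 : a 1 = (s + s⁻¹) * x - y) (h2 : ∀ j, a (j + 2) = (s + s⁻¹) * a (j + 1) - a j) (j : ℕ) :
    a j = (x * s - y) / (s - s⁻¹) * s ^ j + (y * s - x) / (s - s⁻¹) * (s⁻¹) ^ (j + 1) := by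
  have hs0 : s ≠ 0 := by positivity
  have hs1 : s - s⁻¹ ≠ 0 := by
    have := inv_lt_one_of_one_lt₀ hs
    linarith
  have e : s * s⁻¹ = 1 := mul_inv_cancel₀ hs0
  have hP : (x * s - y) / (s - s⁻¹) * (s - s⁻¹) = x * s - y := div_mul_cancel₀ _ hs1
  have hQ : (y * s - x) / (s - s⁻¹) * (s - s⁻¹) = y * s - x := div_mul_cancel₀ _ hs1
  induction j using Nat.twoStepInduction with
  | zero =>
    rw [h0]
    refine mul_right_cancel₀ hs1 ?_
    linear_combination -hP - s⁻¹ * hQ - y * e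
  | one =>
    rw [h1]
    refine mul_right_cancel₀ hs1 ?_
    linear_combination -s * hP - s⁻¹ ^ 2 * hQ + (y * (s - s⁻¹) - s * y) * e
  | more j ih1 ih2 =>
    rw [h2, ih1, ih2]
    set P := (x * s - y) / (s - s⁻¹)
    set Q := (y * s - x) / (s - s⁻¹)
    set r := s⁻¹
    linear_combination (P * s ^ j + Q * r ^ (j + 1)) * e

/-- For `C = B A` the sequences `a j = tr (C ^ j A)` and `b j = tr (B C ^ j)` satisfy
`a j * b j = u c + v` and `a j ^ 2 + b j ^ 2 = v c + 4 u` with `c = tr (C ^ (2 j + 1))` and `u`, `v`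
independent of `j`; the commutator polynomial of `(a j, b j, c)` is then `(1 - u) (c ^ 2 - 4)`, so
that it is positive for all `j` once it is positive for `j = 0`. -/
theorem TraceBalanced.specRad_recurrence_mul_lt {x y z : ℝ} (h : TraceBalanced x y z)
    {a b : ℕ → ℝ} (ha0 : a 0 = x) (ha1 : a 1 = z * x - y)
    (ha2 : ∀ j, a (j + 2) = z * a (j + 1) - a j) (hb0 : b 0 = y) (hb1 : b 1 = z * y - x)
    (hb2 : ∀ j, b (j + 2) = z * b (j + 1) - b j) (j : ℕ) (haj : 2 ≤ a j) (hbj : 2 ≤ b j) :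
    specRad (a j) * specRad (b j) < specRad z ^ (2 * j + 1) := by
  have hz := h.two_lt
  have hsz := specRad_add_inv hz.le
  have hs1 : 1 < specRad z := by
    refine lt_of_add_inv_lt (one_le_specRad hz.le) ?_ le_rfl
    rw [hsz]; linarith
  set s := specRad z with hs
  rw [← hsz] at ha1 ha2 hb1 hb2
  have ea := linear_recurrence_closed_form hs1 ha0 ha1 ha2
  have eb := linear_recurrence_closed_form hs1 hb0 hb1 hb2
  set P := (x * s - y) / (s - s⁻¹)
  set Q := (y * s - x) / (s - s⁻¹)
  have hs0 : s ≠ 0 := by positivity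
  have ex := ea 0
  have ey := eb 0
  rw [ha0] at ex
  rw [hb0] at ey
  simp only [pow_zero, mul_one, zero_add, pow_one] at ex ey
  set u := P * Q * s⁻¹ with hu
  set v := (P ^ 2 + Q ^ 2) * s⁻¹ with hv
  have e : s * s⁻¹ = 1 := mul_inv_cancel₀ hs0
  have hpow : 1 ≤ s ^ (2 * j + 1) := one_le_pow₀ hs1.le
  set c := s ^ (2 * j + 1) + (s ^ (2 * j + 1))⁻¹ with hc
  have hcz : z ≤ c := by
    rw [← hsz]
    rcases Nat.eq_zero_or_pos j with rfl | hj
    · simp [hc]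
    · exact (add_inv_strictMono hs1.le
        (lt_self_pow₀ hs1 (by omega))).le
  have hprod : a j * b j = u * c + v := by
    rw [ea, eb, hu, hv, hc]
    simp only [inv_pow]
    field_simp
    ring
  have hsum : a j ^ 2 + b j ^ 2 = v * c + 4 * u := by
    rw [ea, eb, hu, hv, hc]
    simp only [inv_pow]
    field_simp
    ring
  have hprod0 : x * y = u * z + v := by
    rw [ex, ey, hu, hv, ← hsz]
    field_simp
    ring
  have hsum0 : x ^ 2 + y ^ 2 = v * z + 4 * u := by
    rw [ex, ey, hu, hv, ← hsz]
    field_simp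
    ring
  have hk : 0 < (1 - u) * (z ^ 2 - 4) := by
    have := h.2.2.2
    rw [hsum0, hprod0] at this
    linarith
  have hu1 : 0 < 1 - u := by
    refine pos_of_mul_pos_left hk ?_
    nlinarith
  have hbal : TraceBalanced (a j) (b j) c := by
    refine ⟨haj, hbj, ?_, ?_⟩
    · have := h.2.2.1
      rw [hprod]
      nlinarith
    · rw [hsum, hprod]
      have : 0 < (1 - u) * (c ^ 2 - 4) := by
        apply mul_pos hu1
        nlinarith
      linarith
  have := hbal.specRad_mul_lt
  rwa [hc, specRad_add_inv_self hpow] at this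

/-! ### Products along finite words -/

/-- The product `N_{i_q} ⋯ N_{i_1}` along the finite word `i_1 ⋯ i_q`. -/
def wordMat (N : Fin 2 → Mat2) : List (Fin 2) → Mat2
  | [] => 1
  | i :: w => wordMat N w * N i

theorem wordMat_append (N : Fin 2 → Mat2) (v w : List (Fin 2)) :
    wordMat N (v ++ w) = wordMat N w * wordMat N v := by
  induction v with
  | nil => simp [wordMat]
  | cons i v ih => simp [wordMat, ih, Matrix.mul_assoc]

theorem wordMat_singleton (N : Fin 2 → Mat2) (i : Fin 2) : wordMat N [i] = N i := by
  simp [wordMat]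

theorem cocycle_eq_wordMat (N : Fin 2 → Mat2) (x : InfWord) (n : ℕ) :
    cocycle N x n = wordMat N ((List.range n).map x) := by
  induction n with
  | zero => rfl
  | succ n ih => rw [List.range_succ, List.map_append, wordMat_append, cocycle, ih]; simp [wordMat]

theorem det_wordMat {N : Fin 2 → Mat2} (hN : ∀ i, (N i).det = 1) (w : List (Fin 2)) :
    (wordMat N w).det = 1 := by
  induction w with
  | nil => simp [wordMat]
  | cons i w ih => simp [wordMat, Matrix.det_mul, ih, hN]

theorem wordMat_flatMap (N : Fin 2 → Mat2) (v : Fin 2 → List (Fin 2)) (b : List (Fin 2)) :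
    wordMat N (b.flatMap v) = wordMat (fun i => wordMat N (v i)) b := by
  induction b with
  | nil => rfl
  | cons i b ih => rw [List.flatMap_cons, wordMat_append, ih]; rfl

theorem wordMat_conj (N : Fin 2 → Mat2) {S T : Mat2} (h : T * S = 1) (h' : S * T = 1)
    (w : List (Fin 2)) : wordMat (fun i => S * N i * T) w = S * wordMat N w * T := by
  induction w with
  | nil => simp [wordMat, h']
  | cons i w ih =>
    rw [wordMat, ih, wordMat]
    calc S * wordMat N w * T * (S * N i * T) = S * wordMat N w * (T * S) * N i * T := by
          simp only [Matrix.mul_assoc]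
      _ = _ := by rw [h]; simp only [Matrix.mul_assoc, Matrix.one_mul]

theorem nonneg_mul {X Y : Mat2} (hX : ∀ i j, 0 ≤ X i j) (hY : ∀ i j, 0 ≤ Y i j) (i j : Fin 2) :
    0 ≤ (X * Y) i j := by
  rw [Matrix.mul_apply]
  exact Finset.sum_nonneg fun k _ => mul_nonneg (hX i k) (hY k j)

theorem nonneg_wordMat {N : Fin 2 → Mat2} (hN : ∀ i a b, 0 ≤ N i a b) (w : List (Fin 2))
    (a b : Fin 2) : 0 ≤ wordMat N w a b := by
  induction w generalizing a b with
  | nil => fin_cases a <;> fin_cases b <;> simp [wordMat]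
  | cons i w ih => exact nonneg_mul (fun a b => ih a b) (hN i) a b

/-! ### The Hilbert–Schmidt norm -/

theorem hsNorm_nonneg (X : Mat2) : 0 ≤ hsNorm X := Real.sqrt_nonneg _

theorem abs_apply_le_hsNorm (X : Mat2) (i j : Fin 2) : |X i j| ≤ hsNorm X := by
  rw [hsNorm, trace_transpose_mul_self_eq]
  refine Real.abs_le_sqrt ?_
  fin_cases i <;> fin_cases j <;> simp <;>
    nlinarith [sq_nonneg (X 0 0), sq_nonneg (X 0 1), sq_nonneg (X 1 0), sq_nonneg (X 1 1)]

theorem hsNorm_le_sum (X : Mat2) : hsNorm X ≤ |X 0 0| + |X 0 1| + |X 1 0| + |X 1 1| := by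
  rw [hsNorm, trace_transpose_mul_self_eq, Real.sqrt_le_left (by positivity)]
  have h : ∀ a : ℝ, a ^ 2 = |a| ^ 2 := fun a => (sq_abs a).symm
  rw [h (X 0 0), h (X 0 1), h (X 1 0), h (X 1 1)]
  have h0 := abs_nonneg (X 0 0)
  have h1 := abs_nonneg (X 0 1)
  have h2 := abs_nonneg (X 1 0)
  have h3 := abs_nonneg (X 1 1)
  generalize |X 0 0| = a at *
  generalize |X 0 1| = b at *
  generalize |X 1 0| = c at *
  generalize |X 1 1| = d at *
  nlinarith [mul_nonneg h0 h1, mul_nonneg h0 h2, mul_nonneg h0 h3, mul_nonneg h1 h2,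
    mul_nonneg h1 h3, mul_nonneg h2 h3]

theorem hsNorm_smul (c : ℝ) (X : Mat2) : hsNorm (c • X) = |c| * hsNorm X := by
  rw [hsNorm, hsNorm, trace_transpose_mul_self_eq, trace_transpose_mul_self_eq,
    ← Real.sqrt_sq_eq_abs, ← Real.sqrt_mul (sq_nonneg c)]
  congr 1
  simp only [Matrix.smul_apply, smul_eq_mul]
  ring

theorem hsNorm_adjugate (X : Mat2) : hsNorm X.adjugate = hsNorm X := by
  rw [hsNorm, hsNorm, trace_transpose_mul_self_eq, trace_transpose_mul_self_eq,
    Matrix.adjugate_fin_two]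
  congr 1
  simp
  ring

theorem one_le_hsNorm {X : Mat2} (h : X.det = 1) : 1 ≤ hsNorm X := by
  have h1 := abs_det_le_hsNorm_sq X
  rw [h, abs_one] at h1
  nlinarith [hsNorm_nonneg X]

theorem hsNorm_mul_mul_le (X Y Z : Mat2) :
    hsNorm (X * Y * Z) ≤ hsNorm X * hsNorm Y * hsNorm Z :=
  (hsNorm_mul_le _ _).trans
    (mul_le_mul_of_nonneg_right (hsNorm_mul_le _ _) (hsNorm_nonneg _))

theorem abs_log_hsNorm_wordMat_le {N : Fin 2 → Mat2} (hN : ∀ i, (N i).det = 1) :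
    ∃ C : ℝ, 0 ≤ C ∧ ∀ w, |Real.log (hsNorm (wordMat N w))| ≤ C * (w.length + 1) := by
  have hsqrt2 : (1 : ℝ) ≤ hsNorm 1 := one_le_hsNorm (by simp)
  set C := Real.log (hsNorm 1) + Real.log (hsNorm (N 0)) + Real.log (hsNorm (N 1)) with hC
  have h0 := Real.log_nonneg (one_le_hsNorm (hN 0))
  have h1 := Real.log_nonneg (one_le_hsNorm (hN 1))
  have h2 := Real.log_nonneg hsqrt2
  refine ⟨C, by positivity, fun w => ?_⟩
  rw [abs_of_nonneg (Real.log_nonneg (one_le_hsNorm (det_wordMat hN w)))]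
  induction w with
  | nil => simp [wordMat, hC]; linarith
  | cons i w ih =>
    have hw := one_le_hsNorm (det_wordMat hN w)
    have hi := one_le_hsNorm (hN i)
    have hiC : Real.log (hsNorm (N i)) ≤ C := by
      fin_cases i <;> simp [hC] <;> linarith
    have hwi : 1 ≤ hsNorm (wordMat N w * N i) := one_le_hsNorm (det_wordMat hN (i :: w))
    have := Real.log_le_log (by linarith) (hsNorm_mul_le (wordMat N w) (N i))
    rw [Real.log_mul (by positivity) (by positivity)] at this
    simp only [wordMat, List.length_cons, Nat.cast_add, Nat.cast_one]
    linarith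

/-- Removing a prefix and a suffix changes the norm of a unimodular product by a bounded factor. -/
theorem abs_log_hsNorm_mul_mul_sub_le {X Y Z : Mat2} (hX : X.det = 1) (hY : Y.det = 1)
    (hZ : Z.det = 1) :
    |Real.log (hsNorm (X * Y * Z)) - Real.log (hsNorm Y)| ≤
      Real.log (hsNorm X) + Real.log (hsNorm Z) := by
  have hx := one_le_hsNorm hX
  have hy := one_le_hsNorm hY
  have hz := one_le_hsNorm hZ
  have hxyz : 1 ≤ hsNorm (X * Y * Z) := one_le_hsNorm (by simp [Matrix.det_mul, hX, hY, hZ])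
  have h1 := Real.log_le_log (by linarith) (hsNorm_mul_mul_le X Y Z)
  rw [Real.log_mul (by positivity) (by positivity), Real.log_mul (by positivity) (by positivity)]
    at h1
  have e : Y = X.adjugate * (X * Y * Z) * Z.adjugate := by
    calc Y = (X.adjugate * X) * Y * (Z * Z.adjugate) := by
          rw [Matrix.adjugate_mul, Matrix.mul_adjugate, hX, hZ]; simp
      _ = _ := by simp only [Matrix.mul_assoc]
  have h2 := Real.log_le_log (by rw [← e]; linarith)
    (hsNorm_mul_mul_le X.adjugate (X * Y * Z) Z.adjugate)
  rw [← e, hsNorm_adjugate, hsNorm_adjugate, Real.log_mul (by positivity) (by positivity),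
    Real.log_mul (by positivity) (by positivity)] at h2
  rw [abs_le]
  constructor <;> linarith

/-! ### Triangular form of a balanced pair and the lower bound -/

theorem exists_eigenvector {A : Mat2} (hA : A.det = 1) (ht : 2 ≤ A.trace) :
    ∃ v : Fin 2 → ℝ, v ≠ 0 ∧ A *ᵥ v = specRad A.trace • v := by
  have hdet : (A - specRad A.trace • (1 : Mat2)).det = 0 := by
    have h := specRad_sq ht
    rw [Matrix.trace_fin_two] at *
    rw [Matrix.det_fin_two] at *
    simp
    linear_combination h + hA
  obtain ⟨v, hv, h⟩ := Matrix.exists_mulVec_eq_zero_iff.mpr hdet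
  refine ⟨v, hv, ?_⟩
  rw [Matrix.sub_mulVec, Matrix.smul_mulVec, Matrix.one_mulVec] at h
  exact sub_eq_zero.mp h

/-- An eigenvalue of a unimodular `2 × 2` matrix determines its trace. -/
theorem trace_eq_of_mulVec {C : Mat2} (hC : C.det = 1) {t : ℝ} (ht : t ≠ 0) {v : Fin 2 → ℝ}
    (hv : v ≠ 0) (h : C *ᵥ v = t • v) : C.trace = t + t⁻¹ := by
  have hdet : (C - t • (1 : Mat2)).det = 0 := by
    refine Matrix.exists_mulVec_eq_zero_iff.mp ⟨v, hv, ?_⟩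
    rw [Matrix.sub_mulVec, Matrix.smul_mulVec, Matrix.one_mulVec, h, sub_self]
  rw [Matrix.trace_fin_two]
  rw [Matrix.det_fin_two] at *
  simp at hdet
  field_simp
  linear_combination -hdet + hC

/-- A balanced pair of unimodular matrices is simultaneously conjugate to an upper and a lower
triangular matrix with nonnegative entries: take the expanding eigenvectors as a basis. -/
theorem TraceBalanced.exists_triangular {A B : Mat2} (hA : A.det = 1) (hB : B.det = 1)
    (h : TraceBalanced A.trace B.trace (A * B).trace) :
    ∃ (S T : Mat2) (p r : ℝ), S * T = 1 ∧ T * S = 1 ∧ 0 < p ∧ 0 < r ∧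
      (specRad A.trace - (specRad A.trace)⁻¹) * (specRad B.trace - (specRad B.trace)⁻¹) < p * r ∧
      S * A * T = !![specRad A.trace, p; 0, (specRad A.trace)⁻¹] ∧
      S * B * T = !![(specRad B.trace)⁻¹, 0; r, specRad B.trace] := by
  have hl1 := one_le_specRad h.1
  have hm1 := one_le_specRad h.2.1
  have hl := specRad_add_inv h.1
  have hm := specRad_add_inv h.2.1
  obtain ⟨v, hv, hAv⟩ := exists_eigenvector hA h.1
  obtain ⟨w, hw, hBw⟩ := exists_eigenvector hB h.2.1
  set l := specRad A.trace
  set m := specRad B.trace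
  have hlm : l * m + (l * m)⁻¹ < (A * B).trace := by
    refine TraceBalanced.add_inv_lt hl1 hm1 ?_
    rwa [hl, hm]
  have hl0 : l ≠ 0 := by positivity
  have hm0 : m ≠ 0 := by positivity
  set T : Mat2 := !![v 0, w 0; v 1, w 1] with hT
  -- A common eigenvector would make `l * m` an eigenvalue of `A * B`.
  have hTdet : T.det ≠ 0 := by
    intro h0
    obtain ⟨c, hc0, hc⟩ := Matrix.exists_mulVec_eq_zero_iff.mpr h0
    have e0 : v 0 * c 0 + w 0 * c 1 = 0 := by
      simpa [hT, Matrix.mulVec, dotProduct, Fin.sum_univ_two] using congrFun hc 0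
    have e1 : v 1 * c 0 + w 1 * c 1 = 0 := by
      simpa [hT, Matrix.mulVec, dotProduct, Fin.sum_univ_two] using congrFun hc 1
    have hc1 : c 1 ≠ 0 := by
      intro hc1
      rw [hc1] at e0 e1
      have hc00 : c 0 ≠ 0 := by
        intro hc00; apply hc0; funext i; fin_cases i <;> simpa
      apply hv
      funext i
      fin_cases i
      · simpa [hc00] using e0
      · simpa [hc00] using e1
    have hwv : w = (-(c 0) / c 1) • v := by
      funext i
      fin_cases i
      · simp; field_simp; linarith
      · simp; field_simp; linarith
    have hAw : A *ᵥ w = l • w := by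
      rw [hwv, Matrix.mulVec_smul, hAv, smul_comm]
    have hABw : (A * B) *ᵥ w = (l * m) • w := by
      rw [← Matrix.mulVec_mulVec, hBw, Matrix.mulVec_smul, hAw, smul_smul, mul_comm]
    have := trace_eq_of_mulVec (by rw [Matrix.det_mul, hA, hB, one_mul]) (mul_ne_zero hl0 hm0)
      hw hABw
    linarith
  have hTu : IsUnit T.det := isUnit_iff_ne_zero.mpr hTdet
  have hST : T⁻¹ * T = 1 := Matrix.nonsing_inv_mul _ hTu
  have hTS : T * T⁻¹ = 1 := Matrix.mul_nonsing_inv _ hTu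
  set X := T⁻¹ * A * T with hX
  set Y := T⁻¹ * B * T with hY
  have hXe : X *ᵥ ![1, 0] = l • ![1, 0] := by
    have : T *ᵥ ![1, 0] = v := by
      funext i; fin_cases i <;> simp [hT, Matrix.mulVec, dotProduct, Fin.sum_univ_two]
    rw [hX, ← Matrix.mulVec_mulVec, this, ← Matrix.mulVec_mulVec, hAv, Matrix.mulVec_smul,
      ← this, Matrix.mulVec_mulVec, hST, Matrix.one_mulVec]
  have hYe : Y *ᵥ ![0, 1] = m • ![0, 1] := by
    have : T *ᵥ ![0, 1] = w := by
      funext i; fin_cases i <;> simp [hT, Matrix.mulVec, dotProduct, Fin.sum_univ_two]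
    rw [hY, ← Matrix.mulVec_mulVec, this, ← Matrix.mulVec_mulVec, hBw, Matrix.mulVec_smul,
      ← this, Matrix.mulVec_mulVec, hST, Matrix.one_mulVec]
  have tr_conj : ∀ Z : Mat2, (T⁻¹ * Z * T).trace = Z.trace := fun Z => by
    rw [Matrix.trace_mul_comm, ← Matrix.mul_assoc, hTS, Matrix.one_mul]
  have x00 : X 0 0 = l := by
    simpa [Matrix.mulVec, dotProduct, Fin.sum_univ_two] using congrFun hXe 0
  have x10 : X 1 0 = 0 := by
    simpa [Matrix.mulVec, dotProduct, Fin.sum_univ_two] using congrFun hXe 1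
  have y01 : Y 0 1 = 0 := by
    simpa [Matrix.mulVec, dotProduct, Fin.sum_univ_two] using congrFun hYe 0
  have y11 : Y 1 1 = m := by
    simpa [Matrix.mulVec, dotProduct, Fin.sum_univ_two] using congrFun hYe 1
  have x11 : X 1 1 = l⁻¹ := by
    have := tr_conj A
    rw [← hX, Matrix.trace_fin_two, x00] at this
    linarith
  have y00 : Y 0 0 = m⁻¹ := by
    have := tr_conj B
    rw [← hY, Matrix.trace_fin_two, y11] at this
    linarith
  have hXY : (A * B).trace = l * m⁻¹ + X 0 1 * Y 1 0 + l⁻¹ * m := by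
    have e : T⁻¹ * (A * B) * T = X * Y := by
      calc T⁻¹ * (A * B) * T = T⁻¹ * A * 1 * (B * T) := by
            simp only [Matrix.mul_assoc, Matrix.one_mul]
        _ = X * Y := by rw [← hTS]; simp only [hX, hY, Matrix.mul_assoc]
    rw [← tr_conj (A * B), e, Matrix.trace_fin_two]
    simp only [Matrix.mul_apply, Fin.sum_univ_two, x00, x10, x11, y00, y01, y11]
    ring
  have hpr : (l - l⁻¹) * (m - m⁻¹) < X 0 1 * Y 1 0 := by
    rw [hXY, mul_inv] at hlm
    nlinarith
  have hpr0 : 0 < X 0 1 * Y 1 0 := by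
    refine lt_of_le_of_lt (mul_nonneg ?_ ?_) hpr
    · linarith [inv_le_one_of_one_le₀ hl1]
    · linarith [inv_le_one_of_one_le₀ hm1]
  have eX : X = !![l, X 0 1; 0, l⁻¹] := by
    rw [Matrix.eta_fin_two X, x00, x10, x11]; simp
  have eY : Y = !![m⁻¹, 0; Y 1 0, m] := by
    rw [Matrix.eta_fin_two Y, y00, y01, y11]; simp
  rcases pos_and_pos_or_neg_and_neg_of_mul_pos hpr0 with ⟨hp, hr⟩ | ⟨hp, hr⟩
  · exact ⟨T⁻¹, T, X 0 1, Y 1 0, hST, hTS, hp, hr, hpr, eX, eY⟩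
  · have hJ : (!![1, 0; 0, -1] : Mat2) * !![1, 0; 0, -1] = 1 := by
      ext i j; fin_cases i <;> fin_cases j <;> simp
    refine ⟨!![1, 0; 0, -1] * T⁻¹, T * !![1, 0; 0, -1], -X 0 1, -Y 1 0, ?_, ?_, by linarith,
      by linarith, by linarith, ?_, ?_⟩
    · calc _ = !![1, 0; 0, -1] * (T⁻¹ * T) * !![1, 0; 0, -1] := by simp only [Matrix.mul_assoc]
        _ = 1 := by rw [hST, Matrix.mul_one, hJ]
    · calc _ = T * (!![1, 0; 0, -1] * !![1, 0; 0, -1]) * T⁻¹ := by simp only [Matrix.mul_assoc]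
        _ = 1 := by rw [hJ, Matrix.mul_one, hTS]
    · calc _ = !![1, 0; 0, -1] * X * !![1, 0; 0, -1] := by simp only [hX, Matrix.mul_assoc]
        _ = _ := by rw [eX]; simp
    · calc _ = !![1, 0; 0, -1] * Y * !![1, 0; 0, -1] := by simp only [hY, Matrix.mul_assoc]
        _ = _ := by rw [eY]; simp

/-- In triangular form, the row vector `(l - l⁻¹, p)` is multiplied by `l` by the first matrix and
by at least `m` by the second one, so that every product expands it at least by the product of the
spectral radii. -/
theorem le_wordMat_of_triangular {l m p r : ℝ} (hl : 1 ≤ l) (hm : 1 ≤ m) (hp : 0 < p)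
    (hr : 0 < r) (h : (l - l⁻¹) * (m - m⁻¹) ≤ p * r) (b : List (Fin 2)) :
    l ^ b.count 0 * m ^ b.count 1 * (l - l⁻¹) ≤
        (l - l⁻¹) * wordMat ![!![l, p; 0, l⁻¹], !![m⁻¹, 0; r, m]] b 0 0 +
          p * wordMat ![!![l, p; 0, l⁻¹], !![m⁻¹, 0; r, m]] b 1 0 ∧
      l ^ b.count 0 * m ^ b.count 1 * p ≤
        (l - l⁻¹) * wordMat ![!![l, p; 0, l⁻¹], !![m⁻¹, 0; r, m]] b 0 1 +
          p * wordMat ![!![l, p; 0, l⁻¹], !![m⁻¹, 0; r, m]] b 1 1 := by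
  have hl0 : 0 < l⁻¹ := by positivity
  have hm0 : 0 < m⁻¹ := by positivity
  have hll : l * l⁻¹ = 1 := mul_inv_cancel₀ (by positivity)
  have hmm : m * m⁻¹ = 1 := mul_inv_cancel₀ (by positivity)
  induction b with
  | nil => simp [wordMat]
  | cons i b ih =>
    obtain ⟨ih0, ih1⟩ := ih
    set Z := wordMat ![!![l, p; 0, l⁻¹], !![m⁻¹, 0; r, m]] b
    have hR : 0 ≤ l ^ b.count 0 * m ^ b.count 1 := by positivity
    set R := l ^ b.count 0 * m ^ b.count 1 with hRdef
    match i with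
    | 0 =>
      have e : l ^ (0 :: b).count 0 * m ^ (0 :: b).count 1 = R * l := by
        simp [pow_succ, hRdef]; ring
      rw [e]
      simp only [wordMat, Matrix.mul_apply, Fin.sum_univ_two]
      simp
      constructor
      · nlinarith
      · nlinarith [mul_le_mul_of_nonneg_right ih0 hp.le, mul_le_mul_of_nonneg_right ih1 hl0.le]
    | 1 =>
      have e : l ^ (1 :: b).count 0 * m ^ (1 :: b).count 1 = R * m := by
        simp [pow_succ, hRdef]; ring
      rw [e]
      simp only [wordMat, Matrix.mul_apply, Fin.sum_univ_two]
      simp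
      constructor
      · nlinarith [mul_le_mul_of_nonneg_right ih0 hm0.le, mul_le_mul_of_nonneg_right ih1 hr.le,
          mul_le_mul_of_nonneg_left h hR]
      · nlinarith

/-- Products of a balanced pair have norm at least the product of the spectral radii, up to a
constant that depends on the pair. -/
theorem TraceBalanced.le_hsNorm_wordMat {A B : Mat2} (hA : A.det = 1) (hB : B.det = 1)
    (h : TraceBalanced A.trace B.trace (A * B).trace) :
    ∃ c : ℝ, 0 < c ∧ ∀ b : List (Fin 2),
      c * (specRad A.trace ^ b.count 0 * specRad B.trace ^ b.count 1) ≤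
        hsNorm (wordMat ![A, B] b) := by
  obtain ⟨S, T, p, r, hST, hTS, hp, hr, hpr, hX, hY⟩ := h.exists_triangular hA hB
  have hl1 := one_le_specRad h.1
  have hm1 := one_le_specRad h.2.1
  set l := specRad A.trace
  set m := specRad B.trace
  have hS : 0 < hsNorm S := hsNorm_pos fun h0 => by
    have := congrArg Matrix.det hST
    rw [Matrix.det_mul, h0] at this
    simp at this
  have hT : 0 < hsNorm T := hsNorm_pos fun h0 => by
    have := congrArg Matrix.det hST
    rw [Matrix.det_mul, h0] at this
    simp at this
  have hll : 0 ≤ l - l⁻¹ := by linarith [inv_le_one_of_one_le₀ hl1]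
  refine ⟨p / ((l - l⁻¹ + p) * (hsNorm S * hsNorm T)), by positivity, fun b => ?_⟩
  have e : (fun i => S * ![A, B] i * T) =
      ![!![l, p; 0, l⁻¹], !![m⁻¹, 0; r, m]] := by
    funext i
    match i with
    | 0 => exact hX
    | 1 => exact hY
  have h1 := (le_wordMat_of_triangular hl1 hm1 hp hr hpr.le b).2
  rw [← e, wordMat_conj _ hTS hST] at h1
  set Z := S * wordMat ![A, B] b * T with hZ
  have h2 := (le_abs_self _).trans (abs_apply_le_hsNorm Z 0 1)
  have h3 := (le_abs_self _).trans (abs_apply_le_hsNorm Z 1 1)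
  have h4 := hsNorm_mul_mul_le S (wordMat ![A, B] b) T
  rw [← hZ] at h4
  rw [div_mul_eq_mul_div, div_le_iff₀ (by positivity)]
  calc p * (l ^ b.count 0 * m ^ b.count 1) ≤ (l - l⁻¹ + p) * hsNorm Z := by
        nlinarith [mul_le_mul_of_nonneg_left h2 hll, mul_le_mul_of_nonneg_left h3 hp.le]
    _ ≤ (l - l⁻¹ + p) * (hsNorm S * hsNorm (wordMat ![A, B] b) * hsNorm T) :=
        mul_le_mul_of_nonneg_left h4 (by positivity)
    _ = _ := by ring

/-! ### Powers of unimodular matrices and the upper bound -/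

theorem sq_eq_of_det_eq_one {W : Mat2} (hW : W.det = 1) : W * W = W.trace • W - 1 := by
  rw [Matrix.det_fin_two] at hW
  ext i j
  fin_cases i <;> fin_cases j <;>
    simp [Matrix.mul_apply, Fin.sum_univ_two, Matrix.trace_fin_two] <;>
    first | ring1 | linear_combination -hW

/-- The linear recurrence for `j ↦ tr (X W ^ j Y)`, from the Cayley–Hamilton theorem. -/
theorem trace_mul_pow_recurrence {W : Mat2} (hW : W.det = 1) (X : Mat2) (j : ℕ) :
    (W ^ (j + 2) * X).trace = W.trace * (W ^ (j + 1) * X).trace - (W ^ j * X).trace := by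
  have e : W ^ (j + 2) = W.trace • W ^ (j + 1) - W ^ j := by
    rw [pow_add, pow_two, sq_eq_of_det_eq_one hW, Matrix.mul_sub, Matrix.mul_smul, ← pow_succ,
      Matrix.mul_one]
  rw [e, Matrix.sub_mul, Matrix.smul_mul, Matrix.trace_sub, Matrix.trace_smul, smul_eq_mul]

theorem trace_pow_eq {W : Mat2} (hW : W.det = 1) (ht : 2 ≤ W.trace) (a : ℕ) :
    (W ^ a).trace = specRad W.trace ^ a + (specRad W.trace)⁻¹ ^ a := by
  have hs := specRad_add_inv ht
  have h0 := (specRad_pos ht).ne'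
  have key := trace_mul_pow_recurrence hW 1
  simp only [Matrix.mul_one] at key
  generalize specRad W.trace = s at *
  have e : s * s⁻¹ = 1 := mul_inv_cancel₀ h0
  induction a using Nat.twoStepInduction with
  | zero => simp; norm_num
  | one => simp [hs]
  | more a ih1 ih2 =>
    rw [key, ih1, ih2, ← hs]
    linear_combination (s ^ a + s⁻¹ ^ a) * e

theorem abs_pow_apply_le {W : Mat2} (hW : W.det = 1) (ht : 2 ≤ W.trace) (i j : Fin 2) (a : ℕ) :
    |(W ^ a) i j| ≤
      (1 + a) * (1 + |(W - (specRad W.trace)⁻¹ • (1 : Mat2)) i j|) * specRad W.trace ^ a := by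
  have hs := specRad_add_inv ht
  have h1 := one_le_specRad ht
  set s := specRad W.trace
  set V := W - s⁻¹ • (1 : Mat2) with hV
  have hs0 : s ≠ 0 := by positivity
  have e : s⁻¹ * s = 1 := inv_mul_cancel₀ hs0
  have hWV : W * V = s • V := by
    rw [hV, Matrix.mul_sub, sq_eq_of_det_eq_one hW, ← hs, Matrix.mul_smul, Matrix.mul_one, smul_sub,
      smul_smul, mul_comm s, e, one_smul, add_smul]
    abel
  have hWaV : ∀ a : ℕ, W ^ a * V = s ^ a • V := by
    intro a
    induction a with
    | zero => simp
    | succ a ih => rw [pow_succ, Matrix.mul_assoc, hWV, Matrix.mul_smul, ih, smul_smul, pow_succ']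
  induction a with
  | zero =>
    have : |(1 : Mat2) i j| ≤ 1 := by fin_cases i <;> fin_cases j <;> simp
    simp only [pow_zero, Nat.cast_zero, add_zero, one_mul, mul_one]
    linarith [abs_nonneg (V i j)]
  | succ a ih =>
    have e2 : W ^ (a + 1) = s⁻¹ • W ^ a + s ^ a • V := by
      rw [← hWaV, hV, Matrix.mul_sub, Matrix.mul_smul, Matrix.mul_one, ← pow_succ]
      abel
    have h2 : s⁻¹ ≤ 1 := inv_le_one_of_one_le₀ h1
    have h3 : 0 ≤ s⁻¹ := by positivity
    have hsa : 1 ≤ s ^ a := one_le_pow₀ h1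
    have hsa' : s ^ a ≤ s ^ (a + 1) := pow_le_pow_right₀ h1 (by omega)
    rw [e2, Matrix.add_apply, Matrix.smul_apply, Matrix.smul_apply, smul_eq_mul, smul_eq_mul]
    have hVn := abs_nonneg (V i j)
    calc |s⁻¹ * (W ^ a) i j + s ^ a * V i j|
        ≤ s⁻¹ * |(W ^ a) i j| + s ^ a * |V i j| := by
          refine (abs_add_le _ _).trans (le_of_eq ?_)
          rw [abs_mul, abs_mul, abs_of_nonneg h3, abs_of_nonneg (by positivity : 0 ≤ s ^ a)]
      _ ≤ |(W ^ a) i j| + s ^ a * |V i j| := by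
          nlinarith [abs_nonneg ((W ^ a) i j)]
      _ ≤ (1 + a) * (1 + |V i j|) * s ^ a + s ^ a * (1 + |V i j|) := by nlinarith
      _ = (1 + ((a + 1 : ℕ) : ℝ)) * (1 + |V i j|) * s ^ a := by push_cast; ring
      _ ≤ _ := by gcongr

theorem exists_one_add_le_exp {ε : ℝ} (hε : 0 < ε) :
    ∃ C : ℝ, 0 < C ∧ ∀ a : ℕ, (1 + a : ℝ) ≤ C * Real.exp (ε * a) := by
  refine ⟨1 + ε⁻¹, by positivity, fun a => ?_⟩
  have h1 := Real.add_one_le_exp (ε * a)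
  have h2 : 1 ≤ Real.exp (ε * a) := Real.one_le_exp (by positivity)
  have h3 : (a : ℝ) ≤ ε⁻¹ * Real.exp (ε * a) := by
    rw [inv_mul_eq_div, le_div_iff₀ hε]
    linarith
  linarith

/-- The norms of the powers of a unimodular matrix of trace at least `2` grow subexponentially
relative to the spectral radius. -/
theorem exists_hsNorm_pow_le {W : Mat2} (hW : W.det = 1) (ht : 2 ≤ W.trace) {ε : ℝ} (hε : 0 < ε) :
    ∃ K : ℝ, 1 ≤ K ∧ ∀ a : ℕ,
      hsNorm (W ^ a) ≤ K * (Real.exp (ε * a) * specRad W.trace ^ a) := by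
  obtain ⟨C, hC, h⟩ := exists_one_add_le_exp hε
  have h1 := one_le_specRad ht
  have key := abs_pow_apply_le hW ht
  set s := specRad W.trace
  set V := W - s⁻¹ • (1 : Mat2)
  set D := (1 + |V 0 0|) + (1 + |V 0 1|) + (1 + |V 1 0|) + (1 + |V 1 1|) with hD
  have hD0 : 0 < D := by positivity
  refine ⟨max 1 (C * D), le_max_left _ _, fun a => ?_⟩
  have h2 : hsNorm (W ^ a) ≤ (1 + a) * D * s ^ a := by
    refine (hsNorm_le_sum _).trans ?_
    linarith [key 0 0 a, key 0 1 a, key 1 0 a, key 1 1 a]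
  calc hsNorm (W ^ a) ≤ (1 + a) * D * s ^ a := h2
    _ ≤ C * Real.exp (ε * a) * D * s ^ a := by gcongr; exact h a
    _ = C * D * (Real.exp (ε * a) * s ^ a) := by ring
    _ ≤ _ := by gcongr; exact le_max_right _ _

/-- Balanced pairs with nonnegative entries; `N 0 * N 1` is asked to have positive entries, which
makes products that contain this factor comparable with their traces. -/
structure NonnegBalanced (N : Fin 2 → Mat2) : Prop where
  det_eq_one : ∀ i, (N i).det = 1
  nonneg : ∀ i a b, 0 ≤ N i a b
  pos : ∀ a b, 0 < (N 0 * N 1) a b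
  traceBalanced : TraceBalanced (N 0).trace (N 1).trace (N 1 * N 0).trace

/-- If `W = N 1 * U * N 0` then `W ^ a = N 1 * V * N 0` with `V` nonnegative, and `tr (W ^ a)` is
the trace of `V * (N 0 * N 1)`, hence comparable with the norm of `W ^ a`. -/
theorem NonnegBalanced.exists_hsNorm_pow_le {N : Fin 2 → Mat2} (hN : NonnegBalanced N) :
    ∃ K : ℝ, 1 ≤ K ∧ ∀ u : List (Fin 2), 2 ≤ (wordMat N (0 :: (u ++ [1]))).trace → ∀ a : ℕ,
      hsNorm (wordMat N (0 :: (u ++ [1])) ^ a) ≤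
        K * specRad (wordMat N (0 :: (u ++ [1]))).trace ^ a := by
  obtain ⟨hdet, hnn, hpos, -⟩ := hN
  obtain ⟨c, hc, hcP⟩ : ∃ c : ℝ, 0 < c ∧ ∀ a b, c ≤ (N 0 * N 1) a b := by
    refine ⟨min (min ((N 0 * N 1) 0 0) ((N 0 * N 1) 0 1))
      (min ((N 0 * N 1) 1 0) ((N 0 * N 1) 1 1)), by simp [hpos], fun a b => ?_⟩
    fin_cases a <;> fin_cases b <;> simp
  have hn0 := one_le_hsNorm (hdet 0)
  have hn1 := one_le_hsNorm (hdet 1)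
  refine ⟨hsNorm 1 + 2 * (hsNorm (N 1) * hsNorm (N 0)) / c, ?_, fun u ht a => ?_⟩
  · have : 1 ≤ hsNorm (1 : Mat2) := one_le_hsNorm (by simp)
    have : 0 ≤ 2 * (hsNorm (N 1) * hsNorm (N 0)) / c := by positivity
    linarith
  set W := wordMat N (0 :: (u ++ [1])) with hW
  have hWdet : W.det = 1 := det_wordMat hdet _
  have eW : W = N 1 * wordMat N u * N 0 := by
    rw [hW, wordMat, wordMat_append, wordMat_singleton]
  have h1 := one_le_specRad ht
  have htr := trace_pow_eq hWdet ht a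
  set s := specRad W.trace
  have hsa : 1 ≤ s ^ a := one_le_pow₀ h1
  have hn : 0 ≤ hsNorm (1 : Mat2) := hsNorm_nonneg _
  rcases Nat.eq_zero_or_pos a with rfl | ha
  · simp only [pow_zero, mul_one, le_add_iff_nonneg_right]
    positivity
  obtain ⟨V, hV, eV⟩ : ∃ V : Mat2, (∀ i j, 0 ≤ V i j) ∧ W ^ a = N 1 * V * N 0 := by
    induction a, ha using Nat.le_induction with
    | base => exact ⟨wordMat N u, nonneg_wordMat hnn u, by rw [pow_one, eW]⟩
    | succ a ha ih =>
      obtain ⟨V, hV, eV⟩ := ih (trace_pow_eq hWdet ht a) (one_le_pow₀ h1)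
      refine ⟨V * N 0 * N 1 * wordMat N u, nonneg_mul (nonneg_mul (nonneg_mul hV (hnn 0)) (hnn 1))
        (nonneg_wordMat hnn u), ?_⟩
      rw [pow_succ, eV, eW]
      simp only [Matrix.mul_assoc]
  have h2 : (W ^ a).trace = (V * (N 0 * N 1)).trace := by
    rw [eV, Matrix.mul_assoc, Matrix.trace_mul_comm, Matrix.mul_assoc]
  have h3 : c * hsNorm V ≤ (W ^ a).trace := by
    rw [h2, Matrix.trace_fin_two]
    generalize N 0 * N 1 = Q at hcP
    simp only [Matrix.mul_apply, Fin.sum_univ_two]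
    have h4 := hsNorm_le_sum V
    rw [abs_of_nonneg (hV 0 0), abs_of_nonneg (hV 0 1), abs_of_nonneg (hV 1 0),
      abs_of_nonneg (hV 1 1)] at h4
    nlinarith [mul_le_mul_of_nonneg_left (hcP 0 0) (hV 0 0),
      mul_le_mul_of_nonneg_left (hcP 1 0) (hV 0 1),
      mul_le_mul_of_nonneg_left (hcP 0 1) (hV 1 0), mul_le_mul_of_nonneg_left (hcP 1 1) (hV 1 1)]
  have h5 : (s⁻¹) ^ a ≤ 1 := pow_le_one₀ (by positivity) (inv_le_one_of_one_le₀ h1)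
  have h6 : hsNorm V ≤ 2 * s ^ a / c := by
    rw [le_div_iff₀ hc]
    linarith
  have h7 : hsNorm (W ^ a) ≤ hsNorm (N 1) * hsNorm V * hsNorm (N 0) := by
    rw [eV]; exact hsNorm_mul_mul_le _ _ _
  calc hsNorm (W ^ a) ≤ hsNorm (N 1) * (2 * s ^ a / c) * hsNorm (N 0) := by
        refine h7.trans ?_
        gcongr
    _ = 2 * (hsNorm (N 1) * hsNorm (N 0)) / c * s ^ a := by ring
    _ ≤ _ := by
        gcongr
        linarith

/-- Grouping a product of two matrices into runs of the first one: only the number of occurrences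
of the second one costs a constant factor. -/
theorem hsNorm_wordMat_le_of_runs {A B : Mat2} {K L s t : ℝ} (hK : 1 ≤ K) (hL : 0 ≤ L)
    (hs : 0 ≤ s) (ht : 0 ≤ t) (hA : ∀ a : ℕ, hsNorm (A ^ a) ≤ K * (L ^ a * s ^ a))
    (hB : hsNorm B ≤ K * t) (i j : Fin 2) (hij : ∀ k, k = i ∨ k = j) (hne : i ≠ j)
    {P : Fin 2 → Mat2} (hPi : P i = A) (hPj : P j = B) (b : List (Fin 2)) (m : ℕ) :
    hsNorm (A ^ m * wordMat P b) ≤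
      K ^ (2 * b.count j + 1) * (L ^ (b.count i + m) * (s ^ (b.count i + m) * t ^ b.count j)) := by
  have hK0 : 0 ≤ K := by linarith
  induction b using List.reverseRecOn generalizing m with
  | nil => simpa [wordMat] using hA m
  | append_singleton b k ih =>
    rw [wordMat_append, wordMat_singleton]
    rcases hij k with rfl | rfl
    · rw [hPi, ← Matrix.mul_assoc, ← pow_succ]
      refine (ih (m + 1)).trans (le_of_eq ?_)
      simp [List.count_append, hne, add_assoc, add_comm 1 m]
    · rw [hPj, ← Matrix.mul_assoc]
      have h0 := ih 0
      rw [pow_zero, Matrix.one_mul, add_zero] at h0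
      have e1 : (b ++ [k]).count k = b.count k + 1 := by simp
      have e2 : (b ++ [k]).count i = b.count i := by simp [List.count_append, hne.symm]
      rw [e1, e2]
      calc hsNorm (A ^ m * B * wordMat P b)
          ≤ hsNorm (A ^ m) * hsNorm B * hsNorm (wordMat P b) := hsNorm_mul_mul_le _ _ _
        _ ≤ (K * (L ^ m * s ^ m)) * (K * t) * (K ^ (2 * b.count k + 1) *
              (L ^ b.count i * (s ^ b.count i * t ^ b.count k))) := by
            have := hsNorm_nonneg (wordMat P b)
            have := hsNorm_nonneg B
            gcongr
            exact hA m
        _ = _ := by ring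

/-! ### Farey words -/

/-- The `k`-th word (`0 ≤ k ≤ 2 ^ n`) of level `n` in the Farey tree of lower Christoffel words:
level `0` consists of the words `0` and `1`, and the next level is obtained by inserting between
consecutive words their concatenation. (For `k > 2 ^ n` the value is irrelevant.) -/
def fareyWord : ℕ → ℕ → List (Fin 2)
  | 0, k => if k = 0 then [0] else [1]
  | n + 1, k =>
    if k % 2 = 0 then fareyWord n (k / 2) else fareyWord n (k / 2) ++ fareyWord n (k / 2 + 1)

theorem fareyWord_even (n k : ℕ) : fareyWord (n + 1) (2 * k) = fareyWord n k := by
  simp [fareyWord]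

theorem fareyWord_odd (n k : ℕ) :
    fareyWord (n + 1) (2 * k + 1) = fareyWord n k ++ fareyWord n (k + 1) := by
  have h1 : (2 * k + 1) % 2 = 1 := by omega
  have h2 : (2 * k + 1) / 2 = k := by omega
  simp [fareyWord, h1, h2]

theorem fareyWord_odd_add_one (n k : ℕ) :
    fareyWord (n + 1) (2 * k + 1 + 1) = fareyWord n (k + 1) :=
  fareyWord_even n (k + 1)

theorem fareyWord_two_pow_mul (n m k : ℕ) : fareyWord (n + m) (2 ^ m * k) = fareyWord n k := by
  induction m with
  | zero => simp
  | succ m ih => rw [← add_assoc, pow_succ', mul_assoc, fareyWord_even, ih]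

theorem one_le_length_fareyWord (n k : ℕ) : 1 ≤ (fareyWord n k).length := by
  induction n generalizing k with
  | zero => unfold fareyWord; split_ifs <;> simp
  | succ n ih =>
    rcases Nat.even_or_odd' k with ⟨j, rfl | rfl⟩
    · rw [fareyWord_even]; exact ih j
    · rw [fareyWord_odd, List.length_append]; have := ih j; omega

theorem le_length_fareyWord_add (n k : ℕ) :
    n + 2 ≤ (fareyWord n k).length + (fareyWord n (k + 1)).length := by
  induction n generalizing k with
  | zero => have := one_le_length_fareyWord 0 k; have := one_le_length_fareyWord 0 (k + 1); omega
  | succ n ih =>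
    rcases Nat.even_or_odd' k with ⟨j, rfl | rfl⟩
    · rw [fareyWord_even, fareyWord_odd, List.length_append]
      have := ih j; have := one_le_length_fareyWord n j; omega
    · rw [fareyWord_odd, fareyWord_odd_add_one, List.length_append]
      have := ih j; have := one_le_length_fareyWord n (j + 1); omega

theorem fareyWord_zero (n : ℕ) : fareyWord n 0 = [0] := by
  induction n with
  | zero => simp [fareyWord]
  | succ n ih => exact (fareyWord_even n 0).trans ih

theorem fareyWord_two_pow (n : ℕ) : fareyWord n (2 ^ n) = [1] := by
  induction n with
  | zero => simp [fareyWord]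
  | succ n ih => rw [pow_succ', fareyWord_even]; exact ih

theorem fareyWord_starts_with_zero (n k : ℕ) (hk : k < 2 ^ n) : ∃ u, fareyWord n k = 0 :: u := by
  induction n generalizing k with
  | zero => exact ⟨[], by simp at hk; simp [fareyWord, hk]⟩
  | succ n ih =>
    rw [pow_succ'] at hk
    rcases Nat.even_or_odd' k with ⟨j, rfl | rfl⟩
    · rw [fareyWord_even]; exact ih j (by omega)
    · obtain ⟨u, hu⟩ := ih j (by omega)
      exact ⟨u ++ fareyWord n (j + 1), by rw [fareyWord_odd, hu]; rfl⟩

theorem fareyWord_ends_with_one (n k : ℕ) (hk : 1 ≤ k) : ∃ u, fareyWord n k = u ++ [1] := by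
  induction n generalizing k with
  | zero => exact ⟨[], by simp [fareyWord]; omega⟩
  | succ n ih =>
    rcases Nat.even_or_odd' k with ⟨j, rfl | rfl⟩
    · rw [fareyWord_even]; exact ih j (by omega)
    · obtain ⟨u, hu⟩ := ih (j + 1) (by omega)
      exact ⟨fareyWord n j ++ u, by rw [fareyWord_odd, hu, List.append_assoc]⟩

theorem fareyWord_cases (n k : ℕ) (hk : k ≤ 2 ^ n) :
    fareyWord n k = [0] ∨ fareyWord n k = [1] ∨ ∃ u, fareyWord n k = 0 :: (u ++ [1]) := by
  rcases Nat.eq_zero_or_pos k with rfl | h0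
  · exact Or.inl (fareyWord_zero n)
  rcases hk.eq_or_lt with rfl | hk
  · exact Or.inr (Or.inl (fareyWord_two_pow n))
  refine Or.inr (Or.inr ?_)
  obtain ⟨u, hu⟩ := fareyWord_starts_with_zero n k hk
  obtain ⟨v, hv⟩ := fareyWord_ends_with_one n k h0
  rw [hu] at hv ⊢
  cases v with
  | nil => simp at hv
  | cons i v =>
    rw [List.cons_append, List.cons.injEq] at hv
    exact ⟨v, by rw [hv.2]⟩

/-- The displacement `|w| α - |w|₁` of the rotation by `α` along the word `w`. -/
def displacement (α : ℝ) (w : List (Fin 2)) : ℝ := w.length * α - w.count 1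

theorem displacement_append (α : ℝ) (v w : List (Fin 2)) :
    displacement α (v ++ w) = displacement α v + displacement α w := by
  simp [displacement]; ring

/-- Consecutive words of a level are Farey neighbours. -/
theorem length_mul_displacement_sub (α : ℝ) (n k : ℕ) (hk : k < 2 ^ n) :
    (fareyWord n (k + 1)).length * displacement α (fareyWord n k) -
      (fareyWord n k).length * displacement α (fareyWord n (k + 1)) = 1 := by
  induction n generalizing k with
  | zero => simp at hk; subst hk; simp [fareyWord, displacement]
  | succ n ih =>
    rw [pow_succ'] at hk
    rcases Nat.even_or_odd' k with ⟨j, rfl | rfl⟩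
    · have := ih j (by omega)
      rw [fareyWord_even, fareyWord_odd, displacement_append, List.length_append]
      push_cast
      linarith
    · have := ih j (by omega)
      rw [fareyWord_odd, fareyWord_odd_add_one, displacement_append, List.length_append]
      push_cast
      linarith

theorem TraceBalanced.mul_left {A B : Mat2} (hA : A.det = 1)
    (h : TraceBalanced A.trace B.trace (B * A).trace) :
    TraceBalanced A.trace (B * A).trace (B * A * A).trace := by
  have e : (B * A * A).trace = A.trace * (B * A).trace - B.trace := by
    rw [Matrix.mul_assoc, sq_eq_of_det_eq_one hA, Matrix.mul_sub, Matrix.mul_smul,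
      Matrix.trace_sub, Matrix.trace_smul, Matrix.mul_one, smul_eq_mul]
  rw [e]
  exact h.left

theorem TraceBalanced.mul_right {A B : Mat2} (hB : B.det = 1)
    (h : TraceBalanced A.trace B.trace (B * A).trace) :
    TraceBalanced (B * A).trace B.trace (B * (B * A)).trace := by
  have e : (B * (B * A)).trace = B.trace * (B * A).trace - A.trace := by
    rw [← Matrix.mul_assoc, sq_eq_of_det_eq_one hB, Matrix.sub_mul, Matrix.smul_mul,
      Matrix.trace_sub, Matrix.trace_smul, Matrix.one_mul, smul_eq_mul]
  rw [e]
  exact h.right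

theorem NonnegBalanced.traceBalanced_fareyWord {N : Fin 2 → Mat2} (hN : NonnegBalanced N)
    (n k : ℕ) (hk : k < 2 ^ n) :
    TraceBalanced (wordMat N (fareyWord n k)).trace (wordMat N (fareyWord n (k + 1))).trace
      (wordMat N (fareyWord n (k + 1)) * wordMat N (fareyWord n k)).trace := by
  induction n generalizing k with
  | zero =>
    simp at hk
    subst hk
    simpa [fareyWord, wordMat] using hN.traceBalanced
  | succ n ih =>
    rw [pow_succ'] at hk
    rcases Nat.even_or_odd' k with ⟨j, rfl | rfl⟩
    · rw [fareyWord_even, fareyWord_odd, wordMat_append]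
      exact (ih j (by omega)).mul_left (det_wordMat hN.det_eq_one _)
    · rw [fareyWord_odd, fareyWord_odd_add_one, wordMat_append]
      exact (ih j (by omega)).mul_right (det_wordMat hN.det_eq_one _)

theorem NonnegBalanced.two_le_trace_fareyWord {N : Fin 2 → Mat2} (hN : NonnegBalanced N)
    (n k : ℕ) (hk : k ≤ 2 ^ n) :
    2 ≤ (wordMat N (fareyWord n k)).trace := by
  rcases hk.eq_or_lt with rfl | hk
  · rw [fareyWord_two_pow, wordMat_singleton]
    exact hN.traceBalanced.2.1
  · exact (hN.traceBalanced_fareyWord n k hk).1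

/-- Around the word of index `k` of level `n`, if it was inserted as `w w'` at an earlier level, the
neighbours are `w (w w') ^ j` and `(w w') ^ j w'` for some `j`. -/
theorem NonnegBalanced.exists_fareyWord_neighbours {N : Fin 2 → Mat2} (hN : NonnegBalanced N)
    (n k : ℕ) (h0 : 1 ≤ k) (hk : k < 2 ^ n) :
    ∃ (A B : Mat2) (j : ℕ), A.det = 1 ∧ B.det = 1 ∧
      TraceBalanced A.trace B.trace (B * A).trace ∧ wordMat N (fareyWord n k) = B * A ∧
      wordMat N (fareyWord n (k - 1)) = (B * A) ^ j * A ∧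
      wordMat N (fareyWord n (k + 1)) = B * (B * A) ^ j ∧
      ∀ α, displacement α (fareyWord n (k - 1)) + displacement α (fareyWord n (k + 1)) =
        (2 * j + 1) * displacement α (fareyWord n k) := by
  induction n generalizing k with
  | zero => simp at hk; omega
  | succ n ih =>
    rw [pow_succ'] at hk
    rcases Nat.even_or_odd' k with ⟨i, rfl | rfl⟩
    · obtain ⟨A, B, j, hA, hB, hbal, e1, e2, e3, e4⟩ := ih i (by omega) (by omega)
      have e : 2 * i - 1 = 2 * (i - 1) + 1 := by omega
      have e' : i - 1 + 1 = i := by omega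
      refine ⟨A, B, j + 1, hA, hB, hbal, ?_, ?_, ?_, fun α => ?_⟩
      · rw [fareyWord_even, e1]
      · rw [e, fareyWord_odd, wordMat_append, e', e1, e2, pow_succ']
        simp only [Matrix.mul_assoc]
      · rw [fareyWord_odd, wordMat_append, e1, e3, pow_succ, Matrix.mul_assoc]
      · rw [e, fareyWord_odd, fareyWord_odd, fareyWord_even, displacement_append,
          displacement_append, e']
        have := e4 α
        push_cast
        linarith
    · refine ⟨wordMat N (fareyWord n i), wordMat N (fareyWord n (i + 1)), 0,
        det_wordMat hN.det_eq_one _, det_wordMat hN.det_eq_one _,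
        hN.traceBalanced_fareyWord n i (by omega), ?_, ?_, ?_, fun α => ?_⟩
      · rw [fareyWord_odd, wordMat_append]
      · simp [fareyWord_even]
      · simp [fareyWord_odd_add_one]
      · rw [Nat.add_sub_cancel, fareyWord_even, fareyWord_odd_add_one, fareyWord_odd,
          displacement_append]
        push_cast
        ring

/-- The logarithm of the spectral radius of the product along a Farey word. -/
noncomputable def fareyLog (N : Fin 2 → Mat2) (n k : ℕ) : ℝ :=
  Real.log (specRad (wordMat N (fareyWord n k)).trace)

theorem NonnegBalanced.fareyLog_add_lt {N : Fin 2 → Mat2} (hN : NonnegBalanced N)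
    (n k : ℕ) (h0 : 1 ≤ k) (hk : k < 2 ^ n) :
    ∃ c : ℝ, 0 < c ∧ fareyLog N n (k - 1) + fareyLog N n (k + 1) < c * fareyLog N n k ∧
      ∀ α, displacement α (fareyWord n (k - 1)) + displacement α (fareyWord n (k + 1)) =
        c * displacement α (fareyWord n k) := by
  obtain ⟨A, B, j, hA, hB, hbal, e1, e2, e3, e4⟩ := hN.exists_fareyWord_neighbours n k h0 hk
  refine ⟨2 * j + 1, by positivity, ?_, e4⟩
  have t1 := hN.two_le_trace_fareyWord n (k - 1) (by omega)
  have t2 := hN.two_le_trace_fareyWord n (k + 1) (by omega)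
  rw [fareyLog, fareyLog, fareyLog, e1]
  rw [e2] at t1 ⊢
  rw [e3] at t2 ⊢
  have hC : (B * A).det = 1 := by rw [Matrix.det_mul, hA, hB, one_mul]
  rw [Matrix.trace_mul_comm B] at t2 ⊢
  have key := hbal.specRad_recurrence_mul_lt (a := fun j => ((B * A) ^ j * A).trace)
    (b := fun j => ((B * A) ^ j * B).trace) (by simp)
    (by
      simp only [pow_one]
      rw [Matrix.mul_assoc, sq_eq_of_det_eq_one hA, Matrix.mul_sub, Matrix.mul_smul,
        Matrix.trace_sub, Matrix.trace_smul, Matrix.mul_one, smul_eq_mul, mul_comm])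
    (trace_mul_pow_recurrence hC A) (by simp)
    (by
      simp only [pow_one]
      rw [Matrix.trace_mul_comm, ← Matrix.mul_assoc, sq_eq_of_det_eq_one hB, Matrix.sub_mul,
        Matrix.smul_mul, Matrix.trace_sub, Matrix.trace_smul, Matrix.one_mul, smul_eq_mul,
        mul_comm])
    (trace_mul_pow_recurrence hC B) j t1 t2
  have p1 := specRad_pos t1
  have p2 := specRad_pos t2
  rw [← Real.log_mul p1.ne' p2.ne']
  have := Real.log_lt_log (mul_pos p1 p2) key
  rw [Real.log_pow] at this
  push_cast at this
  exact this

/-- The affine function of `α` that takes the value `fareyLog N n j / |w_j|` at the slope of the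
Farey word `w_j` of level `n`, for `j = k` and for `j = k + 1`. -/
noncomputable def fareyChord (N : Fin 2 → Mat2) (n k : ℕ) (α : ℝ) : ℝ :=
  displacement α (fareyWord n k) * fareyLog N n (k + 1) -
    displacement α (fareyWord n (k + 1)) * fareyLog N n k

theorem NonnegBalanced.fareyChord_sub {N : Fin 2 → Mat2} (hN : NonnegBalanced N)
    (n k : ℕ) (hk : k + 1 < 2 ^ n) :
    ∃ g : ℝ, 0 < g ∧ ∀ α, fareyChord N n (k + 1) α - fareyChord N n k α =
      -(g * displacement α (fareyWord n (k + 1))) := by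
  obtain ⟨c, hc, h1, h2⟩ := hN.fareyLog_add_lt n (k + 1) (by omega) hk
  rw [Nat.add_sub_cancel] at h1 h2
  refine ⟨c * fareyLog N n (k + 1) - (fareyLog N n k + fareyLog N n (k + 1 + 1)), by linarith,
    fun α => ?_⟩
  have := h2 α
  unfold fareyChord
  linear_combination (-fareyLog N n (k + 1)) * this

theorem displacement_nonneg_of_le {α : ℝ} {n k j : ℕ} (hk : k ≤ 2 ^ n)
    (h : 0 ≤ displacement α (fareyWord n k)) (hj : j ≤ k) :
    0 ≤ displacement α (fareyWord n j) := by
  induction k, hj using Nat.le_induction with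
  | base => exact h
  | succ k hjk ih =>
    refine ih (by omega) ?_
    have h1 := length_mul_displacement_sub α n k (by omega)
    have h2 : (1 : ℝ) ≤ (fareyWord n (k + 1)).length := by
      exact_mod_cast one_le_length_fareyWord n (k + 1)
    have h3 : (0 : ℝ) ≤ (fareyWord n k).length := by positivity
    by_contra! hc
    nlinarith [mul_nonneg h3 h]

theorem displacement_nonpos_of_le {α : ℝ} {n k j : ℕ} (hj : j ≤ 2 ^ n)
    (h : displacement α (fareyWord n k) ≤ 0) (hkj : k ≤ j) :
    displacement α (fareyWord n j) ≤ 0 := by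
  induction j, hkj using Nat.le_induction with
  | base => exact h
  | succ j hkj ih =>
    have ih := ih (by omega)
    have h1 := length_mul_displacement_sub α n j (by omega)
    have h2 : (1 : ℝ) ≤ (fareyWord n j).length := by
      exact_mod_cast one_le_length_fareyWord n j
    have h3 : (0 : ℝ) ≤ (fareyWord n (j + 1)).length := by positivity
    by_contra! hc
    nlinarith [mul_nonneg h3 (neg_nonneg.mpr ih)]

/-- The chord over the Farey interval that contains `α` is the smallest one at `α`: the broken line
through the points of level `n` is the minimum of its chords, hence concave. -/
theorem NonnegBalanced.fareyChord_le {N : Fin 2 → Mat2} (hN : NonnegBalanced N)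
    {α : ℝ} {n k : ℕ} (hk : k < 2 ^ n)
    (h0 : 0 ≤ displacement α (fareyWord n k)) (h1 : displacement α (fareyWord n (k + 1)) ≤ 0)
    {j : ℕ} (hj : j < 2 ^ n) : fareyChord N n k α ≤ fareyChord N n j α := by
  rcases le_total k j with hkj | hjk
  · induction j, hkj using Nat.le_induction with
    | base => exact le_rfl
    | succ j hkj ih =>
      obtain ⟨g, hg, e⟩ := hN.fareyChord_sub n j hj
      have h2 := displacement_nonpos_of_le (j := j + 1) hj.le h1 (by omega)
      have := e α
      have := ih (by omega)
      nlinarith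
  · induction hjk using Nat.decreasingInduction with
    | self => exact le_rfl
    | of_succ j hjk ih =>
      obtain ⟨g, hg, e⟩ := hN.fareyChord_sub n j (by omega)
      have h2 := displacement_nonneg_of_le hk.le h0 (j := j + 1) (by omega)
      have := e α
      have := ih (by omega)
      nlinarith

/-! ### Codings of rotations -/

/-- The coding of the orbit of `y` under the rotation by `α`: the letter `1` is read whenever the
orbit `y, y + α, y + 2 α, …` passes an integer. -/
noncomputable def coding (α y : ℝ) : InfWord :=
  fun k => Fin.ofNat 2 (⌊y + ((k : ℝ) + 1) * α⌋ - ⌊y + (k : ℝ) * α⌋).toNat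

theorem rotationWord_eq_coding (α : ℝ) : rotationWord α = coding α 0 := by
  funext k
  simp [rotationWord, coding]

theorem coding_add_int (α y : ℝ) (z : ℤ) : coding α (y + z) = coding α y := by
  funext k
  simp only [coding, add_right_comm y (z : ℝ), Int.floor_add_intCast, add_sub_add_right_eq_sub]

theorem coding_add (α y : ℝ) (m k : ℕ) : coding α y (m + k) = coding α (y + m * α) k := by
  have e1 : y + (((m + k : ℕ) : ℝ) + 1) * α = y + m * α + ((k : ℝ) + 1) * α := by push_cast; ring
  have e2 : y + ((m + k : ℕ) : ℝ) * α = y + m * α + (k : ℝ) * α := by push_cast; ring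
  simp only [coding, e1, e2]

theorem shift_iterate_apply (x : InfWord) (m k : ℕ) : (shift^[m] x) k = x (m + k) := by
  induction m generalizing x with
  | zero => simp
  | succ m ih => rw [Function.iterate_succ_apply, ih]; exact congrArg x (by omega)

theorem shift_coding (α y : ℝ) : shift (coding α y) = coding α (y + α) := by
  funext k
  have := coding_add α y 1 k
  rw [Nat.cast_one, one_mul] at this
  rw [← this, add_comm 1 k]
  rfl

theorem val_coding {α : ℝ} (h0 : 0 ≤ α) (h1 : α ≤ 1) (y : ℝ) (k : ℕ) :
    (((coding α y k : Fin 2) : ℕ) : ℤ) = ⌊y + ((k : ℝ) + 1) * α⌋ - ⌊y + (k : ℝ) * α⌋ := by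
  have e : y + ((k : ℝ) + 1) * α = y + (k : ℝ) * α + α := by ring
  have hl : ⌊y + (k : ℝ) * α⌋ ≤ ⌊y + ((k : ℝ) + 1) * α⌋ := Int.floor_le_floor (by rw [e]; linarith)
  have hu : ⌊y + ((k : ℝ) + 1) * α⌋ ≤ ⌊y + (k : ℝ) * α⌋ + 1 := by
    rw [← Int.floor_add_one]
    exact Int.floor_le_floor (by rw [e]; linarith)
  simp only [coding, Fin.val_ofNat]
  omega

/-- The word of the first `n` letters of `x`. -/
def prefixWord (x : InfWord) (n : ℕ) : List (Fin 2) := (List.range n).map x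

theorem length_prefixWord (x : InfWord) (n : ℕ) : (prefixWord x n).length = n := by
  simp [prefixWord]

theorem prefixWord_coding_add (α y : ℝ) (m n : ℕ) :
    prefixWord (coding α y) (m + n) =
      prefixWord (coding α y) m ++ prefixWord (coding α (y + m * α)) n := by
  rw [prefixWord, List.range_add, List.map_append, List.map_map]
  congr 1
  exact List.map_congr_left fun k _ => coding_add α y m k

/-- With `e = displacement α v` and `d = -displacement α w`, the first return map of the rotation
by `α` to the interval `[0, d + e)` exchanges its subintervals `[0, d)` and `[d, d + e)`, and the
orbits that start there read the words `v` and `w`, respectively. -/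
structure ReadsBlocks (α : ℝ) (v w : List (Fin 2)) : Prop where
  left : ∀ y, 0 ≤ y → y < -displacement α w → prefixWord (coding α y) v.length = v
  right : ∀ y, -displacement α w ≤ y → y < -displacement α w + displacement α v →
    prefixWord (coding α y) w.length = w
  entry : ∃ L : ℕ, ∀ y : ℝ, ∃ m ≤ L, ∃ z : ℤ, 0 ≤ y + m * α + z ∧
    y + m * α + z < -displacement α w + displacement α v

theorem add_length_mul (α y : ℝ) (v : List (Fin 2)) :
    y + v.length * α = y + displacement α v + ((v.count 1 : ℤ) : ℝ) := by
  simp only [displacement, Int.cast_natCast]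
  ring

theorem ReadsBlocks.step_left {α : ℝ} {v w : List (Fin 2)} (h : ReadsBlocks α v w)
    (hv : 0 ≤ displacement α v) (hd : displacement α v + displacement α w ≤ 0) :
    ReadsBlocks α v (v ++ w) where
  left y h0 h1 := by
    rw [displacement_append] at h1
    exact h.left y h0 (by linarith)
  right y h0 h1 := by
    rw [displacement_append] at h0 h1
    rw [List.length_append, prefixWord_coding_add, h.left y (by linarith) (by linarith),
      add_length_mul, coding_add_int, h.right _ (by linarith) (by linarith)]
  entry := by
    obtain ⟨L, hL⟩ := h.entry
    refine ⟨L + w.length, fun y => ?_⟩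
    obtain ⟨m, hm, z, h0, h1⟩ := hL y
    rw [displacement_append]
    by_cases hy : y + m * α + z < -displacement α w
    · exact ⟨m, by omega, z, h0, by linarith⟩
    · refine ⟨m + w.length, by omega, z - (w.count 1 : ℤ), ?_⟩
      have e := add_length_mul α (y + m * α) w
      push_cast at e ⊢
      constructor <;> linarith

theorem ReadsBlocks.step_right {α : ℝ} {v w : List (Fin 2)} (h : ReadsBlocks α v w)
    (hw : displacement α w ≤ 0) (hd : 0 ≤ displacement α v + displacement α w) :
    ReadsBlocks α (v ++ w) w where
  left y h0 h1 := by
    rw [List.length_append, prefixWord_coding_add, h.left y h0 h1,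
      add_length_mul, coding_add_int, h.right _ (by linarith) (by linarith)]
  right y h0 h1 := by
    rw [displacement_append] at h1
    exact h.right y h0 (by linarith)
  entry := by
    obtain ⟨L, hL⟩ := h.entry
    refine ⟨L + w.length, fun y => ?_⟩
    obtain ⟨m, hm, z, h0, h1⟩ := hL y
    rw [displacement_append]
    by_cases hy : y + m * α + z < displacement α v
    · exact ⟨m, by omega, z, h0, by linarith⟩
    · refine ⟨m + w.length, by omega, z - (w.count 1 : ℤ), ?_⟩
      have e := add_length_mul α (y + m * α) w
      push_cast at e ⊢
      constructor <;> linarith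

theorem coding_zero_of_lt {α y : ℝ} (h0 : 0 ≤ α) (h1 : α ≤ 1) (hy : 0 ≤ y) (hy1 : y < 1 - α) :
    coding α y 0 = 0 := by
  have h := val_coding h0 h1 y 0
  have e1 : ⌊y⌋ = 0 := Int.floor_eq_iff.mpr ⟨by simpa, by push_cast; linarith⟩
  have e2 : ⌊y + α⌋ = 0 := Int.floor_eq_iff.mpr ⟨by push_cast; linarith, by push_cast; linarith⟩
  simp [e1, e2] at h
  exact h

theorem coding_zero_of_le {α y : ℝ} (h0 : 0 ≤ α) (h1 : α ≤ 1) (hy : 1 - α ≤ y) (hy1 : y < 1) :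
    coding α y 0 = 1 := by
  have h := val_coding h0 h1 y 0
  have e1 : ⌊y⌋ = 0 := Int.floor_eq_iff.mpr ⟨by push_cast; linarith, by push_cast; linarith⟩
  have e2 : ⌊y + α⌋ = 1 := Int.floor_eq_iff.mpr ⟨by push_cast; linarith, by push_cast; linarith⟩
  simp [e1, e2] at h
  apply Fin.ext
  simpa using h

theorem readsBlocks_fareyWord {α : ℝ} (h0 : 0 ≤ α) (h1 : α ≤ 1) (n k : ℕ) (hk : k < 2 ^ n)
    (hv : 0 ≤ displacement α (fareyWord n k)) (hw : displacement α (fareyWord n (k + 1)) ≤ 0) :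
    ReadsBlocks α (fareyWord n k) (fareyWord n (k + 1)) := by
  induction n generalizing k with
  | zero =>
    simp at hk
    subst hk
    refine ⟨fun y hy hy1 => ?_, fun y hy hy1 => ?_, 0, fun y => ⟨0, le_rfl, -⌊y⌋, ?_⟩⟩
    · simp [fareyWord, displacement] at hy1
      simpa [fareyWord, prefixWord] using coding_zero_of_lt h0 h1 hy hy1
    · simp [fareyWord, displacement] at hy hy1
      simpa [fareyWord, prefixWord] using coding_zero_of_le h0 h1 (by linarith) hy1
    · have := Int.floor_le y
      have := Int.lt_floor_add_one y
      simp [fareyWord, displacement]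
      constructor <;> linarith
  | succ n ih =>
    rw [pow_succ'] at hk
    rcases Nat.even_or_odd' k with ⟨j, rfl | rfl⟩
    · rw [fareyWord_even] at hv ⊢
      rw [fareyWord_odd] at hw ⊢
      rw [displacement_append] at hw
      exact (ih j (by omega) hv (by linarith)).step_left hv hw
    · rw [fareyWord_odd_add_one] at hw ⊢
      rw [fareyWord_odd] at hv ⊢
      rw [displacement_append] at hv
      exact (ih j (by omega) (by linarith) hw).step_right hw hv

/-- Every slope lies in a Farey interval of each level. -/
theorem exists_fareyWord_interval {α : ℝ} (h0 : 0 ≤ α) (h1 : α ≤ 1) (n : ℕ) :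
    ∃ k < 2 ^ n, 0 ≤ displacement α (fareyWord n k) ∧
      displacement α (fareyWord n (k + 1)) ≤ 0 := by
  induction n with
  | zero =>
    exact ⟨0, by simp, by simpa [fareyWord, displacement], by simpa [fareyWord, displacement]⟩
  | succ n ih =>
    obtain ⟨k, hk, hv, hw⟩ := ih
    rw [pow_succ']
    rcases le_total 0 (displacement α (fareyWord (n + 1) (2 * k + 1))) with h | h
    · exact ⟨2 * k + 1, by omega, h, by rwa [fareyWord_odd_add_one]⟩
    · exact ⟨2 * k, by omega, by rwa [fareyWord_even], h⟩

/-- Words read from the return interval are concatenations of `v` and `w`, up to a short suffix. -/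
theorem ReadsBlocks.exists_parsing {α : ℝ} {v w : List (Fin 2)} (h : ReadsBlocks α v w)
    (hv : 1 ≤ v.length) (hw : 1 ≤ w.length) (hdv : 0 ≤ displacement α v)
    (hdw : displacement α w ≤ 0) (n : ℕ) (y : ℝ) (h0 : 0 ≤ y)
    (h1 : y < -displacement α w + displacement α v) :
    ∃ b r : List (Fin 2), prefixWord (coding α y) n = b.flatMap ![v, w] ++ r ∧
      r.length ≤ v.length + w.length ∧
      0 ≤ y + b.count 0 * displacement α v + b.count 1 * displacement α w ∧
      y + b.count 0 * displacement α v + b.count 1 * displacement α w <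
        -displacement α w + displacement α v := by
  induction n using Nat.strong_induction_on generalizing y with
  | _ n ih =>
    by_cases hn : n ≤ v.length + w.length
    · exact ⟨[], prefixWord (coding α y) n, by simp, by rwa [length_prefixWord], by simpa,
        by simpa using h1⟩
    by_cases hy : y < -displacement α w
    · obtain ⟨b, r, e, hr, e0, e1⟩ := ih (n - v.length) (by omega) (y + displacement α v)
        (by linarith) (by linarith)
      refine ⟨0 :: b, r, ?_, hr, ?_⟩
      · obtain ⟨m, rfl⟩ : ∃ m, n = v.length + m := ⟨n - v.length, by omega⟩
        rw [Nat.add_sub_cancel_left] at e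
        rw [prefixWord_coding_add, h.left y h0 hy, add_length_mul, coding_add_int, e]
        simp
      · simp
        constructor <;> linarith
    · obtain ⟨b, r, e, hr, e0, e1⟩ := ih (n - w.length) (by omega) (y + displacement α w)
        (by linarith) (by linarith)
      refine ⟨1 :: b, r, ?_, hr, ?_⟩
      · obtain ⟨m, rfl⟩ : ∃ m, n = w.length + m := ⟨n - w.length, by omega⟩
        rw [Nat.add_sub_cancel_left] at e
        rw [prefixWord_coding_add, h.right y (by linarith) h1, add_length_mul, coding_add_int, e]
        simp
      · simp
        constructor <;> linarith

theorem length_flatMap_pair (v w b : List (Fin 2)) :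
    (b.flatMap ![v, w]).length = b.count 0 * v.length + b.count 1 * w.length := by
  induction b with
  | nil => simp
  | cons i b ih =>
    match i with
    | 0 => simp at ih; simp [ih]; ring
    | 1 => simp at ih; simp [ih]; ring

/-- Words in the subshift of slope `α` are concatenations of two Farey words, up to a bounded
prefix and suffix, and the frequencies of the two blocks are determined by `α`. -/
theorem exists_parsing_coding {α : ℝ} (h0 : 0 ≤ α) (h1 : α ≤ 1) {n k : ℕ} (hk : k < 2 ^ n)
    (hv : 0 ≤ displacement α (fareyWord n k)) (hw : displacement α (fareyWord n (k + 1)) ≤ 0) :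
    ∃ C : ℝ, 0 ≤ C ∧ ∀ (y : ℝ) (m : ℕ), ∃ s b r : List (Fin 2),
      prefixWord (coding α y) m =
        s ++ b.flatMap ![fareyWord n k, fareyWord n (k + 1)] ++ r ∧
      (s.length : ℝ) + r.length ≤ C ∧
      |(b.count 0 : ℝ) - m * -displacement α (fareyWord n (k + 1))| ≤ C ∧
      |(b.count 1 : ℝ) - m * displacement α (fareyWord n k)| ≤ C := by
  have hR := readsBlocks_fareyWord h0 h1 n k hk hv hw
  have hdet := length_mul_displacement_sub α n k hk
  have hlv := one_le_length_fareyWord n k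
  have hlw := one_le_length_fareyWord n (k + 1)
  set v := fareyWord n k
  set w := fareyWord n (k + 1)
  obtain ⟨L, hL⟩ := hR.entry
  have hv1 : (1 : ℝ) ≤ v.length := by exact_mod_cast hlv
  have hw1 : (1 : ℝ) ≤ w.length := by exact_mod_cast hlw
  set e := displacement α v
  set d' := displacement α w
  have he1 : e ≤ 1 := by
    nlinarith [mul_nonneg (by linarith : (0 : ℝ) ≤ v.length) (neg_nonneg.mpr hw)]
  have hd1 : -d' ≤ 1 := by nlinarith [mul_nonneg (by linarith : (0 : ℝ) ≤ w.length) hv]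
  set C : ℝ := L + 2 * (v.length + w.length) with hC
  have hL0 : (0 : ℝ) ≤ L := by positivity
  refine ⟨C, by positivity, fun y m => ?_⟩
  -- It suffices to parse up to a bounded prefix and suffix, with bounded total displacement.
  suffices H : ∃ s b r : List (Fin 2), prefixWord (coding α y) m = s ++ b.flatMap ![v, w] ++ r ∧
      s.length + r.length ≤ L + (v.length + w.length) ∧
      |(b.count 0 : ℝ) * e + b.count 1 * d'| ≤ 1 by
    obtain ⟨s, b, r, hpre, hsr, hab⟩ := H
    have hsr' : (s.length : ℝ) + r.length ≤ L + (v.length + w.length) := by exact_mod_cast hsr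
    refine ⟨s, b, r, hpre, by linarith, ?_, ?_⟩
    all_goals
      have hlen := congrArg List.length hpre
      rw [length_prefixWord, List.length_append, List.length_append, length_flatMap_pair] at hlen
      have hlen' : (m : ℝ) =
          s.length + (b.count 0 * v.length + b.count 1 * w.length) + r.length := by
        exact_mod_cast hlen
      rw [abs_le] at hab
      have hs0 : (0 : ℝ) ≤ s.length := by positivity
      have hr0 : (0 : ℝ) ≤ r.length := by positivity
      generalize (b.count 0 : ℝ) = p at *
      generalize (b.count 1 : ℝ) = q at *
      set t : ℝ := s.length + r.length with ht
    · have key : p - m * -d' = w.length * (p * e + q * d') + t * d' := by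
        rw [hlen', ht]
        linear_combination (-p) * hdet
      have h2 : |t * d'| ≤ t := by
        rw [abs_mul, abs_of_nonneg (by linarith : 0 ≤ t), abs_of_nonpos hw]
        nlinarith
      have h3 : |w.length * (p * e + q * d')| ≤ w.length := by
        rw [abs_mul, abs_of_nonneg (by linarith : (0 : ℝ) ≤ w.length)]
        have := abs_le.mpr hab
        nlinarith
      rw [key]
      refine (abs_add_le _ _).trans ?_
      linarith
    · have key : q - m * e = -(v.length * (p * e + q * d')) - t * e := by
        rw [hlen', ht]
        linear_combination (-q) * hdet
      have h2 : |t * e| ≤ t := by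
        rw [abs_mul, abs_of_nonneg (by linarith : 0 ≤ t), abs_of_nonneg hv]
        nlinarith
      have h3 : |-(v.length * (p * e + q * d'))| ≤ v.length := by
        rw [abs_neg, abs_mul, abs_of_nonneg (by linarith : (0 : ℝ) ≤ v.length)]
        have := abs_le.mpr hab
        nlinarith
      rw [key]
      refine (abs_sub _ _).trans ?_
      linarith
  obtain ⟨i, hi, z, hy0, hy1⟩ := hL y
  rcases le_total m i with hmi | him
  · refine ⟨prefixWord (coding α y) m, [], [], by simp, ?_, by simp⟩
    rw [length_prefixWord]
    simp only [List.length_nil]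
    omega
  · obtain ⟨b, r, e1, hr, e2, e3⟩ := hR.exists_parsing hlv hlw hv hw (m - i) _ hy0 hy1
    refine ⟨prefixWord (coding α y) i, b, r, ?_, ?_, ?_⟩
    · obtain ⟨j, rfl⟩ : ∃ j, m = i + j := ⟨m - i, by omega⟩
      rw [Nat.add_sub_cancel_left, coding_add_int] at e1
      rw [prefixWord_coding_add, e1, List.append_assoc]
    · rw [length_prefixWord]
      omega
    · have : -d' + e ≤ 1 := by nlinarith
      rw [abs_le]
      constructor <;> linarith

/-- The initial words of the points of the subshift of slope `α` are initial words of codings. -/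
theorem exists_coding_of_mem_sturmianShift {α : ℝ} {x : InfWord} (hx : x ∈ sturmianShift α)
    (n : ℕ) : ∃ y : ℝ, ∀ k < n, x k = coding α y k := by
  rw [sturmianShift, mem_omegaLimit_singleton_iff_mapClusterPt, mapClusterPt_iff_frequently] at hx
  have hU : {y : InfWord | ∀ k ∈ Finset.range n, y k = x k} ∈ 𝓝 x := by
    have : {y : InfWord | ∀ k ∈ Finset.range n, y k = x k} =
        ⋂ k ∈ Finset.range n, (fun y : InfWord => y k) ⁻¹' {x k} := by
      ext y; simp
    rw [this, Filter.biInter_finset_mem]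
    intro k _
    exact (continuous_apply k).continuousAt.preimage_mem_nhds ((isOpen_discrete _).mem_nhds rfl)
  obtain ⟨m, hm⟩ := (hx _ hU).exists
  refine ⟨m * α, fun k hk => ?_⟩
  have := hm k (Finset.mem_range.mpr hk)
  rw [← this, shift_iterate_apply, rotationWord_eq_coding, coding_add, zero_add]

theorem prefixWord_eq_of_forall_lt {x y : InfWord} {n : ℕ} (h : ∀ k < n, x k = y k) :
    prefixWord x n = prefixWord y n :=
  List.map_congr_left fun k hk => h k (List.mem_range.mp hk)

/-! ### Lyapunov exponents of Sturmian measures and chords of the Farey polygons -/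

theorem NonnegBalanced.det_ne_zero {N : Fin 2 → Mat2} (hN : NonnegBalanced N) (i : Fin 2) :
    (N i).det ≠ 0 := by
  rw [hN.det_eq_one i]; exact one_ne_zero

theorem IsSturmianMeasure.ae_mem {α : ℝ} {μ : Measure InfWord} (hμ : IsSturmianMeasure α μ) :
    ∀ᵐ x ∂μ, x ∈ sturmianShift α :=
  hμ.2

theorem tendsto_add_div_nat (c C : ℝ) :
    Tendsto (fun m : ℕ => (1 / (m : ℝ)) * (m * c + C)) atTop (𝓝 c) := by
  have h := (tendsto_const_div_atTop_nhds_zero_nat C).const_add c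
  rw [add_zero] at h
  refine h.congr' ?_
  filter_upwards [eventually_gt_atTop 0] with m hm
  have : (m : ℝ) ≠ 0 := by positivity
  field_simp

theorem IsSturmianMeasure.lyapunovExponent_le {N : Fin 2 → Mat2} (hN : ∀ i, (N i).det ≠ 0)
    {α : ℝ} {μ : Measure InfWord} (hμ : IsSturmianMeasure α μ) {c C : ℝ}
    (h : ∀ x ∈ sturmianShift α, ∀ m : ℕ, Real.log (hsNorm (cocycle N x m)) ≤ m * c + C) :
    lyapunovExponent N μ ≤ c := by
  have := hμ.1.1
  refine le_of_tendsto_of_tendsto' (tendsto_lyapunovSeq hN hμ.1) (tendsto_add_div_nat c C)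
    fun m => ?_
  refine mul_le_mul_of_nonneg_left ?_ (by positivity)
  have h1 : ∫ _ : InfWord, (m * c + C : ℝ) ∂μ = m * c + C := by simp
  rw [← h1]
  refine integral_mono_ae (integrable_log_hsNorm_cocycle hN μ m) (integrable_const _) ?_
  filter_upwards [hμ.ae_mem] with x hx using h x hx m

theorem IsSturmianMeasure.le_lyapunovExponent {N : Fin 2 → Mat2} (hN : ∀ i, (N i).det ≠ 0)
    {α : ℝ} {μ : Measure InfWord} (hμ : IsSturmianMeasure α μ) {c C : ℝ}
    (h : ∀ x ∈ sturmianShift α, ∀ m : ℕ, m * c + C ≤ Real.log (hsNorm (cocycle N x m))) :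
    c ≤ lyapunovExponent N μ := by
  have := hμ.1.1
  refine le_of_tendsto_of_tendsto' (tendsto_add_div_nat c C) (tendsto_lyapunovSeq hN hμ.1)
    fun m => ?_
  refine mul_le_mul_of_nonneg_left ?_ (by positivity)
  have h1 : ∫ _ : InfWord, (m * c + C : ℝ) ∂μ = m * c + C := by simp
  rw [← h1]
  refine integral_mono_ae (integrable_const _) (integrable_log_hsNorm_cocycle hN μ m) ?_
  filter_upwards [hμ.ae_mem] with x hx using h x hx m

/-- Along points of the subshift, the cocycle is a product of blocks up to a bounded factor. -/
theorem NonnegBalanced.exists_parsing_cocycle {N : Fin 2 → Mat2} (hN : NonnegBalanced N) {α : ℝ}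
    (h0 : 0 ≤ α) (h1 : α ≤ 1) {n k : ℕ} (hk : k < 2 ^ n)
    (hv : 0 ≤ displacement α (fareyWord n k)) (hw : displacement α (fareyWord n (k + 1)) ≤ 0) :
    ∃ C : ℝ, 0 ≤ C ∧ ∀ x ∈ sturmianShift α, ∀ m : ℕ, ∃ b : List (Fin 2),
      |Real.log (hsNorm (cocycle N x m)) - Real.log (hsNorm
        (wordMat ![wordMat N (fareyWord n k), wordMat N (fareyWord n (k + 1))] b))| ≤ C ∧
      |(b.count 0 : ℝ) - m * -displacement α (fareyWord n (k + 1))| ≤ C ∧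
      |(b.count 1 : ℝ) - m * displacement α (fareyWord n k)| ≤ C := by
  obtain ⟨C, hC, hpar⟩ := exists_parsing_coding h0 h1 hk hv hw
  obtain ⟨D, hD, hlog⟩ := abs_log_hsNorm_wordMat_le hN.det_eq_one
  refine ⟨max C (D * (C + 2)), le_max_of_le_left hC, fun x hx m => ?_⟩
  obtain ⟨y, hy⟩ := exists_coding_of_mem_sturmianShift hx m
  obtain ⟨s, b, r, e, hsr, h2, h3⟩ := hpar y m
  rw [← prefixWord_eq_of_forall_lt hy, prefixWord] at e
  refine ⟨b, ?_, h2.trans (le_max_left _ _), h3.trans (le_max_left _ _)⟩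
  have e2 : (fun i => wordMat N (![fareyWord n k, fareyWord n (k + 1)] i)) =
      ![wordMat N (fareyWord n k), wordMat N (fareyWord n (k + 1))] := by
    funext i
    match i with
    | 0 => rfl
    | 1 => rfl
  rw [cocycle_eq_wordMat, e, wordMat_append, wordMat_append, wordMat_flatMap, e2,
    ← Matrix.mul_assoc]
  have h4 := abs_log_hsNorm_mul_mul_sub_le (det_wordMat hN.det_eq_one r)
    (det_wordMat (N := ![wordMat N (fareyWord n k), wordMat N (fareyWord n (k + 1))])
      (fun i => by
        match i with
        | 0 => exact det_wordMat hN.det_eq_one _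
        | 1 => exact det_wordMat hN.det_eq_one _) b) (det_wordMat hN.det_eq_one s)
  have h5 := (le_abs_self _).trans (hlog r)
  have h6 := (le_abs_self _).trans (hlog s)
  refine (h4.trans ?_).trans (le_max_right _ _)
  nlinarith

theorem NonnegBalanced.fareyLog_nonneg {N : Fin 2 → Mat2} (hN : NonnegBalanced N) {n k : ℕ}
    (hk : k ≤ 2 ^ n) : 0 ≤ fareyLog N n k :=
  Real.log_nonneg (one_le_specRad (hN.two_le_trace_fareyWord n k hk))

/-- The chord over a Farey interval that contains `α` bounds the Lyapunov exponent from below. -/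
theorem NonnegBalanced.fareyChord_le_lyapunovExponent {N : Fin 2 → Mat2} (hN : NonnegBalanced N)
    {α : ℝ} (h0 : 0 ≤ α) (h1 : α ≤ 1) {μ : Measure InfWord} (hμ : IsSturmianMeasure α μ)
    {n k : ℕ} (hk : k < 2 ^ n) (hv : 0 ≤ displacement α (fareyWord n k))
    (hw : displacement α (fareyWord n (k + 1)) ≤ 0) :
    fareyChord N n k α ≤ lyapunovExponent N μ := by
  obtain ⟨C, hC, hpar⟩ := hN.exists_parsing_cocycle h0 h1 hk hv hw
  have hbal := hN.traceBalanced_fareyWord n k hk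
  rw [Matrix.trace_mul_comm] at hbal
  obtain ⟨c, hc, hlow⟩ := hbal.le_hsNorm_wordMat (det_wordMat hN.det_eq_one _)
    (det_wordMat hN.det_eq_one _)
  have hF := hN.fareyLog_nonneg hk.le
  have hF' := hN.fareyLog_nonneg (n := n) (k := k + 1) hk
  have hs := specRad_pos (hN.two_le_trace_fareyWord n k hk.le)
  have ht := specRad_pos (hN.two_le_trace_fareyWord n (k + 1) hk)
  refine hμ.le_lyapunovExponent hN.det_ne_zero
    (C := Real.log c - C * fareyLog N n k - C * fareyLog N n (k + 1) - C) fun x hx m => ?_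
  obtain ⟨b, hb, hp, hq⟩ := hpar x hx m
  have h2 := Real.log_le_log (by positivity) (hlow b)
  rw [Real.log_mul hc.ne' (by positivity), Real.log_mul (by positivity) (by positivity),
    Real.log_pow, Real.log_pow] at h2
  rw [abs_le] at hb hp hq
  rw [fareyChord]
  change _ + (_ * fareyLog N n k + _ * fareyLog N n (k + 1)) ≤ _ at h2
  have h3 := mul_le_mul_of_nonneg_right hp.1 hF
  have h4 := mul_le_mul_of_nonneg_right hq.1 hF'
  linarith [hb.1]

/-- The powers of the products along Farey words have norm at most the power of the spectral
radius, up to a subexponential factor that is uniform over all Farey words. -/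
theorem NonnegBalanced.exists_hsNorm_fareyWord_pow_le {N : Fin 2 → Mat2} (hN : NonnegBalanced N)
    {ε : ℝ} (hε : 0 < ε) : ∃ K : ℝ, 1 ≤ K ∧ ∀ n k, k ≤ 2 ^ n → ∀ a : ℕ,
      hsNorm (wordMat N (fareyWord n k) ^ a) ≤
        K * (Real.exp ε ^ a * specRad (wordMat N (fareyWord n k)).trace ^ a) := by
  obtain ⟨K0, hK0, h0⟩ := _root_.exists_hsNorm_pow_le (hN.det_eq_one 0) hN.traceBalanced.1 hε
  obtain ⟨K1, hK1, h1⟩ := _root_.exists_hsNorm_pow_le (hN.det_eq_one 1) hN.traceBalanced.2.1 hε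
  obtain ⟨K2, hK2, h2⟩ := hN.exists_hsNorm_pow_le
  refine ⟨K0 + K1 + K2, by linarith, fun n k hk a => ?_⟩
  have ht := hN.two_le_trace_fareyWord n k hk
  have hE : Real.exp (ε * a) = Real.exp ε ^ a := by rw [mul_comm, Real.exp_nat_mul]
  have hE1 : 1 ≤ Real.exp ε ^ a := one_le_pow₀ (Real.one_le_exp hε.le)
  rcases fareyWord_cases n k hk with e | e | ⟨u, e⟩
  · rw [e, wordMat_singleton] at ht ⊢
    rw [← hE]
    have := specRad_pos ht
    refine (h0 a).trans ?_
    gcongr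
    linarith
  · rw [e, wordMat_singleton] at ht ⊢
    rw [← hE]
    have := specRad_pos ht
    refine (h1 a).trans ?_
    gcongr
    linarith
  · rw [e] at ht ⊢
    have := specRad_pos ht
    refine (h2 u ht a).trans ?_
    gcongr
    · linarith
    · exact le_mul_of_one_le_left (by positivity) hE1

/-- Logarithmic form of `hsNorm_wordMat_le_of_runs`, for either of the two matrices in the role of
the one that is grouped into runs. -/
theorem log_hsNorm_wordMat_le_of_runs {A B : Mat2} {K ε s t : ℝ} (hK : 1 ≤ K) (hs : 0 < s)
    (ht : 0 < t) (hA : ∀ a : ℕ, hsNorm (A ^ a) ≤ K * (Real.exp ε ^ a * s ^ a))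
    (hB : ∀ a : ℕ, hsNorm (B ^ a) ≤ K * (Real.exp ε ^ a * t ^ a)) (i j : Fin 2)
    (hij : ∀ k, k = i ∨ k = j) (hne : i ≠ j) {P : Fin 2 → Mat2} (hPi : P i = A) (hPj : P j = B)
    (b : List (Fin 2)) (hdet : (wordMat P b).det = 1) :
    Real.log (hsNorm (wordMat P b)) ≤ (2 * b.count j + 1) * Real.log K +
      ε * (b.count i + b.count j) + (b.count i * Real.log s + b.count j * Real.log t) := by
  have hE := Real.exp_pos ε
  have hB1 : hsNorm B ≤ K * (Real.exp ε * t) := by simpa using hB 1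
  have h := hsNorm_wordMat_le_of_runs hK hE.le hs.le (mul_pos hE ht).le hA hB1 i j hij hne hPi hPj
    b 0
  rw [pow_zero, Matrix.one_mul, add_zero] at h
  have hK0 : 0 < K := by linarith
  have h2 := Real.log_le_log (by linarith [one_le_hsNorm hdet]) h
  rw [Real.log_mul (by positivity) (by positivity), Real.log_mul (by positivity) (by positivity),
    Real.log_mul (by positivity) (by positivity), Real.log_pow, Real.log_pow, Real.log_pow,
    Real.log_pow, Real.log_mul hE.ne' ht.ne', Real.log_exp] at h2
  push_cast at h2
  linarith

/-- The chords of level `n` approximate the Lyapunov exponents uniformly. Runs of the more frequent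
block are estimated by the preceding lemma, and the other block has frequency at most
`1 / (n + 2)`. -/
theorem NonnegBalanced.lyapunovExponent_le_fareyChord_add {N : Fin 2 → Mat2}
    (hN : NonnegBalanced N) {ε : ℝ} (hε : 0 < ε) : ∃ K : ℝ, 0 ≤ K ∧ ∀ (α : ℝ), 0 ≤ α → α ≤ 1 →
      ∀ μ : Measure InfWord, IsSturmianMeasure α μ → ∀ n k : ℕ, k < 2 ^ n →
      0 ≤ displacement α (fareyWord n k) → displacement α (fareyWord n (k + 1)) ≤ 0 →
      lyapunovExponent N μ ≤ fareyChord N n k α + ε + K / (n + 2) := by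
  obtain ⟨K, hK, hpow⟩ := hN.exists_hsNorm_fareyWord_pow_le hε
  have hlK := Real.log_nonneg hK
  refine ⟨2 * Real.log K, by positivity, fun α h0 h1 μ hμ n k hk hv hw => ?_⟩
  obtain ⟨C, hC, hpar⟩ := hN.exists_parsing_cocycle h0 h1 hk hv hw
  have hF := hN.fareyLog_nonneg hk.le
  have hF' := hN.fareyLog_nonneg (n := n) (k := k + 1) hk
  have hs := specRad_pos (hN.two_le_trace_fareyWord n k hk.le)
  have ht := specRad_pos (hN.two_le_trace_fareyWord n (k + 1) hk)
  have hA := hpow n k hk.le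
  have hB := hpow n (k + 1) hk
  have hdet := length_mul_displacement_sub α n k hk
  have hlen : ((n : ℝ) + 2) ≤ (fareyWord n k).length + (fareyWord n (k + 1)).length := by
    exact_mod_cast le_length_fareyWord_add n k
  have hl1 : (1 : ℝ) ≤ (fareyWord n k).length := by exact_mod_cast one_le_length_fareyWord n k
  have hl2 : (1 : ℝ) ≤ (fareyWord n (k + 1)).length := by
    exact_mod_cast one_le_length_fareyWord n (k + 1)
  have hdetP : ∀ b, (wordMat ![wordMat N (fareyWord n k), wordMat N (fareyWord n (k + 1))] b).det
      = 1 := det_wordMat (fun i => by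
        match i with
        | 0 => exact det_wordMat hN.det_eq_one _
        | 1 => exact det_wordMat hN.det_eq_one _)
  have hn2 : (0 : ℝ) < n + 2 := by positivity
  have hfl : Real.log (specRad (wordMat N (fareyWord n k)).trace) = fareyLog N n k := rfl
  have hfl' : Real.log (specRad (wordMat N (fareyWord n (k + 1))).trace) = fareyLog N n (k + 1) :=
    rfl
  set A := wordMat N (fareyWord n k)
  set B := wordMat N (fareyWord n (k + 1))
  set e := displacement α (fareyWord n k)
  set d := -displacement α (fareyWord n (k + 1)) with hd
  have hd0 : 0 ≤ d := by linarith
  have hd1 : d ≤ 1 := by nlinarith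
  have he1 : e ≤ 1 := by nlinarith
  set F := fareyLog N n k
  set F' := fareyLog N n (k + 1)
  have hchord : fareyChord N n k α = e * F' + d * F := by rw [fareyChord]; ring
  set c := specRad A.trace
  set c' := specRad B.trace
  have hde1 : ε * (d + e) ≤ ε := by
    refine mul_le_of_le_one_right hε.le ?_
    nlinarith
  have hmin : ∀ f : ℝ, 0 ≤ f → f ≤ d → f ≤ e → 2 * Real.log K * f ≤ 2 * Real.log K / (n + 2) := by
    intro f hf0 hfd hfe
    rw [le_div_iff₀ hn2, mul_assoc]
    refine mul_le_of_le_one_right (by positivity) ?_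
    have h2 := mul_le_mul_of_nonneg_left hlen hf0
    have h3 := mul_le_mul_of_nonneg_right hfd (zero_le_one.trans hl1)
    have h4 := mul_le_mul_of_nonneg_right hfe (zero_le_one.trans hl2)
    linarith
  rcases le_total e d with hed | hde
  · refine (hμ.lyapunovExponent_le hN.det_ne_zero (c := e * F' + d * F + ε * (d + e) +
      2 * Real.log K * e) (C := C + 2 * ε * C + C * F + C * F' + (2 * C + 1) * Real.log K)
      fun x hx m => ?_).trans (by linarith [hmin e hv hed le_rfl])
    obtain ⟨b, hb, hp, hq⟩ := hpar x hx m
    have h2 := log_hsNorm_wordMat_le_of_runs hK hs ht hA hB 0 1 (by decide) (by decide)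
      (P := ![A, B]) rfl rfl b (hdetP b)
    rw [abs_le] at hb hp hq
    rw [hfl, hfl'] at h2
    have := mul_le_mul_of_nonneg_right hp.2 hF
    have := mul_le_mul_of_nonneg_right hq.2 hF'
    have := mul_le_mul_of_nonneg_right hp.2 hε.le
    have := mul_le_mul_of_nonneg_right hq.2 hε.le
    have := mul_le_mul_of_nonneg_right hq.2 hlK
    linarith [hb.2]
  · refine (hμ.lyapunovExponent_le hN.det_ne_zero (c := e * F' + d * F + ε * (d + e) +
      2 * Real.log K * d) (C := C + 2 * ε * C + C * F + C * F' + (2 * C + 1) * Real.log K)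
      fun x hx m => ?_).trans (by linarith [hmin d hd0 le_rfl hde])
    obtain ⟨b, hb, hp, hq⟩ := hpar x hx m
    have h2 := log_hsNorm_wordMat_le_of_runs hK ht hs hB hA 1 0 (by decide) (by decide)
      (P := ![A, B]) rfl rfl b (hdetP b)
    rw [abs_le] at hb hp hq
    rw [hfl, hfl'] at h2
    have := mul_le_mul_of_nonneg_right hp.2 hF
    have := mul_le_mul_of_nonneg_right hq.2 hF'
    have := mul_le_mul_of_nonneg_right hp.2 hε.le
    have := mul_le_mul_of_nonneg_right hq.2 hε.le
    have := mul_le_mul_of_nonneg_right hp.2 hlK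
    linarith [hb.2]

/-! ### Continuity and strict concavity -/

/-- A concave function on `[0, 1]` that is affine on no subinterval is strictly concave. -/
theorem strictConcaveOn_Icc_of_exists_lt {f : ℝ → ℝ} (hf : ConcaveOn ℝ (Icc 0 1) f)
    (h : ∀ x z : ℝ, 0 ≤ x → x < z → z ≤ 1 → ∃ u ∈ Icc x z, ∃ v ∈ Icc x z, ∃ a b : ℝ,
      0 < a ∧ 0 < b ∧ a + b = 1 ∧ a * f u + b * f v < f (a * u + b * v)) :
    StrictConcaveOn ℝ (Icc 0 1) f := by
  refine LinearOrder.strictConcaveOn_of_lt (convex_Icc 0 1) fun x hx z hz hxz a b ha hb hab => ?_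
  simp only [smul_eq_mul]
  by_contra! hle
  set y := a * x + b * z with hy
  have hyx' : y - x = b * (z - x) := by rw [hy]; linear_combination x * hab
  have hzy' : z - y = a * (z - x) := by rw [hy]; linear_combination (-z) * hab
  have hxy : x < y := by linarith [mul_pos hb (sub_pos.mpr hxz)]
  have hyz : y < z := by linarith [mul_pos ha (sub_pos.mpr hxz)]
  set s := (f z - f x) / (z - x) with hs
  have hzx : 0 < z - x := by linarith
  have hsz : s * (z - x) = f z - f x := div_mul_cancel₀ _ hzx.ne'
  -- The chord over `[x, z]` bounds `f` from below, and equality at `y` spreads to `[x, y]`.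
  have hchord : ∀ t ∈ Icc x y, f t ≤ f x + s * (t - x) := by
    intro t ht
    have hzt : 0 < z - t := by linarith [ht.2]
    have key := hf.2 (show t ∈ Icc (0 : ℝ) 1 from ⟨by linarith [hx.1, ht.1], by linarith [hz.2]⟩) hz
      (show 0 ≤ (z - y) / (z - t) from div_nonneg (by linarith) hzt.le)
      (show 0 ≤ (y - t) / (z - t) from div_nonneg (by linarith [ht.2]) hzt.le)
      (by rw [← add_div, div_eq_one_iff_eq hzt.ne']; ring)
    simp only [smul_eq_mul] at key
    have e1 : (z - y) / (z - t) * t + (y - t) / (z - t) * z = y := by field_simp; ring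
    rw [e1] at key
    have h1 : ((z - y) / (z - t) * f t + (y - t) / (z - t) * f z) * (z - t) ≤ f y * (z - t) :=
      mul_le_mul_of_nonneg_right key hzt.le
    have e2 : ((z - y) / (z - t) * f t + (y - t) / (z - t) * f z) * (z - t) =
        (z - y) * f t + (y - t) * f z := by field_simp
    rw [e2] at h1
    have e3 : a * f x + b * f z = f x + s * (y - x) := by
      rw [hyx']
      linear_combination (f x) * hab - b * hsz
    rw [e3] at hle
    have h2 := mul_le_mul_of_nonneg_right hle hzt.le
    have h3 : (z - y) * f t ≤ (z - y) * (f x + s * (t - x)) := by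
      have e4 : f z = f x + s * (z - x) := by linarith
      rw [e4] at h1
      nlinarith
    exact le_of_mul_le_mul_left h3 (by linarith)
  have hchord' : ∀ t ∈ Icc x y, f x + s * (t - x) ≤ f t := by
    intro t ht
    have key := hf.2 hx hz (show 0 ≤ (z - t) / (z - x) from div_nonneg (by linarith [ht.2]) hzx.le)
      (show 0 ≤ (t - x) / (z - x) from div_nonneg (by linarith [ht.1]) hzx.le)
      (by rw [← add_div, div_eq_one_iff_eq hzx.ne']; ring)
    simp only [smul_eq_mul] at key
    have e1 : (z - t) / (z - x) * x + (t - x) / (z - x) * z = t := by field_simp; ring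
    have e2 : (z - t) / (z - x) * f x + (t - x) / (z - x) * f z = f x + s * (t - x) := by
      rw [hs]; field_simp; ring
    rwa [e1, e2] at key
  obtain ⟨u, hu, v, hv, p, q, hp, hq, hpq, hlt⟩ := h x y hx.1 hxy (by linarith [hz.2])
  have h1 := hchord' u hu
  have h2 := hchord' v hv
  have h3 := hchord (p * u + q * v) (convex_Icc x y hu hv hp.le hq.le hpq)
  have e : f x + s * (p * u + q * v - x) =
      p * (f x + s * (u - x)) + q * (f x + s * (v - x)) := by
    linear_combination (s * x - f x) * hpq
  nlinarith

/-- The slope `|w|₁ / |w|` of a word. -/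
noncomputable def slope₁ (w : List (Fin 2)) : ℝ := (w.count 1 : ℝ) / w.length

theorem displacement_eq_mul_sub (α : ℝ) {w : List (Fin 2)} (hw : 1 ≤ w.length) :
    displacement α w = w.length * (α - slope₁ w) := by
  have : (w.length : ℝ) ≠ 0 := by positivity
  rw [displacement, slope₁]
  field_simp

theorem slope₁_nonneg (w : List (Fin 2)) : 0 ≤ slope₁ w := by unfold slope₁; positivity

theorem slope₁_le_one (w : List (Fin 2)) : slope₁ w ≤ 1 :=
  div_le_one_of_le₀ (by exact_mod_cast List.count_le_length) (by positivity)

theorem slope₁_sub (n k : ℕ) (hk : k < 2 ^ n) :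
    0 < slope₁ (fareyWord n (k + 1)) - slope₁ (fareyWord n k) ∧
      slope₁ (fareyWord n (k + 1)) - slope₁ (fareyWord n k) ≤ 1 / (n + 1) := by
  have h := length_mul_displacement_sub 0 n k hk
  rw [displacement_eq_mul_sub _ (one_le_length_fareyWord n k),
    displacement_eq_mul_sub _ (one_le_length_fareyWord n (k + 1))] at h
  have h1 : (1 : ℝ) ≤ (fareyWord n k).length := by exact_mod_cast one_le_length_fareyWord n k
  have h2 : (1 : ℝ) ≤ (fareyWord n (k + 1)).length := by
    exact_mod_cast one_le_length_fareyWord n (k + 1)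
  have h3 : ((n : ℝ) + 2) ≤ (fareyWord n k).length + (fareyWord n (k + 1)).length := by
    exact_mod_cast le_length_fareyWord_add n k
  set p : ℝ := ((fareyWord n k).length : ℝ)
  set q : ℝ := ((fareyWord n (k + 1)).length : ℝ)
  have e : (slope₁ (fareyWord n (k + 1)) - slope₁ (fareyWord n k)) * (p * q) = 1 := by linarith
  have hn : (0 : ℝ) < n + 1 := by positivity
  have hpq : (n : ℝ) + 1 ≤ p * q := by nlinarith
  have hpos : 0 < slope₁ (fareyWord n (k + 1)) - slope₁ (fareyWord n k) :=
    pos_of_mul_pos_left (by rw [e]; exact one_pos) (by positivity)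
  refine ⟨hpos, ?_⟩
  rw [le_div_iff₀ hn]
  exact (mul_le_mul_of_nonneg_left hpq hpos.le).trans e.le

theorem fareyChord_convexComb (N : Fin 2 → Mat2) (n k : ℕ) {a b : ℝ} (hab : a + b = 1)
    (x z : ℝ) :
    fareyChord N n k (a * x + b * z) = a * fareyChord N n k x + b * fareyChord N n k z := by
  obtain rfl : b = 1 - a := by linarith
  simp only [fareyChord, displacement]
  ring

/-- All chords of a sufficiently high level approximate the Lyapunov exponents from below. -/
theorem NonnegBalanced.exists_level {N : Fin 2 → Mat2} (hN : NonnegBalanced N)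
    {μ : ℝ → Measure InfWord} (hμ : ∀ α ∈ Icc (0 : ℝ) 1, IsSturmianMeasure α (μ α))
    {ε : ℝ} (hε : 0 < ε) : ∃ n₀ : ℕ, ∀ n ≥ n₀, ∀ α ∈ Icc (0 : ℝ) 1, ∀ k < 2 ^ n,
      0 ≤ displacement α (fareyWord n k) → displacement α (fareyWord n (k + 1)) ≤ 0 →
      lyapunovExponent N (μ α) ≤ fareyChord N n k α + ε := by
  obtain ⟨K, hK, h⟩ := hN.lyapunovExponent_le_fareyChord_add (half_pos hε)
  obtain ⟨n₀, hn₀⟩ := exists_nat_gt (2 * K / ε)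
  refine ⟨n₀, fun n hn α hα k hk hv hw => ?_⟩
  have h1 := h α hα.1 hα.2 (μ α) (hμ α hα) n k hk hv hw
  have h2 : K / (n + 2) ≤ ε / 2 := by
    rw [div_lt_iff₀ hε] at hn₀
    rw [div_le_iff₀ (by positivity)]
    have : (n₀ : ℝ) ≤ n := by exact_mod_cast hn
    nlinarith
  linarith

theorem NonnegBalanced.concaveOn_lyapunovExponent {N : Fin 2 → Mat2} (hN : NonnegBalanced N)
    {μ : ℝ → Measure InfWord} (hμ : ∀ α ∈ Icc (0 : ℝ) 1, IsSturmianMeasure α (μ α)) :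
    ConcaveOn ℝ (Icc 0 1) fun α => lyapunovExponent N (μ α) := by
  refine ⟨convex_Icc 0 1, fun x hx z hz a b ha hb hab => ?_⟩
  have hy := convex_Icc (0 : ℝ) 1 hx hz ha hb hab
  simp only [smul_eq_mul] at hy ⊢
  refine le_of_forall_pos_le_add fun ε hε => ?_
  obtain ⟨n, hn⟩ := hN.exists_level hμ hε
  have hn := hn n le_rfl
  obtain ⟨i, hi, hi0, hi1⟩ := exists_fareyWord_interval hx.1 hx.2 n
  obtain ⟨j, hj, hj0, hj1⟩ := exists_fareyWord_interval hz.1 hz.2 n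
  obtain ⟨k, hk, hk0, hk1⟩ := exists_fareyWord_interval hy.1 hy.2 n
  have h1 := hn x hx i hi hi0 hi1
  have h2 := hn z hz j hj hj0 hj1
  have h3 := hN.fareyChord_le_lyapunovExponent hy.1 hy.2 (hμ _ hy) hk hk0 hk1
  rw [fareyChord_convexComb N n k hab] at h3
  have h4 := hN.fareyChord_le hi hi0 hi1 hk
  have h5 := hN.fareyChord_le hj hj0 hj1 hk
  have h6 := mul_le_mul_of_nonneg_left (h1.trans (add_le_add_left h4 ε)) ha
  have h7 := mul_le_mul_of_nonneg_left (h2.trans (add_le_add_left h5 ε)) hb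
  have e : a * ε + b * ε = ε := by rw [← add_mul, hab, one_mul]
  linarith

theorem NonnegBalanced.continuousOn_lyapunovExponent {N : Fin 2 → Mat2} (hN : NonnegBalanced N)
    {μ : ℝ → Measure InfWord} (hμ : ∀ α ∈ Icc (0 : ℝ) 1, IsSturmianMeasure α (μ α)) :
    ContinuousOn (fun α => lyapunovExponent N (μ α)) (Icc 0 1) := by
  refine continuousOn_of_uniform_approx_of_continuousOn fun u hu => ?_
  obtain ⟨ε, hε, hεu⟩ := Metric.mem_uniformity_dist.mp hu
  obtain ⟨n, hn⟩ := hN.exists_level hμ (half_pos hε)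
  have hn := hn n le_rfl
  have hne : (Finset.range (2 ^ n)).Nonempty := ⟨0, by simp⟩
  refine ⟨fun α => (Finset.range (2 ^ n)).inf' hne fun k => fareyChord N n k α, ?_, ?_⟩
  · refine Continuous.continuousOn (Continuous.finset_inf'_apply hne fun k _ => ?_)
    unfold fareyChord displacement
    fun_prop
  · intro α hα
    obtain ⟨k, hk, hk0, hk1⟩ := exists_fareyWord_interval hα.1 hα.2 n
    have e : ((Finset.range (2 ^ n)).inf' hne fun k => fareyChord N n k α) =
        fareyChord N n k α :=
      le_antisymm (Finset.inf'_le _ (Finset.mem_range.mpr hk))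
        (Finset.le_inf' _ _ fun j hj => hN.fareyChord_le hk hk0 hk1 (Finset.mem_range.mp hj))
    apply hεu
    have h1 := hn α hα k hk hk0 hk1
    have h2 := hN.fareyChord_le_lyapunovExponent hα.1 hα.2 (hμ α hα) hk hk0 hk1
    simp only [e, Real.dist_eq]
    rw [abs_lt]
    constructor <;> linarith

/-- At the slope of a Farey word, the Lyapunov exponent is the normalized logarithm of the spectral
radius. -/
theorem NonnegBalanced.lyapunovExponent_slope₁ {N : Fin 2 → Mat2} (hN : NonnegBalanced N)
    {μ : ℝ → Measure InfWord} (hμ : ∀ α ∈ Icc (0 : ℝ) 1, IsSturmianMeasure α (μ α)) {n k : ℕ}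
    (hk : k < 2 ^ n) :
    (fareyWord n k).length * lyapunovExponent N (μ (slope₁ (fareyWord n k))) =
      fareyLog N n k := by
  set α := slope₁ (fareyWord n k) with hα
  have hα0 : α ∈ Icc (0 : ℝ) 1 := ⟨slope₁_nonneg _, slope₁_le_one _⟩
  have hl : (1 : ℝ) ≤ (fareyWord n k).length := by exact_mod_cast one_le_length_fareyWord n k
  -- The word persists at all later levels, where it is the left end of an interval.
  have key : ∀ m : ℕ, 2 ^ m * k < 2 ^ (n + m) ∧
      displacement α (fareyWord (n + m) (2 ^ m * k)) = 0 ∧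
      displacement α (fareyWord (n + m) (2 ^ m * k + 1)) ≤ 0 ∧
      (fareyWord n k).length * fareyChord N (n + m) (2 ^ m * k) α = fareyLog N n k := by
    intro m
    have hk' : 2 ^ m * k < 2 ^ (n + m) := by
      rw [pow_add, mul_comm]; exact Nat.mul_lt_mul_of_pos_right hk (by positivity)
    have h0 : displacement α (fareyWord (n + m) (2 ^ m * k)) = 0 := by
      rw [fareyWord_two_pow_mul, displacement_eq_mul_sub _ (one_le_length_fareyWord n k), sub_self,
        mul_zero]
    have h1 := length_mul_displacement_sub α (n + m) (2 ^ m * k) hk'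
    rw [h0, fareyWord_two_pow_mul, mul_zero, zero_sub] at h1
    refine ⟨hk', h0, ?_, ?_⟩
    · by_contra! hc
      nlinarith
    · have e : fareyLog N (n + m) (2 ^ m * k) = fareyLog N n k := by
        rw [fareyLog, fareyWord_two_pow_mul, fareyLog]
      rw [fareyChord, h0, e]
      linear_combination (fareyLog N n k) * h1
  apply le_antisymm
  · refine le_of_forall_pos_le_add fun ε hε => ?_
    have hε' : 0 < ε / (fareyWord n k).length := by positivity
    obtain ⟨n₀, hn₀⟩ := hN.exists_level hμ hε'
    obtain ⟨h1, h2, h3, h4⟩ := key n₀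
    have h5 := hn₀ (n + n₀) (by omega) α hα0 _ h1 h2.ge h3
    have h6 := mul_le_mul_of_nonneg_left h5 (zero_le_one.trans hl)
    rwa [mul_add, h4, mul_div_cancel₀ _ (by positivity)] at h6
  · obtain ⟨h1, h2, h3, h4⟩ := key 0
    have h5 := hN.fareyChord_le_lyapunovExponent hα0.1 hα0.2 (hμ _ hα0) h1 h2.ge h3
    rw [← h4]
    exact mul_le_mul_of_nonneg_left h5 (zero_le_one.trans hl)

theorem NonnegBalanced.strictConcaveOn_lyapunovExponent {N : Fin 2 → Mat2} (hN : NonnegBalanced N)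
    {μ : ℝ → Measure InfWord} (hμ : ∀ α ∈ Icc (0 : ℝ) 1, IsSturmianMeasure α (μ α)) :
    StrictConcaveOn ℝ (Icc 0 1) fun α => lyapunovExponent N (μ α) := by
  refine strictConcaveOn_Icc_of_exists_lt (hN.concaveOn_lyapunovExponent hμ)
    fun x z hx hxz hz => ?_
  set y := (x + z) / 2 with hy
  obtain ⟨n, hn⟩ := exists_nat_gt (4 / (z - x))
  have hzx : 0 < z - x := by linarith
  have hn1 : (2 : ℝ) * (1 / (n + 1)) < (z - x) / 2 := by
    rw [div_lt_iff₀ hzx] at hn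
    rw [mul_one_div, div_lt_iff₀ (by positivity)]
    nlinarith
  have hn0 : (0 : ℝ) < 1 / (n + 1) := by positivity
  obtain ⟨k, hk, hk0, hk1⟩ := exists_fareyWord_interval (α := y) (by linarith) (by linarith) n
  have hl0 : (1 : ℝ) ≤ (fareyWord n k).length := by exact_mod_cast one_le_length_fareyWord n k
  have hl1 : (1 : ℝ) ≤ (fareyWord n (k + 1)).length := by
    exact_mod_cast one_le_length_fareyWord n (k + 1)
  rw [displacement_eq_mul_sub _ (one_le_length_fareyWord n k)] at hk0
  rw [displacement_eq_mul_sub _ (one_le_length_fareyWord n (k + 1))] at hk1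
  have hr0 : slope₁ (fareyWord n k) ≤ y := by
    have := nonneg_of_mul_nonneg_right hk0 (by linarith)
    linarith
  have hr1 : y ≤ slope₁ (fareyWord n (k + 1)) := by
    by_contra! hc
    nlinarith
  have hgap := slope₁_sub n k hk
  -- The Farey interval that contains the midpoint of `[x, z]` is not the first or the last one.
  have hk2 : 1 ≤ k := by
    by_contra! hc
    obtain rfl : k = 0 := by omega
    have : slope₁ (fareyWord n 0) = 0 := by simp [fareyWord_zero, slope₁]
    linarith [hgap.2]
  have hk3 : k + 1 < 2 ^ n := by
    by_contra! hc
    have e : k + 1 = 2 ^ n := by omega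
    have : slope₁ (fareyWord n (k + 1)) = 1 := by simp [e, fareyWord_two_pow, slope₁]
    linarith [hgap.2]
  obtain ⟨i, rfl⟩ : ∃ i, k = i + 1 := ⟨k - 1, by omega⟩
  have hgap' := slope₁_sub n i (by omega)
  obtain ⟨c, hc, hlt, hdisp⟩ := hN.fareyLog_add_lt n (i + 1) (by omega) hk
  have hli : (1 : ℝ) ≤ (fareyWord n i).length := by exact_mod_cast one_le_length_fareyWord n i
  rw [Nat.add_sub_cancel] at hlt hdisp
  rw [← hN.lyapunovExponent_slope₁ hμ hk3, ← hN.lyapunovExponent_slope₁ hμ hk,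
    ← hN.lyapunovExponent_slope₁ hμ (show i < 2 ^ n by omega)] at hlt
  have d0 := hdisp 0
  have d1 := hdisp 1
  rw [displacement_eq_mul_sub _ (one_le_length_fareyWord n _),
    displacement_eq_mul_sub _ (one_le_length_fareyWord n _),
    displacement_eq_mul_sub _ (one_le_length_fareyWord n _)] at d0 d1
  refine ⟨slope₁ (fareyWord n i), ⟨by linarith [hgap.2, hgap'.2], by linarith [hgap.1, hgap'.1]⟩,
    slope₁ (fareyWord n (i + 1 + 1)), ⟨by linarith [hgap.1, hgap'.1], by linarith [hgap.2]⟩, ?_⟩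
  set p : ℝ := ((fareyWord n i).length : ℝ)
  set q : ℝ := ((fareyWord n (i + 1)).length : ℝ)
  set r : ℝ := ((fareyWord n (i + 1 + 1)).length : ℝ)
  have hpqr : p + r = c * q := by linarith
  have hcq : 0 < c * q := by positivity
  have e : p / (c * q) * slope₁ (fareyWord n i) + r / (c * q) * slope₁ (fareyWord n (i + 1 + 1)) =
      slope₁ (fareyWord n (i + 1)) := by
    field_simp
    linarith
  refine ⟨p / (c * q), r / (c * q), by positivity, by positivity, ?_, ?_⟩
  · rw [← add_div, hpqr, div_self hcq.ne']
  · rw [e, div_mul_eq_mul_div, div_mul_eq_mul_div, ← add_div, div_lt_iff₀ hcq]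
    linarith

/-! ### Existence of Sturmian measures -/

theorem eventually_floor_add_eq (y c : ℝ) : ∀ᶠ t in 𝓝[≥] y, ⌊t + c⌋ = ⌊y + c⌋ := by
  have h : y < ⌊y + c⌋ + 1 - c := by linarith [Int.lt_floor_add_one (y + c)]
  filter_upwards [Ico_mem_nhdsGE h] with t ht
  rw [Int.floor_eq_iff]
  exact ⟨by linarith [Int.floor_le (y + c), ht.1], by linarith [ht.2]⟩

/-- Codings depend continuously from the right on the base point. -/
theorem eventually_coding_eq (α y : ℝ) (n : ℕ) :
    ∀ᶠ t in 𝓝[≥] y, ∀ k ∈ Finset.range n, coding α t k = coding α y k := by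
  rw [Filter.eventually_all_finset]
  intro k _
  filter_upwards [eventually_floor_add_eq y (((k : ℝ) + 1) * α), eventually_floor_add_eq y (k * α)]
    with t h1 h2
  simp only [coding, h1, h2]

/-- For an irrational slope, the orbit of `0` is dense, so that it approaches `y` from the right. -/
theorem exists_coding_mul_eq_of_irrational {α : ℝ} (hα : Irrational α) (y : ℝ) (n M : ℕ) :
    ∃ m ≥ M, ∀ k < n, coding α (m * α) k = coding α y k := by
  obtain ⟨u, hyu, hu⟩ := (mem_nhdsGE_iff_exists_Ico_subset).mp (eventually_coding_eq α y n)
  have hyu : y < u := hyu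
  have hdense : DenseRange (fun i : ℤ => i • (α : UnitAddCircle)) :=
    AddCircle.denseRange_zsmul_coe_iff.mpr (by simpa using hα)
  have hcl : MapClusterPt (((y + u) / 2 : ℝ) : UnitAddCircle) atTop
      (fun i : ℕ => i • (α : UnitAddCircle)) :=
    ((mapClusterPt_atTop_nsmul_tfae _ _).out 0 3).mpr (hdense _)
  have hopen : IsOpen ((fun t : ℝ => (t : UnitAddCircle)) '' Ioo y u) :=
    QuotientAddGroup.isOpenMap_coe _ isOpen_Ioo
  have hfreq := mapClusterPt_iff_frequently.mp hcl _
    (hopen.mem_nhds ⟨(y + u) / 2, ⟨by linarith, by linarith⟩, rfl⟩)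
  obtain ⟨m, hm, t, ht, e⟩ := (frequently_atTop.mp hfreq) M
  refine ⟨m, hm, fun k hk => ?_⟩
  have e' : ((m * α - t : ℝ) : UnitAddCircle) = 0 := by
    have e2 : (t : UnitAddCircle) = m • (α : UnitAddCircle) := e
    rw [AddCircle.coe_sub, e2, ← AddCircle.coe_nsmul, nsmul_eq_mul, sub_self]
  obtain ⟨z, hz⟩ := (AddCircle.coe_eq_zero_iff 1).mp e'
  have e3 : m * α = t + z := by
    rw [zsmul_eq_mul, mul_one] at hz
    linarith
  rw [e3, coding_add_int]
  exact hu ⟨ht.1.le, ht.2⟩ k (Finset.mem_range.mpr hk)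

/-- For a rational slope, the coding of `y` is the coding of a point of the orbit of `0`. -/
theorem exists_coding_mul_eq_of_rat (a : ℚ) (y : ℝ) (M : ℕ) :
    ∃ m ≥ M, coding a (m * (a : ℝ)) = coding a y := by
  have hq : (0 : ℝ) < a.den := by exact_mod_cast a.den_pos
  have ha : (a : ℝ) = a.num / a.den := by exact_mod_cast (Rat.num_div_den a).symm
  -- Only the integer part of `y * a.den` matters.
  have hfl : ∀ i : ℤ, ∀ t : ℝ, ⌊t + i / a.den⌋ = (⌊t * a.den⌋ + i) / (a.den : ℤ) := by
    intro i t
    have e : t + (i : ℝ) / a.den = (t * a.den + i) / (a.den : ℕ) := by field_simp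
    rw [e, Int.floor_div_natCast, Int.floor_add_intCast]
  have hcod : ∀ s t : ℝ, ⌊s * a.den⌋ = ⌊t * a.den⌋ → coding a s = coding a t := by
    intro s t hst
    funext k
    have e1 : ((k : ℝ) + 1) * (a : ℝ) = (((k + 1 : ℕ) * a.num : ℤ) : ℝ) / a.den := by
      rw [ha]; push_cast; ring
    have e2 : (k : ℝ) * (a : ℝ) = ((k * a.num : ℤ) : ℝ) / a.den := by
      rw [ha]; push_cast; ring
    simp only [coding, e1, e2, hfl, hst]
  obtain ⟨u, v, huv⟩ : ∃ u v : ℤ, a.num * u + a.den * v = 1 := by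
    obtain ⟨u, v, h⟩ := a.isCoprime_num_den
    exact ⟨u, v, by linarith⟩
  set j := ⌊y * a.den⌋ with hj
  have hq' : (0 : ℤ) < a.den := by exact_mod_cast a.den_pos
  have hm0 : 0 ≤ (j * u) % a.den := Int.emod_nonneg _ hq'.ne'
  refine ⟨((j * u) % a.den).toNat + a.den * M, ?_, ?_⟩
  · have : M ≤ a.den * M := Nat.le_mul_of_pos_left _ a.den_pos
    omega
  set m := ((j * u) % a.den).toNat + a.den * M with hm
  have hmz : (m : ℤ) = j * u + a.den * (M - (j * u) / a.den) := by
    rw [hm]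
    push_cast
    rw [Int.toNat_of_nonneg hm0, Int.emod_def]
    ring
  have e : (m : ℝ) * (a : ℝ) = (j : ℝ) / a.den +
      ((-(j * v) + a.num * (M - (j * u) / a.den) : ℤ) : ℝ) := by
    have e1 : (m : ℝ) = ((j * u + a.den * (M - (j * u) / a.den) : ℤ) : ℝ) := by
      exact_mod_cast hmz
    have e2 : (a.num : ℝ) * u + a.den * v = 1 := by exact_mod_cast huv
    rw [ha, e1]
    generalize (j * u) / (a.den : ℤ) = w
    push_cast
    field_simp
    linear_combination (j : ℝ) * e2
  rw [e, coding_add_int]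
  apply hcod
  rw [div_mul_cancel₀ _ hq.ne', Int.floor_intCast]

theorem coding_mem_sturmianShift (α y : ℝ) : coding α y ∈ sturmianShift α := by
  rw [sturmianShift, mem_omegaLimit_singleton_iff_mapClusterPt, mapClusterPt_iff_frequently]
  intro s hs
  rw [frequently_atTop]
  intro M
  -- A neighbourhood contains all words with the same first `n` letters, for some `n`.
  obtain ⟨n, hn⟩ : ∃ n : ℕ, ∀ x : InfWord, (∀ k < n, x k = coding α y k) → x ∈ s := by
    rw [nhds_pi, Filter.mem_pi] at hs
    obtain ⟨I, hI, t, ht, hts⟩ := hs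
    obtain ⟨n, hn⟩ := hI.bddAbove
    refine ⟨n + 1, fun x hx => hts fun k hk => ?_⟩
    rw [hx k (Nat.lt_succ_of_le (hn hk))]
    exact mem_of_mem_nhds (ht k)
  have key : ∃ m ≥ M, ∀ k < n, coding α (m * α) k = coding α y k := by
    by_cases hα : Irrational α
    · exact exists_coding_mul_eq_of_irrational hα y n M
    · obtain ⟨a, rfl⟩ := not_not.mp hα
      obtain ⟨m, hm, e⟩ := exists_coding_mul_eq_of_rat a y M
      exact ⟨m, hm, fun k _ => by rw [e]⟩
  obtain ⟨m, hm, h⟩ := key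
  refine ⟨m, hm, hn _ fun k hk => ?_⟩
  rw [shift_iterate_apply, rotationWord_eq_coding, coding_add, zero_add, h k hk]

theorem measurable_coding (α : ℝ) : Measurable (coding α) := by
  refine measurable_pi_iff.mpr fun k => ?_
  have h1 : Measurable fun y : ℝ => (⌊y + ((k : ℝ) + 1) * α⌋, ⌊y + (k : ℝ) * α⌋) :=
    (Int.measurable_floor.comp (measurable_id.add_const _)).prodMk
      (Int.measurable_floor.comp (measurable_id.add_const _))
  exact (measurable_of_countable fun p : ℤ × ℤ => Fin.ofNat 2 (p.1 - p.2).toNat).comp h1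

/-- The image of Lebesgue measure on the circle under the coding is a Sturmian measure. -/
theorem isSturmianMeasure_map_coding (α : ℝ) :
    IsSturmianMeasure α ((volume.restrict (Ioc (0 : ℝ) 1)).map (coding α)) := by
  have hmeas := measurable_coding α
  have hshift : Measurable shift := continuous_shift.measurable
  refine ⟨⟨⟨?_⟩, hshift, ?_⟩, ?_⟩
  · rw [Measure.map_apply hmeas MeasurableSet.univ]
    simp
  · rw [Measure.map_map hshift hmeas]
    ext E hE
    rw [Measure.map_apply (hshift.comp hmeas) hE, Measure.map_apply hmeas hE,
      Measure.restrict_apply ((hshift.comp hmeas) hE), Measure.restrict_apply (hmeas hE)]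
    have e1 : (shift ∘ coding α) ⁻¹' E ∩ Ioc 0 1 =
        (fun y => y + α) ⁻¹' (coding α ⁻¹' E ∩ Ioc α (α + 1)) := by
      ext y
      simp only [mem_inter_iff, mem_preimage, Function.comp_apply, shift_coding, mem_Ioc]
      constructor
      · rintro ⟨h1, h2, h3⟩; exact ⟨h1, by linarith, by linarith⟩
      · rintro ⟨h1, h2, h3⟩; exact ⟨h1, by linarith, by linarith⟩
    rw [e1, measure_preimage_add_right]
    have h0 := isAddFundamentalDomain_Ioc (zero_lt_one' ℝ) 0
    have h1 := isAddFundamentalDomain_Ioc (zero_lt_one' ℝ) α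
    rw [zero_add] at h0
    refine h1.measure_set_eq h0 (hmeas hE) ?_
    rintro ⟨g, z, rfl⟩
    ext y
    have : (z • (1 : ℝ)) + y = y + z := by rw [zsmul_eq_mul, mul_one, add_comm]
    simp only [mem_preimage]
    change coding α ((z • (1 : ℝ)) + y) ∈ E ↔ _
    rw [this, coding_add_int]
  · have hS : IsClosed (sturmianShift α) := isClosed_omegaLimit _ _ _
    rw [Measure.map_apply hmeas hS.measurableSet.compl]
    have : coding α ⁻¹' (sturmianShift α)ᶜ = ∅ :=
      eq_empty_of_forall_notMem fun y hy => hy (coding_mem_sturmianShift α y)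
    rw [this, measure_empty]

/-! ### Uniqueness of Sturmian measures -/

/-- The number of letters `1` among the first `j` letters of `x`. -/
def countOnes (j : ℕ) (x : InfWord) : ℤ := ∑ i ∈ Finset.range j, ((x i : ℕ) : ℤ)

theorem countOnes_coding {α : ℝ} (h0 : 0 ≤ α) (h1 : α ≤ 1) (y : ℝ) (j : ℕ) :
    countOnes j (coding α y) = ⌊y + j * α⌋ - ⌊y⌋ := by
  induction j with
  | zero => simp [countOnes]
  | succ j ih =>
    rw [countOnes, Finset.sum_range_succ, ← countOnes, ih, val_coding h0 h1]
    push_cast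
    ring

/-- On the subshift of slope `α`, the numbers of ones in prefixes are controlled by a single point
`y` of the circle. -/
theorem exists_countOnes_eq {α : ℝ} (h0 : 0 ≤ α) (h1 : α ≤ 1) {x : InfWord}
    (hx : x ∈ sturmianShift α) (n : ℕ) :
    ∃ y : ℝ, 0 ≤ y ∧ y < 1 ∧ ∀ j ≤ n, countOnes j x = ⌊y + j * α⌋ := by
  obtain ⟨y, hy⟩ := exists_coding_of_mem_sturmianShift hx n
  refine ⟨Int.fract y, Int.fract_nonneg y, Int.fract_lt_one y, fun j hj => ?_⟩
  have e : coding α (Int.fract y) = coding α y := by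
    rw [← Int.self_sub_floor, sub_eq_add_neg, ← Int.cast_neg, coding_add_int]
  have h := countOnes_coding h0 h1 (Int.fract y) j
  rw [Int.floor_fract, sub_zero, e] at h
  rw [← h]
  exact Finset.sum_congr rfl fun i hi => by
    rw [hy i (lt_of_lt_of_le (Finset.mem_range.mp hi) hj)]

theorem measurable_countOnes (j : ℕ) : Measurable (countOnes j) := by
  unfold countOnes
  refine Finset.measurable_sum _ fun i _ => ?_
  exact (measurable_of_countable fun a : Fin 2 => ((a : ℕ) : ℤ)).comp (measurable_pi_apply i)

/-- The half-spaces `c ≤ countOnes j` generate the product σ-algebra. -/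
theorem generateFrom_countOnes :
    (inferInstance : MeasurableSpace InfWord) =
      MeasurableSpace.generateFrom {E | ∃ (j : ℕ) (c : ℤ), E = {x | c ≤ countOnes j x}} := by
  apply le_antisymm
  · set m := MeasurableSpace.generateFrom
      {E : Set InfWord | ∃ (j : ℕ) (c : ℤ), E = {x | c ≤ countOnes j x}} with hm
    have h1 : ∀ j, @Measurable _ _ m _ (countOnes j) := fun j =>
      @measurable_of_Ici _ _ _ _ _ m _ _ _ _ fun c =>
        MeasurableSpace.measurableSet_generateFrom ⟨j, c, rfl⟩
    have h2 : ∀ i, @Measurable _ _ m _ (fun x : InfWord => x i) := by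
      intro i
      have e : (fun x : InfWord => x i) =
          (fun p : ℤ × ℤ => Fin.ofNat 2 (p.1 - p.2).toNat) ∘
            fun x => (countOnes (i + 1) x, countOnes i x) := by
        funext x
        simp [countOnes, Finset.sum_range_succ]
      rw [e]
      exact (measurable_of_countable _).comp ((h1 (i + 1)).prodMk (h1 i))
    refine iSup_le fun i => ?_
    exact measurable_iff_comap_le.mp (h2 i)
  · refine MeasurableSpace.generateFrom_le ?_
    rintro _ ⟨j, c, rfl⟩
    exact measurable_countOnes j measurableSet_Ici

/-- Two measures that are carried by `S` agree if they agree on a generating family of sets whose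
traces on `S` form a chain. -/
theorem ext_of_generate_chain {X : Type*} {m : MeasurableSpace X} {μ ν : Measure X}
    [IsProbabilityMeasure μ] [IsProbabilityMeasure ν] {S : Set X} (hμ : μ Sᶜ = 0) (hν : ν Sᶜ = 0)
    {C : Set (Set X)} (hm : m = MeasurableSpace.generateFrom C)
    (hchain : ∀ s ∈ C, ∀ t ∈ C, s ∩ S ⊆ t ∨ t ∩ S ⊆ s) (h : ∀ s ∈ C, μ s = ν s) : μ = ν := by
  have hred : ∀ s ∈ generatePiSystem C, ∃ t ∈ C, s ∩ S = t ∩ S := by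
    intro s hs
    induction hs with
    | base hs => exact ⟨_, hs, rfl⟩
    | inter _ _ _ ih1 ih2 =>
      obtain ⟨t1, h1, e1⟩ := ih1
      obtain ⟨t2, h2, e2⟩ := ih2
      rcases hchain t1 h1 t2 h2 with hc | hc
      · refine ⟨t1, h1, ?_⟩
        rw [inter_inter_distrib_right, e1, e2, ← inter_inter_distrib_right, inter_right_comm]
        exact inter_eq_left.mpr hc
      · refine ⟨t2, h2, ?_⟩
        rw [inter_inter_distrib_right, e1, e2, ← inter_inter_distrib_right, inter_assoc]
        exact inter_eq_right.mpr hc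
  refine ext_of_generate_finite (generatePiSystem C)
    (by rw [generateFrom_generatePiSystem_eq, hm]) (isPiSystem_generatePiSystem C) ?_ (by simp)
  intro s hs
  obtain ⟨t, ht, e⟩ := hred s hs
  have hS : ∀ (ρ : Measure X), ρ Sᶜ = 0 → ∀ u, ρ (u ∩ S) = ρ u := fun ρ hρ u =>
    measure_inter_conull hρ
  rw [← hS μ hμ, ← hS ν hν, e, hS μ hμ, hS ν hν, h t ht]

theorem IsInvariantProb.integral_countOnes {μ : Measure InfWord} (hμ : IsInvariantProb μ) (j : ℕ) :
    ∫ x, (countOnes j x : ℝ) ∂μ = j * ∫ x, ((x 0 : ℕ) : ℝ) ∂μ := by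
  obtain ⟨_, hinv⟩ := hμ
  have hcont : ∀ i : ℕ, Continuous fun x : InfWord => ((x i : ℕ) : ℝ) := fun i =>
    (continuous_of_discreteTopology (f := fun a : Fin 2 => ((a : ℕ) : ℝ))).comp
      (continuous_apply i)
  have hint : ∀ i : ℕ, Integrable (fun x : InfWord => ((x i : ℕ) : ℝ)) μ := fun i =>
    (hcont i).integrable_of_hasCompactSupport (HasCompactSupport.of_compactSpace _)
  have h : ∀ i : ℕ, ∫ x, ((x i : ℕ) : ℝ) ∂μ = ∫ x, ((x 0 : ℕ) : ℝ) ∂μ := by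
    intro i
    have hp := hinv.iterate i
    have h := integral_map (μ := μ) hp.measurable.aemeasurable
      (f := fun x : InfWord => ((x 0 : ℕ) : ℝ)) (hcont 0).aestronglyMeasurable
    rw [hp.map_eq] at h
    rw [h]
    simp only [shift_iterate_apply, add_zero]
  simp only [countOnes, Int.cast_sum, Int.cast_natCast]
  rw [integral_finsetSum _ fun i _ => hint i]
  simp [h]

theorem countOnes_le_of_mem {α : ℝ} (h0 : 0 ≤ α) (h1 : α ≤ 1) {x : InfWord}
    (hx : x ∈ sturmianShift α) (j : ℕ) :
    ⌊j * α⌋ ≤ countOnes j x ∧ countOnes j x ≤ ⌊j * α⌋ + 1 := by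
  obtain ⟨y, hy0, hy1, h⟩ := exists_countOnes_eq h0 h1 hx j
  rw [h j le_rfl, ← Int.floor_add_one]
  exact ⟨Int.floor_le_floor (by linarith), Int.floor_le_floor (by linarith)⟩

theorem integrable_countOnes (μ : Measure InfWord) [IsFiniteMeasure μ] (j : ℕ) :
    Integrable (fun x => (countOnes j x : ℝ)) μ := by
  refine Continuous.integrable_of_hasCompactSupport ?_ (HasCompactSupport.of_compactSpace _)
  simp only [countOnes, Int.cast_sum, Int.cast_natCast]
  exact continuous_finsetSum _ fun i _ =>
    (continuous_of_discreteTopology (f := fun a : Fin 2 => ((a : ℕ) : ℝ))).comp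
      (continuous_apply i)

/-- The frequency of the letter `1` is the slope. -/
theorem IsSturmianMeasure.integral_apply_zero {α : ℝ} (h0 : 0 ≤ α) (h1 : α ≤ 1)
    {μ : Measure InfWord} (hμ : IsSturmianMeasure α μ) : ∫ x, ((x 0 : ℕ) : ℝ) ∂μ = α := by
  have := hμ.1.1
  set p := ∫ x, ((x 0 : ℕ) : ℝ) ∂μ
  have hj : ∀ j : ℕ, |(j : ℝ) * (p - α)| ≤ 1 := by
    intro j
    have hlow : ∫ _ : InfWord, ((j : ℝ) * α - 1) ∂μ ≤ ∫ x, (countOnes j x : ℝ) ∂μ := by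
      refine integral_mono_ae (integrable_const _) (integrable_countOnes μ j) ?_
      filter_upwards [hμ.ae_mem] with x hx
      have h2 : (⌊j * α⌋ : ℝ) ≤ countOnes j x := by
        exact_mod_cast (countOnes_le_of_mem h0 h1 hx j).1
      linarith [Int.lt_floor_add_one (j * α)]
    have hup : ∫ x, (countOnes j x : ℝ) ∂μ ≤ ∫ _ : InfWord, ((j : ℝ) * α + 1) ∂μ := by
      refine integral_mono_ae (integrable_countOnes μ j) (integrable_const _) ?_
      filter_upwards [hμ.ae_mem] with x hx
      have h2 : (countOnes j x : ℝ) ≤ ⌊j * α⌋ + 1 := by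
        exact_mod_cast (countOnes_le_of_mem h0 h1 hx j).2
      linarith [Int.floor_le (j * α)]
    rw [hμ.1.integral_countOnes] at hlow hup
    simp only [integral_const, probReal_univ, one_smul] at hlow hup
    rw [abs_le]
    constructor <;> linarith
  by_contra hne
  have hpos : 0 < |p - α| := abs_pos.mpr (sub_ne_zero.mpr hne)
  obtain ⟨j, hj'⟩ := exists_nat_gt (1 / |p - α|)
  have := hj j
  rw [abs_mul, Nat.abs_cast] at this
  rw [div_lt_iff₀ hpos] at hj'
  linarith

/-- On `S_α` the function `countOnes j` takes the values `⌊j α⌋` and `⌊j α⌋ + 1` only, and its mean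
is `j α`. -/
theorem IsSturmianMeasure.measure_countOnes {α : ℝ} (h0 : 0 ≤ α) (h1 : α ≤ 1)
    {μ : Measure InfWord} (hμ : IsSturmianMeasure α μ) (j : ℕ) (c : ℤ) :
    μ {x | c ≤ countOnes j x} = if c ≤ ⌊j * α⌋ then 1 else if c = ⌊j * α⌋ + 1 then
      ENNReal.ofReal (Int.fract (j * α)) else 0 := by
  have := hμ.1.1
  split_ifs with hc hc'
  · rw [← measure_univ (μ := μ)]
    refine measure_congr ?_
    filter_upwards [hμ.ae_mem] with x hx
    exact propext ⟨fun _ => trivial, fun _ => hc.trans (countOnes_le_of_mem h0 h1 hx j).1⟩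
  · have hE : MeasurableSet {x | c ≤ countOnes j x} := measurable_countOnes j measurableSet_Ici
    have h2 : ∫ x, (countOnes j x : ℝ) ∂μ =
        ∫ x, ((⌊j * α⌋ : ℝ) + {x | c ≤ countOnes j x}.indicator (1 : InfWord → ℝ) x) ∂μ := by
      refine integral_congr_ae ?_
      filter_upwards [hμ.ae_mem] with x hx
      obtain ⟨hx1, hx2⟩ := countOnes_le_of_mem h0 h1 hx j
      by_cases hx3 : c ≤ countOnes j x
      · have e : countOnes j x = ⌊j * α⌋ + 1 := by omega
        rw [indicator_of_mem (by exact hx3), e]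
        push_cast
        rfl
      · have e : countOnes j x = ⌊j * α⌋ := by omega
        rw [indicator_of_notMem (by exact hx3), e, add_zero]
    have hi : Integrable ({x | c ≤ countOnes j x}.indicator (1 : InfWord → ℝ)) μ :=
      (integrable_const (1 : ℝ)).indicator hE
    rw [hμ.1.integral_countOnes, hμ.integral_apply_zero h0 h1,
      integral_add (integrable_const _) hi, integral_indicator_one hE] at h2
    simp only [integral_const, probReal_univ, one_smul] at h2
    have e : μ.real {x | c ≤ countOnes j x} = Int.fract (j * α) := by
      rw [← Int.self_sub_floor]
      linarith
    rw [← e, ofReal_measureReal]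
  · refine measure_mono_null (t := (sturmianShift α)ᶜ) (fun x hx hxS => ?_) hμ.2
    have := (countOnes_le_of_mem h0 h1 hxS j).2
    have hx : c ≤ countOnes j x := hx
    omega

/-- The traces on `S_α` of the generating sets form a chain, since each of them is a lower bound on
the point of the circle that is coded. -/
theorem existsUnique_isSturmianMeasure {α : ℝ} (h0 : 0 ≤ α) (h1 : α ≤ 1) :
    ∃! μ : Measure InfWord, IsSturmianMeasure α μ := by
  refine ⟨_, isSturmianMeasure_map_coding α, fun μ hμ => ?_⟩
  have hν := isSturmianMeasure_map_coding α
  set ν := (volume.restrict (Ioc (0 : ℝ) 1)).map (coding α)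
  have := hμ.1.1
  have := hν.1.1
  refine ext_of_generate_chain hμ.2 hν.2 generateFrom_countOnes ?_ ?_
  · rintro _ ⟨i, c, rfl⟩ _ ⟨j, d, rfl⟩
    -- In terms of the point `y` of the circle, both conditions are lower bounds for `y`.
    have key : ∀ x ∈ sturmianShift α, ∃ y : ℝ, ∀ k : ℕ, k = i ∨ k = j → ∀ e : ℤ,
        (e ≤ countOnes k x ↔ e - k * α ≤ y) := by
      intro x hx
      obtain ⟨y, -, -, h⟩ := exists_countOnes_eq h0 h1 hx (max i j)
      refine ⟨y, fun k hk e => ?_⟩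
      rw [h k (by rcases hk with rfl | rfl <;> simp), Int.le_floor, sub_le_iff_le_add]
    rcases le_total ((c : ℝ) - i * α) (d - j * α) with hcd | hcd
    · right
      rintro x ⟨hx1, hx2⟩
      obtain ⟨y, hy⟩ := key x hx2
      exact (hy i (Or.inl rfl) c).mpr (hcd.trans ((hy j (Or.inr rfl) d).mp hx1))
    · left
      rintro x ⟨hx1, hx2⟩
      obtain ⟨y, hy⟩ := key x hx2
      exact (hy j (Or.inr rfl) d).mpr (hcd.trans ((hy i (Or.inl rfl) c).mp hx1))
  · rintro _ ⟨j, c, rfl⟩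
    rw [hμ.measure_countOnes h0 h1, hν.measure_countOnes h0 h1]

/-! ### Balanced pairs in triangular form -/

theorem hypMat_eq_smul (s u l : ℝ) : hypMat s u l =
    (s - u)⁻¹ • !![s * l - u * l⁻¹, s * u * (l⁻¹ - l); l - l⁻¹, s * l⁻¹ - u * l] := by
  have hdet : (!![s, u; 1, 1] : Mat2).det = s - u := by simp [Matrix.det_fin_two]
  rw [hypMat, Matrix.inv_def, hdet, Ring.inverse_eq_inv', Matrix.adjugate_fin_two_of]
  ext i j
  fin_cases i <;> fin_cases j <;> simp [Matrix.mul_apply, Fin.sum_univ_two] <;> ring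

theorem traceBalanced_hypMat {s₁ u₁ l₁ s₂ u₂ l₂ : ℝ} (hu : u₂ < u₁) (hu0 : u₁ < 0) (hs0 : 0 < s₁)
    (hs : s₁ < s₂) (h1 : 1 < l₁) (h2 : 1 < l₂) :
    TraceBalanced (hypMat s₁ u₁ l₁).trace (hypMat s₂ u₂ l₂).trace
      (hypMat s₁ u₁ l₁ * hypMat s₂ u₂ l₂).trace := by
  have d1 : 0 < s₁ - u₁ := by linarith
  have d2 : 0 < s₂ - u₂ := by linarith
  have p1 : 0 < l₁ := by linarith
  have p2 : 0 < l₂ := by linarith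
  have hl1 : 0 < l₁ - l₁⁻¹ := by linarith [inv_lt_one_of_one_lt₀ h1]
  have hl2 : 0 < l₂ - l₂⁻¹ := by linarith [inv_lt_one_of_one_lt₀ h2]
  have t : ∀ s u l : ℝ, s - u ≠ 0 → (hypMat s u l).trace = l + l⁻¹ := by
    intro s u l h
    rw [hypMat_eq_smul, Matrix.trace_smul, Matrix.trace_fin_two]
    simp
    field_simp
    ring
  rw [t _ _ _ d1.ne', t _ _ _ d2.ne']
  refine TraceBalanced.of_add_inv_lt h1.le h2.le ?_
  -- The excess over the commuting case is given by the cross-ratio of the fixed points.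
  have e : (hypMat s₁ u₁ l₁ * hypMat s₂ u₂ l₂).trace - (l₁ * l₂ + (l₁ * l₂)⁻¹) =
      (l₁ - l₁⁻¹) * (l₂ - l₂⁻¹) * ((s₂ - s₁) * (u₁ - u₂) / ((s₁ - u₁) * (s₂ - u₂))) := by
    rw [hypMat_eq_smul, hypMat_eq_smul, Matrix.smul_mul, Matrix.mul_smul,
      Matrix.trace_smul, Matrix.trace_smul, Matrix.trace_fin_two, mul_inv]
    simp [Matrix.mul_apply, Fin.sum_univ_two]
    have e1 : l₁ * l₁⁻¹ = 1 := mul_inv_cancel₀ p1.ne'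
    have e2 : l₂ * l₂⁻¹ = 1 := mul_inv_cancel₀ p2.ne'
    generalize l₁⁻¹ = m₁ at *
    generalize l₂⁻¹ = m₂ at *
    field_simp
    ring
  have : 0 < (l₁ - l₁⁻¹) * (l₂ - l₂⁻¹) * ((s₂ - s₁) * (u₁ - u₂) / ((s₁ - u₁) * (s₂ - u₂))) := by
    have : 0 < s₂ - s₁ := by linarith
    have : 0 < u₁ - u₂ := by linarith
    positivity
  linarith

theorem traceBalanced_hypMat_parMat {s u l x : ℝ} (hu : u < 0) (hs : 0 < s) (hl : 1 < l)
    (hx : 0 < x) :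
    TraceBalanced (hypMat s u l).trace (parMat x).trace (hypMat s u l * parMat x).trace := by
  have d : 0 < s - u := by linarith
  have p : 0 < l := by linarith
  have hl1 : 0 < l - l⁻¹ := by linarith [inv_lt_one_of_one_lt₀ hl]
  have t : (hypMat s u l).trace = l + l⁻¹ := by
    rw [hypMat_eq_smul, Matrix.trace_smul, Matrix.trace_fin_two]
    simp
    field_simp
    ring
  have t2 : (parMat x).trace = 1 + 1⁻¹ := by simp [parMat, Matrix.trace_fin_two]
  rw [t, t2]
  refine TraceBalanced.of_add_inv_lt hl.le le_rfl ?_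
  have e : (hypMat s u l * parMat x).trace - (l * 1 + (l * 1)⁻¹) =
      s * (-u) * (l - l⁻¹) * x / (s - u) := by
    rw [hypMat_eq_smul, Matrix.smul_mul, Matrix.trace_smul, Matrix.trace_fin_two, mul_one]
    simp [parMat, Matrix.mul_apply, Fin.sum_univ_two]
    generalize l⁻¹ = m at *
    field_simp
    ring
  have : 0 < s * (-u) * (l - l⁻¹) * x / (s - u) := by
    have : 0 < -u := by linarith
    positivity
  linarith

theorem traceBalanced_parMat {x y : ℝ} (hx : 0 < x) (hy : 0 < y) :
    TraceBalanced (parMat x).trace (parMat y)ᵀ.trace (parMat x * (parMat y)ᵀ).trace := by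
  have t : ∀ x : ℝ, (parMat x).trace = 1 + 1⁻¹ := fun x => by simp [parMat, Matrix.trace_fin_two]
  rw [Matrix.trace_transpose, t, t]
  refine TraceBalanced.of_add_inv_lt le_rfl le_rfl ?_
  have e : (parMat x * (parMat y)ᵀ).trace = 2 + x * y := by
    rw [Matrix.trace_fin_two, Matrix.mul_apply, Matrix.mul_apply]
    simp [parMat, Fin.sum_univ_two]
    ring
  have := mul_pos hx hy
  rw [e]
  norm_num
  exact this

theorem traceBalanced_of_pair_eq {C D X Y : Mat2} (h : ({C, D} : Set Mat2) = {X, Y})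
    (hXY : TraceBalanced X.trace Y.trace (X * Y).trace) :
    TraceBalanced C.trace D.trace (C * D).trace := by
  rcases Set.pair_eq_pair_iff.mp h with ⟨rfl, rfl⟩ | ⟨rfl, rfl⟩
  · exact hXY
  · rw [Matrix.trace_mul_comm]
    exact hXY.symm

theorem IsNormalForm.traceBalanced {C D : Mat2} (h : IsNormalForm C D) :
    TraceBalanced C.trace D.trace (C * D).trace := by
  rcases h with ⟨s₁, u₁, l₁, s₂, u₂, l₂, h1, h2, h3, h4, h5, h6, e⟩ |
    ⟨s, u, l, x, h1, h2, h3, h4, e⟩ | ⟨x, y, h1, h2, e⟩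
  · exact traceBalanced_of_pair_eq e (traceBalanced_hypMat h1 h2 h3 h4 h5 h6)
  · exact traceBalanced_of_pair_eq e (traceBalanced_hypMat_parMat h1 h2 h3 h4)
  · exact traceBalanced_of_pair_eq e (traceBalanced_parMat h1 h2)

theorem IsUnimodularBalancedPair.traceBalanced {A B : Mat2} (h : IsUnimodularBalancedPair A B) :
    TraceBalanced A.trace B.trace (A * B).trace := by
  obtain ⟨-, -, T, h⟩ := h
  have h := h.traceBalanced
  have hT : T.val * (T⁻¹ : GL (Fin 2) ℝ).val = 1 := by
    rw [← Units.val_mul, mul_inv_cancel, Units.val_one]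
  have tr_conj : ∀ Z : Mat2, ((T⁻¹ : GL (Fin 2) ℝ).val * Z * T.val).trace = Z.trace := fun Z => by
    rw [Matrix.trace_mul_comm, ← Matrix.mul_assoc, hT, Matrix.one_mul]
  have e : (T⁻¹ : GL (Fin 2) ℝ).val * A * T.val * ((T⁻¹ : GL (Fin 2) ℝ).val * B * T.val) =
      (T⁻¹ : GL (Fin 2) ℝ).val * (A * B) * T.val := by
    calc _ = (T⁻¹ : GL (Fin 2) ℝ).val * A * (T.val * (T⁻¹ : GL (Fin 2) ℝ).val) * B * T.val := by
          simp only [Matrix.mul_assoc]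
      _ = _ := by rw [hT]; simp only [Matrix.mul_assoc, Matrix.one_mul]
  rwa [e, tr_conj, tr_conj, tr_conj] at h

theorem nonnegBalanced_triangular {l m p r : ℝ} (hl : 1 ≤ l) (hm : 1 ≤ m) (hp : 0 < p)
    (hr : 0 < r) (h : (l - l⁻¹) * (m - m⁻¹) < p * r) :
    NonnegBalanced ![!![l, p; 0, l⁻¹], !![m⁻¹, 0; r, m]] where
  det_eq_one i := by
    have hl0 : l ≠ 0 := by positivity
    have hm0 : m ≠ 0 := by positivity
    fin_cases i <;> simp [Matrix.det_fin_two, hl0, hm0]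
  nonneg i a b := by
    have hl0 : 0 ≤ l := by positivity
    have hm0 : 0 ≤ m := by positivity
    fin_cases i <;> fin_cases a <;> fin_cases b <;> simp [hl0, hm0, hp.le, hr.le]
  pos a b := by
    have hl0 : 0 < l := by positivity
    have hm0 : 0 < m := by positivity
    fin_cases a <;> fin_cases b <;> simp [Matrix.mul_apply, Fin.sum_univ_two] <;> positivity
  traceBalanced := by
    have e0 : ((![!![l, p; 0, l⁻¹], !![m⁻¹, 0; r, m]] : Fin 2 → Mat2) 0).trace = l + l⁻¹ := by
      simp [Matrix.trace_fin_two]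
    have e1 : ((![!![l, p; 0, l⁻¹], !![m⁻¹, 0; r, m]] : Fin 2 → Mat2) 1).trace = m + m⁻¹ := by
      simp [Matrix.trace_fin_two, add_comm]
    rw [e0, e1]
    refine TraceBalanced.of_add_inv_lt hl hm ?_
    rw [Matrix.trace_fin_two, mul_inv]
    simp [Matrix.mul_apply, Fin.sum_univ_two]
    nlinarith

/-- A balanced pair becomes a nonnegative unimodular one after scaling and conjugation. -/
theorem IsBalancedPair.exists_nonnegBalanced {M : Fin 2 → Mat2} (hM : IsBalancedPair M) :
    ∃ (N : Fin 2 → Mat2) (c : Fin 2 → ℝ) (S T : Mat2), NonnegBalanced N ∧ (∀ i, c i ≠ 0) ∧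
      S * T = 1 ∧ T * S = 1 ∧ ∀ i, N i = S * (c i • M i) * T := by
  obtain ⟨-, -, a, b, hab⟩ := hM
  have hbal := hab.traceBalanced
  obtain ⟨⟨hA, -, -⟩, ⟨hB, -, -⟩, -⟩ := hab
  have ha : a ≠ 0 := by
    rintro rfl
    simp at hA
  have hb : b ≠ 0 := by
    rintro rfl
    simp at hB
  obtain ⟨S, T, p, r, hST, hTS, hp, hr, hpr, hX, hY⟩ := hbal.exists_triangular hA hB
  refine ⟨_, ![a, b], S, T, nonnegBalanced_triangular (one_le_specRad hbal.1)
    (one_le_specRad hbal.2.1) hp hr hpr, ?_, hST, hTS, ?_⟩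
  · intro i
    match i with
    | 0 => exact ha
    | 1 => exact hb
  · intro i
    match i with
    | 0 => exact hX.symm
    | 1 => exact hY.symm

theorem wordMat_smul (M : Fin 2 → Mat2) (c : Fin 2 → ℝ) (w : List (Fin 2)) :
    wordMat (fun i => c i • M i) w = (c 0 ^ w.count 0 * c 1 ^ w.count 1) • wordMat M w := by
  induction w with
  | nil => simp [wordMat]
  | cons i w ih =>
    rw [wordMat, ih, wordMat, Matrix.smul_mul, Matrix.mul_smul, smul_smul]
    congr 1
    match i with
    | 0 => simp; ring
    | 1 => simp; ring

theorem count_one_prefixWord (x : InfWord) (m : ℕ) :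
    ((prefixWord x m).count 1 : ℤ) = countOnes m x := by
  induction m with
  | zero => simp [prefixWord, countOnes]
  | succ m ih =>
    rw [prefixWord, List.range_succ, List.map_append, List.count_append, ← prefixWord, countOnes,
      Finset.sum_range_succ, ← countOnes, ← ih]
    push_cast
    congr 1
    simp only [List.map_cons, List.map_nil]
    generalize x m = a
    match a with
    | 0 => simp
    | 1 => simp

theorem count_zero_add_count_one (w : List (Fin 2)) : w.count 0 + w.count 1 = w.length := by
  induction w with
  | nil => simp
  | cons i w ih =>
    match i with
    | 0 => simp; omega
    | 1 => simp; omega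

/-- Scaling and conjugation change the Lyapunov exponent of the Sturmian measure of slope `α` by an
affine function of `α`. -/
theorem IsSturmianMeasure.lyapunovExponent_scale_conj {M N : Fin 2 → Mat2} (hN : NonnegBalanced N)
    {c : Fin 2 → ℝ} {S T : Mat2} (hM : ∀ i, (M i).det ≠ 0) (hc : ∀ i, c i ≠ 0) (hST : S * T = 1)
    (hTS : T * S = 1) (hMN : ∀ i, N i = S * (c i • M i) * T) {α : ℝ} (h0 : 0 ≤ α) (h1 : α ≤ 1)
    {μ : Measure InfWord} (hμ : IsSturmianMeasure α μ) :
    lyapunovExponent M μ = lyapunovExponent N μ -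
      ((1 - α) * Real.log |c 0| + α * Real.log |c 1|) := by
  have := hμ.1.1
  set κ := (1 - α) * Real.log |c 0| + α * Real.log |c 1| with hκ
  have hS : 0 < hsNorm S := hsNorm_pos fun h => by
    have := congrArg Matrix.det hST
    simp [Matrix.det_mul, h] at this
  have hT : 0 < hsNorm T := hsNorm_pos fun h => by
    have := congrArg Matrix.det hST
    simp [Matrix.det_mul, h] at this
  set C := |Real.log (hsNorm S) + Real.log (hsNorm T)| + |(Real.log |c 1| - Real.log |c 0|)|
    with hC
  have key : ∀ x ∈ sturmianShift α, ∀ m : ℕ, |Real.log (hsNorm (cocycle M x m)) -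
      (Real.log (hsNorm (cocycle N x m)) + m * -κ)| ≤ C := by
    intro x hx m
    have hm := hsNorm_pos (det_cocycle_ne_zero hM x m)
    have hn := hsNorm_pos (det_cocycle_ne_zero hN.det_ne_zero x m)
    rw [cocycle_eq_wordMat, ← prefixWord] at hm hn ⊢
    rw [cocycle_eq_wordMat, ← prefixWord]
    have hlen := count_zero_add_count_one (prefixWord x m)
    rw [length_prefixWord] at hlen
    have hone := countOnes_le_of_mem h0 h1 hx m
    rw [← count_one_prefixWord] at hone
    set w := prefixWord x m
    have e1 : wordMat N w = S * ((c 0 ^ w.count 0 * c 1 ^ w.count 1) • wordMat M w) * T := by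
      rw [← wordMat_smul, ← wordMat_conj _ hTS hST]
      congr 1
      funext i
      exact hMN i
    set k := c 0 ^ w.count 0 * c 1 ^ w.count 1 with hk
    have hk0 : k ≠ 0 := mul_ne_zero (pow_ne_zero _ (hc 0)) (pow_ne_zero _ (hc 1))
    have hk1 : 0 < |k| := abs_pos.mpr hk0
    have e2 : k • wordMat M w = T * wordMat N w * S := by
      calc k • wordMat M w = (T * S) * (k • wordMat M w) * (T * S) := by rw [hTS]; simp
        _ = T * wordMat N w * S := by rw [e1]; simp only [Matrix.mul_assoc]
    have b1 := Real.log_le_log hn (e1 ▸ hsNorm_mul_mul_le S (k • wordMat M w) T)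
    have b2 := Real.log_le_log (by rw [hsNorm_smul]; positivity)
      (e2 ▸ hsNorm_mul_mul_le T (wordMat N w) S)
    rw [hsNorm_smul, Real.log_mul (by positivity) (by positivity),
      Real.log_mul (by positivity) (by positivity),
      Real.log_mul (by positivity) (by positivity)] at b1
    rw [hsNorm_smul, Real.log_mul (by positivity) (by positivity),
      Real.log_mul (by positivity) (by positivity),
      Real.log_mul (by positivity) (by positivity)] at b2
    have hlk : Real.log |k| = w.count 0 * Real.log |c 0| + w.count 1 * Real.log |c 1| := by
      have a0 : |c 0| ≠ 0 := abs_ne_zero.mpr (hc 0)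
      have a1 : |c 1| ≠ 0 := abs_ne_zero.mpr (hc 1)
      rw [hk, abs_mul, abs_pow, abs_pow, Real.log_mul (pow_ne_zero _ a0) (pow_ne_zero _ a1),
        Real.log_pow, Real.log_pow]
    have hlen' : (w.count 0 : ℝ) = m - w.count 1 := by
      rw [← hlen]; push_cast; ring
    have hcount : |(w.count 1 : ℝ) - m * α| ≤ 1 := by
      have h2 : (⌊m * α⌋ : ℝ) ≤ w.count 1 := by exact_mod_cast hone.1
      have h3 : (w.count 1 : ℝ) ≤ ⌊m * α⌋ + 1 := by exact_mod_cast hone.2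
      rw [abs_le]
      constructor <;> linarith [Int.floor_le (m * α), Int.lt_floor_add_one (m * α)]
    have e3 : Real.log |k| - m * κ =
        ((w.count 1 : ℝ) - m * α) * (Real.log |c 1| - Real.log |c 0|) := by
      rw [hlk, hlen', hκ]; ring
    have h4 : |Real.log |k| - m * κ| ≤ |(Real.log |c 1| - Real.log |c 0|)| := by
      rw [e3, abs_mul]
      exact mul_le_of_le_one_left (abs_nonneg _) hcount
    have h5 := le_abs_self (Real.log (hsNorm S) + Real.log (hsNorm T))
    rw [abs_le] at h4 ⊢
    constructor <;> linarith [h4.1, h4.2]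
  have hintM := fun m => integrable_log_hsNorm_cocycle hM μ m
  have hintN := fun m => integrable_log_hsNorm_cocycle hN.det_ne_zero μ m
  have hlim : ∀ D : ℝ, Tendsto (fun m : ℕ => lyapunovSeq N μ m + (1 / (m : ℝ)) * (m * -κ + D))
      atTop (𝓝 (lyapunovExponent N μ - κ)) := fun D =>
    (tendsto_lyapunovSeq hN.det_ne_zero hμ.1).add (tendsto_add_div_nat (-κ) D)
  have hI : ∀ (D : ℝ) (m : ℕ), ∫ x, (Real.log (hsNorm (cocycle N x m)) + (m * -κ + D)) ∂μ =
      ∫ x, Real.log (hsNorm (cocycle N x m)) ∂μ + (m * -κ + D) := by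
    intro D m
    rw [integral_add (hintN m) (integrable_const _)]
    simp
  apply le_antisymm
  · refine le_of_tendsto_of_tendsto' (tendsto_lyapunovSeq hM hμ.1) (hlim C) fun m => ?_
    rw [lyapunovSeq, lyapunovSeq, ← mul_add, ← hI]
    refine mul_le_mul_of_nonneg_left ?_ (by positivity)
    refine integral_mono_ae (hintM m) ((hintN m).add (integrable_const _)) ?_
    filter_upwards [hμ.ae_mem] with x hx
    linarith [(abs_le.mp (key x hx m)).2]
  · refine le_of_tendsto_of_tendsto' (hlim (-C)) (tendsto_lyapunovSeq hM hμ.1) fun m => ?_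
    rw [lyapunovSeq, lyapunovSeq, ← mul_add, ← hI]
    refine mul_le_mul_of_nonneg_left ?_ (by positivity)
    refine integral_mono_ae ((hintN m).add (integrable_const _)) (hintM m) ?_
    filter_upwards [hμ.ae_mem] with x hx
    linarith [(abs_le.mp (key x hx m)).1]

theorem lemma4p6 (M : Fin 2 → Mat2) (hM : IsBalancedPair M) :
    (∀ α ∈ Set.Icc (0 : ℝ) 1, ∃! μ : Measure InfWord, IsSturmianMeasure α μ) ∧
    ContinuousOn (fun α : ℝ => lyapunovExponent M (sturmianMeasure α)) (Set.Icc 0 1) ∧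
    StrictConcaveOn ℝ (Set.Icc 0 1) (fun α : ℝ => lyapunovExponent M (sturmianMeasure α)) ∧
    (∀ α ∈ Set.Icc (0 : ℝ) 1, ∀ β ∈ Set.Icc (0 : ℝ) 1,
      IsMaximizingMeasure M (sturmianMeasure α) → IsMaximizingMeasure M (sturmianMeasure β) →
        α = β) := by
  have hex : ∀ α ∈ Icc (0 : ℝ) 1, ∃! μ : Measure InfWord, IsSturmianMeasure α μ :=
    fun α hα => existsUnique_isSturmianMeasure hα.1 hα.2
  have hμ : ∀ α ∈ Icc (0 : ℝ) 1, IsSturmianMeasure α (sturmianMeasure α) := by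
    intro α hα
    have h : ∃ μ : Measure InfWord, IsSturmianMeasure α μ := (hex α hα).exists
    rw [sturmianMeasure, dif_pos h]
    exact h.choose_spec
  have hdet : ∀ i, (M i).det ≠ 0 := by
    intro i
    match i with
    | 0 => exact hM.1.ne'
    | 1 => exact hM.2.1.ne'
  obtain ⟨N, c, S, T, hN, hc, hST, hTS, hMN⟩ := hM.exists_nonnegBalanced
  have heq : EqOn (fun α => lyapunovExponent N (sturmianMeasure α) +
      -((1 - α) * Real.log |c 0| + α * Real.log |c 1|))
      (fun α => lyapunovExponent M (sturmianMeasure α)) (Icc 0 1) := fun α hα =>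
    ((hμ α hα).lyapunovExponent_scale_conj hN hdet hc hST hTS hMN hα.1 hα.2).symm
  have hconc : StrictConcaveOn ℝ (Icc 0 1) fun α => lyapunovExponent M (sturmianMeasure α) := by
    refine ((hN.strictConcaveOn_lyapunovExponent hμ).add_concaveOn ?_).congr heq
    refine ⟨convex_Icc 0 1, fun x _ y _ a b _ _ hab => le_of_eq ?_⟩
    simp only [smul_eq_mul]
    linear_combination (-Real.log |c 0|) * hab
  refine ⟨hex, ?_, hconc, fun α hα β hβ hmα hmβ => ?_⟩
  · refine ContinuousOn.congr ((hN.continuousOn_lyapunovExponent hμ).add ?_) heq.symm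
    fun_prop
  · by_contra hne
    have hmid := convex_Icc (0 : ℝ) 1 hα hβ (by norm_num : (0 : ℝ) ≤ 1 / 2)
      (by norm_num : (0 : ℝ) ≤ 1 / 2) (by norm_num)
    have h1 := hconc.2 hα hβ hne (by norm_num : (0 : ℝ) < 1 / 2) (by norm_num : (0 : ℝ) < 1 / 2)
      (by norm_num)
    have h2 := hmα.2 _ (hμ _ hmid).1
    have h3 := hmβ.2 _ (hμ _ hmid).1
    simp only [smul_eq_mul] at h1 h2 h3
    linarith
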